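/- **Setting.** Minkowski space $\mathbb R^{1,3}$ has metric $\mathrm{diag}(1,-1,-1,-1)$, $\sigma^\mu=(1,\vec\sigma)$. A superfunction of four points assigns to $(x_1,\dots,x_4)\in(\mathbb R^{1,3})^4$ an element of the complex Grassmann algebra generated by $\theta_i^\alpha,\bar\theta_i^{\dot\alpha}$ ($i=1,\dots,4$; $\alpha,\dot\alpha=1,2$). It is considered on the set $U$ of pairwise space-like separated configurations. Functions and powers of even elements are defined by Taylor expansion about the body (the value at $\theta=\bar\theta=0$), powers with the principal branch at the body. Put $x_{i\pm}^\mu=x_i^\mu\mp i\theta_i\sigma^\mu\bar\theta_i$, $$x_{\bar ij}^\mu=x_{i-}^\mu-x_{j+}^\mu-2i\theta_j\sigma^\mu\bar\theta_i,\quad \mathrm x_{\bar ij}=x^\mu_{\bar ij}\sigma_\mu,\quad \tilde{\mathrm x}_{\bar ij}=x^\mu_{\bar ij}\tilde\sigma_\mu,\quad \mathrm x_{\bar ij}^{-1}=\tilde{\mathrm x}_{\bar ij}/x_{\bar ij}^2,\quad \tilde{\mathrm x}_{\bar ij}^{-1}=\mathrm x_{\bar ij}/x_{\bar ij}^2 ,$$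 $\theta_{ij}=\theta_i-\theta_j$, $\bar\theta_{ij}=\bar\theta_i-\bar\theta_j$, $\rho_{ij}=\theta_{ij}\tilde{\mathrm x}_{\bar ij}^{-1}\bar\theta_{ij}$, and $$\mathcal I_1=\frac{x_{\bar14}^2x_{\bar32}^2}{x_{\bar12}^2x_{\bar34}^2},\quad \mathcal I_2=\frac{x_{\bar14}^2x_{\bar23}^2}{x_{\bar13}^2x_{\bar24}^2},\quad \mathcal I_6=\frac{x_{\bar13}^2x_{\bar42}^2}{x_{\bar12}^2x_{\bar43}^2},\quad X_+^2=\frac{x_{\bar24}^2}{x_{\bar21}^2x_{\bar14}^2},\quad X_-^2=\frac{x_{\bar42}^2}{x_{\bar41}^2x_{\bar12}^2},\quad J=\frac{X_+^2}{X_-^2}.$$ For $k,i,j\in\{1,2\}$ let $$\tilde\Theta_{(i)}=i\big(\tilde{\mathrm x}_{\bar41}^{-1}\bar\theta_{41}-\tilde{\mathrm x}_{\overline{i+1}\,1}^{-1}\bar\theta_{i+1,1}\big),\qquad \tilde{\bar\Theta}_{(j)}=i\big(\theta_{1,j+1}\tilde{\mathrm x}_{\bar1\,j+1}^{-1}-\theta_{14}\tilde{\mathrm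 x}_{\bar14}^{-1}\big)$$ (the prefactor $i$ is the imaginary unit), $\tilde{\mathrm X}_{(1)}=-\mathrm x_{\bar14}^{-1}\mathrm x_{\bar24}\mathrm x_{\bar21}^{-1}$, $\tilde{\mathrm X}_{(2)}=\mathrm x_{\bar13}^{-1}\mathrm x_{\bar43}\mathrm x_{\bar41}^{-1}$. The eight nilpotent invariants are $I_{kij}=-\tilde{\bar\Theta}_{(j)}\tilde{\mathrm X}_{(k)}\tilde\Theta_{(i)}/\sqrt{X_+^2X_-^2}$ (positive root at the body). Finally let $T=T_{222}+T_\Sigma-T_{212}$, where $$T_{222}=-\rho_{14}+\rho_{13}+\rho_{34}+2i(\rho_{14}^2-\rho_{13}^2-\rho_{34}^2),\qquad T_\Sigma=-\rho_{13}+\rho_{12}+\rho_{23}+2i(\rho_{13}^2-\rho_{12}^2-\rho_{23}^2),$$ $$T_{212}=C+2iC^2,\qquad C=\mathcal I_6\,\sqrt J\,I_{212},$$ and $\mathcal D=4i\,T\,\mathcal I_1\,\partial/\partial\mathcal I_1$. Here $e^{\mathcal D}[f(\mathcal I_1,\mathcal I_2)/N]$ means $\frac1N\sum_k\frac{(4iT)^k}{k!}\big((\mathcal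 I_1\partial_{\mathcal I_1})^kf\big)(\mathcal I_1,\mathcal I_2)$, a finite sum. A superfunction is superconformally covariant with scale dimensions $\eta_i$ and R-charges $\kappa_i$ (real numbers) if it is real analytic on $U$ and satisfies there the $\mathcal N=1$ superconformal Ward identities, i.e. is annihilated by the generators $Q,\bar Q,S,\bar S$ acting on four scalar superfields with these weights (they generate the whole algebra). It is a four-point function $\langle\bar\Phi_1\bar\Phi_2\Phi_3\Phi_4\rangle$ of two anti-chiral and two chiral scalar superfields if moreover $D_1,D_2,\bar D_3,\bar D_4$ annihilate it, where $D=\partial_\theta-i\sigma^\mu\bar\theta\,\partial_\mu$ and $\bar D=-\partial_{\bar\theta}+i\theta\sigma^\mu\partial_\mu$ at the respective point. **Theorem.** Let $\sum_i\kappa_i=0$ (vanishing total R-charge). 1. Every four-point function $\langle\bar\Phi_1\bar\Phi_2\Phi_3\Phi_4\rangle$ is, on $U$, of the form $$\langle\bar\Phi_1\bar\Phi_2\Phi_3\Phi_4\rangle=e^{\mathcal D}\left[\frac{f_{0,1}(\mathcal I_1,\mathcal I_2)}{x_{\bar13}^{2(\eta_3-\eta_2)}\,x_{\bar14}^{2\eta_4}\,x_{\bar23}^{2\eta_2}}\right]$$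 with a real-analytic function $f_{0,1}:(0,\infty)^2\to\mathbb C$. It is the zeroth-order coefficient of the expansion in the nilpotent invariants: whenever $\langle\bar\Phi_1\bar\Phi_2\Phi_3\Phi_4\rangle\,x_{\bar13}^{2(\eta_3-\eta_2)}x_{\bar14}^{2\eta_4}x_{\bar23}^{2\eta_2}$ is written as a finite sum $\sum_m c_m(\mathcal I_1,\mathcal I_2)\prod_{k,i,j} I_{kij}^{m_{kij}}$, one has $c_0=f_{0,1}$. 2. $f_{0,1}$ is arbitrary: if $\kappa_i=\eta_i/3$ for $i=1,2$ and $\kappa_i=-\eta_i/3$ for $i=3,4$ (the relation valid for anti-chiral and chiral fields), then for every real-analytic $f_{0,1}:(0,\infty)^2\to\mathbb C$ the right-hand side is such a four-point function. 3. $T$ is superconformally invariant (covariant with all $\eta_i=\kappa_i=0$) and nilpotent. -/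

import Mathlib

/-!
# Four-point functions of chiral superfields in `N = 1` superconformal field theory

Conventions.  The four points `1, 2, 3, 4` are the elements `0, 1, 2, 3` of `Fin 4`.  Fields are
placed at `1, 2` (anti-chiral) and `3, 4` (chiral).  Space-time is `ℝ^{1,3}` with metric
`diag (1, -1, -1, -1)`.  Spinor indices `α` and `α̇` run through `Fin 2`.  A superfunction of four
points is a function of the four real space-time points with values in the complex Grassmann
algebra on the sixteen generators `θ_i^α`, `θ̄_i^α̇`.
-/

namespace ChiralFourPoint

noncomputable section

/-! ### The Grassmann algebra and superfunctions -/

/-- Labels of the Grassmann generators: `inl (i, α)` for `θ_i^α`, `inr (i, α̇)` for `θ̄_i^α̇`. -/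
abbrev OddIndex : Type := (Fin 4 × Fin 2) ⊕ (Fin 4 × Fin 2)

/-- The complex Grassmann algebra with sixteen generators. -/
abbrev Grassmann : Type := ExteriorAlgebra ℂ (OddIndex → ℂ)

instance : Module.Finite ℂ Grassmann := by
  let _ : LinearOrder OddIndex := LinearOrder.lift' (Fintype.equivFin OddIndex)
    (Fintype.equivFin OddIndex).injective
  exact Module.Finite.of_basis ((Pi.basisFun ℂ OddIndex).ExteriorAlgebra)

/-- A norm on the finite-dimensional space `Grassmann` (all norms are equivalent; it is only used
to speak about derivatives and analyticity of Grassmann-valued functions). -/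
instance : NormedAddCommGroup Grassmann :=
  NormedAddCommGroup.induced Grassmann (Fin (Module.finrank ℂ Grassmann) → ℂ)
    (Module.finBasis ℂ Grassmann).equivFun (Module.finBasis ℂ Grassmann).equivFun.injective

instance : NormedSpace ℂ Grassmann :=
  NormedSpace.induced ℂ Grassmann (Fin (Module.finrank ℂ Grassmann) → ℂ)
    (Module.finBasis ℂ Grassmann).equivFun

/-- Four points of Minkowski space: `x i μ` is the coordinate `x_i^μ`. -/
abbrev Configuration : Type := Fin 4 → Fin 4 → ℝ

/-- Superfunctions of four superspace points. -/
abbrev SuperFun : Type := Configuration → Grassmann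

/-- The generator `θ_i^α`. -/
def θ (i : Fin 4) (α : Fin 2) : Grassmann :=
  ExteriorAlgebra.ι ℂ (Pi.single (Sum.inl (i, α)) 1)

/-- The generator `θ̄_i^α̇`. -/
def θbar (i : Fin 4) (α : Fin 2) : Grassmann :=
  ExteriorAlgebra.ι ℂ (Pi.single (Sum.inr (i, α)) 1)

/-- The left derivative `∂/∂θ_i^α`. -/
def dθ (i : Fin 4) (α : Fin 2) : Grassmann →ₗ[ℂ] Grassmann :=
  CliffordAlgebra.contractLeft (LinearMap.proj (Sum.inl (i, α)) : (OddIndex → ℂ) →ₗ[ℂ] ℂ)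

/-- The left derivative `∂/∂θ̄_i^α̇`. -/
def dθbar (i : Fin 4) (α : Fin 2) : Grassmann →ₗ[ℂ] Grassmann :=
  CliffordAlgebra.contractLeft (LinearMap.proj (Sum.inr (i, α)) : (OddIndex → ℂ) →ₗ[ℂ] ℂ)

/-- The derivative `∂/∂x_i^μ` of a superfunction. -/
def dx (i μ : Fin 4) (G : SuperFun) : SuperFun :=
  fun x => fderiv ℝ G x (Pi.single i (Pi.single μ 1))

/-- The body of a Grassmann number: its value when all generators are set to zero. -/
def body : Grassmann →ₐ[ℂ] ℂ := ExteriorAlgebra.algebraMapInv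

/-- The nilpotent part of a Grassmann number. -/
def soul (a : Grassmann) : Grassmann := a - algebraMap ℂ Grassmann (body a)

/-- The real power `a ^ r` of an even Grassmann number with non-zero body, by the (terminating)
Taylor expansion of the principal branch of the power about the body. -/
def spow (a : Grassmann) (r : ℝ) : Grassmann :=
  ∑ k ∈ Finset.range 17,
    (((∏ j ∈ Finset.range k, ((r : ℂ) - j)) / (k.factorial : ℂ)) * body a ^ ((r : ℂ) - k)) •
      soul a ^ k

/-- The inverse of an even Grassmann number with non-zero body. -/
def sinv (a : Grassmann) : Grassmann := spow a (-1)

/-- The value `f (a, b)` of a function of two real variables at two even Grassmann numbers with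
real bodies, by the (terminating) Taylor expansion about the bodies. -/
def superEval (f : ℝ × ℝ → ℂ) (a b : Grassmann) : Grassmann :=
  ∑ k ∈ Finset.range 17, ∑ l ∈ Finset.range 17,
    (iteratedDeriv k (fun s => iteratedDeriv l (fun t => f (s, t)) (body b).re) (body a).re /
      ((k.factorial : ℂ) * (l.factorial : ℂ))) • (soul a ^ k * soul b ^ l)

/-! ### Pauli matrices, chiral coordinates and intervals -/

/-- `σ^μ`, with lower spinor indices `α α̇`. -/
def pauli : Fin 4 → Matrix (Fin 2) (Fin 2) ℂ :=
  ![!![1, 0; 0, 1], !![0, 1; 1, 0], !![0, -Complex.I; Complex.I, 0], !![1, 0; 0, -1]]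

/-- The diagonal of the Minkowski metric. -/
def metric : Fin 4 → ℂ := ![1, -1, -1, -1]

/-- `σ_μ`, with lower spinor indices `α α̇`. -/
def sigmaLower (μ : Fin 4) : Matrix (Fin 2) (Fin 2) ℂ := metric μ • pauli μ

/-- `σ̃_μ`, with upper spinor indices `α̇ α`; as `σ̃^μ = (1, -σ)`, this is `(1, σ)`. -/
def sigmaTildeLower (μ : Fin 4) : Matrix (Fin 2) (Fin 2) ℂ := pauli μ

/-- The vector `θ_j σ^μ θ̄_i`. -/
def θσθbar (j i μ : Fin 4) : Grassmann :=
  ∑ α : Fin 2, ∑ β : Fin 2, pauli μ α β • (θ j α * θbar i β)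

/-- `x_{i+}^μ = x_i^μ - i θ_i σ^μ θ̄_i`. -/
def xPlus (i μ : Fin 4) : SuperFun := fun x =>
  algebraMap ℂ Grassmann (x i μ) - Complex.I • θσθbar i i μ

/-- `x_{i-}^μ = x_i^μ + i θ_i σ^μ θ̄_i`. -/
def xMinus (i μ : Fin 4) : SuperFun := fun x =>
  algebraMap ℂ Grassmann (x i μ) + Complex.I • θσθbar i i μ

/-- The interval `x_{īj}^μ = x_{i-}^μ - x_{j+}^μ - 2 i θ_j σ^μ θ̄_i`. -/
def interval (i j μ : Fin 4) : SuperFun := fun x =>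
  xMinus i μ x - xPlus j μ x - (2 * Complex.I) • θσθbar j i μ

/-- The square `x_{īj}²`. -/
def sq (i j : Fin 4) : SuperFun := fun x => ∑ μ : Fin 4, metric μ • interval i j μ x ^ 2

/-- The matrix `𝐱_{īj}`, with lower indices `α α̇`. -/
def mat (i j : Fin 4) (x : Configuration) : Matrix (Fin 2) (Fin 2) Grassmann :=
  Matrix.of fun α β => ∑ μ : Fin 4, sigmaLower μ α β • interval i j μ x

/-- The matrix `𝐱̃_{īj}`, with upper indices `α̇ α`. -/
def matTilde (i j : Fin 4) (x : Configuration) : Matrix (Fin 2) (Fin 2) Grassmann :=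
  Matrix.of fun β α => ∑ μ : Fin 4, sigmaTildeLower μ β α • interval i j μ x

/-- `𝐱_{īj}⁻¹ = 𝐱̃_{īj} / x_{īj}²`. -/
def matInv (i j : Fin 4) (x : Configuration) : Matrix (Fin 2) (Fin 2) Grassmann :=
  sinv (sq i j x) • matTilde i j x

/-- `𝐱̃_{īj}⁻¹ = 𝐱_{īj} / x_{īj}²`. -/
def matTildeInv (i j : Fin 4) (x : Configuration) : Matrix (Fin 2) (Fin 2) Grassmann :=
  sinv (sq i j x) • mat i j x

/-- The contraction of a matrix with two spinors, in the order row, matrix, column. -/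
def contract (u : Fin 2 → Grassmann) (M : Matrix (Fin 2) (Fin 2) Grassmann)
    (v : Fin 2 → Grassmann) : Grassmann :=
  ∑ a : Fin 2, ∑ b : Fin 2, u a * M a b * v b

/-- `θ_{ij} = θ_i - θ_j`. -/
def θdiff (i j : Fin 4) (α : Fin 2) : Grassmann := θ i α - θ j α

/-- `θ̄_{ij} = θ̄_i - θ̄_j`. -/
def θbarDiff (i j : Fin 4) (α : Fin 2) : Grassmann := θbar i α - θbar j α

/-- `ρ_{ij} = θ_{ij} 𝐱̃_{īj}⁻¹ θ̄_{ij}`. -/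
def rho (i j : Fin 4) : SuperFun := fun x =>
  contract (θdiff i j) (matTildeInv i j x) (θbarDiff i j)

/-! ### Superconformal cross ratios and nilpotent invariants -/

/-- The cross ratio `x_{r̄s}² x_{t̄u}² / (x_{r̄u}² x_{t̄s}²)`. -/
def crossRatio (r s t u : Fin 4) : SuperFun := fun x =>
  sq r s x * sq t u x * sinv (sq r u x * sq t s x)

/-- `𝓘₁ = x_{1̄4}² x_{3̄2}² / (x_{1̄2}² x_{3̄4}²)`. -/
def I₁ : SuperFun := crossRatio 0 3 2 1

/-- `𝓘₂ = x_{1̄4}² x_{2̄3}² / (x_{1̄3}² x_{2̄4}²)`. -/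
def I₂ : SuperFun := crossRatio 0 3 1 2

/-- `𝓘₆ = x_{1̄3}² x_{4̄2}² / (x_{1̄2}² x_{4̄3}²)`. -/
def I₆ : SuperFun := crossRatio 0 2 3 1

/-- `X_{1(1)+}² = x_{2̄4}² / (x_{2̄1}² x_{1̄4}²)`. -/
def XPlusSq : SuperFun := fun x => sq 1 3 x * sinv (sq 1 0 x * sq 0 3 x)

/-- `X_{1(1)-}² = x_{4̄2}² / (x_{4̄1}² x_{1̄2}²)`. -/
def XMinusSq : SuperFun := fun x => sq 3 1 x * sinv (sq 3 0 x * sq 0 1 x)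

/-- `J_{1(1)} = X_{1(1)+}² / X_{1(1)-}²`. -/
def J : SuperFun := fun x => XPlusSq x * sinv (XMinusSq x)

/-- The matrices `𝐗̃_{1(1)+} = - 𝐱_{1̄4}⁻¹ 𝐱_{2̄4} 𝐱_{2̄1}⁻¹` (for `k = 0`) and
`𝐗̃_{1(2)-} = 𝐱_{1̄3}⁻¹ 𝐱_{4̄3} 𝐱_{4̄1}⁻¹` (for `k = 1`), with upper indices `α̇ α`. -/
def XTilde (k : Fin 2) (x : Configuration) : Matrix (Fin 2) (Fin 2) Grassmann :=
  ![-(matInv 0 3 x * mat 1 3 x * matInv 1 0 x), matInv 0 2 x * mat 3 2 x * matInv 3 0 x] k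

/-- The point `2` (for `i = 0`) or `3` (for `i = 1`). -/
def midPoint (i : Fin 2) : Fin 4 := ![1, 2] i

/-- With `m = 2, 3` for `i = 0, 1`: the spinor
`Θ̃_{1(m-1)} = i (𝐱̃_{4̄1}⁻¹ θ̄_{41} - 𝐱̃_{m̄1}⁻¹ θ̄_{m1})`, with lower index `α`. -/
def ΘTilde (i : Fin 2) (x : Configuration) (α : Fin 2) : Grassmann :=
  Complex.I • ∑ β : Fin 2, (matTildeInv 3 0 x α β * θbarDiff 3 0 β -
    matTildeInv (midPoint i) 0 x α β * θbarDiff (midPoint i) 0 β)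

/-- With `m = 2, 3` for `j = 0, 1`: the spinor
`Θ̃̄_{1(m-1)} = i (θ_{1m} 𝐱̃_{1̄m}⁻¹ - θ_{14} 𝐱̃_{1̄4}⁻¹)`, with lower index `α̇`. -/
def ΘbarTilde (j : Fin 2) (x : Configuration) (β : Fin 2) : Grassmann :=
  Complex.I • ∑ α : Fin 2, (θdiff 0 (midPoint j) α * matTildeInv 0 (midPoint j) x α β -
    θdiff 0 3 α * matTildeInv 0 3 x α β)

/-- The eight nilpotent invariants `I_{kij}` (each of `k, i, j = 1, 2` is here `0, 1`),
`I_{1ij} = - Θ̃̄_{1(j)} 𝐗̃_{1(1)+} Θ̃_{1(i)} / √(X_{1(1)+}² X_{1(1)-}²)`, and `I_{2ij}` with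
`𝐗̃_{1(2)-}` instead of `𝐗̃_{1(1)+}`. -/
def nilInv (k i j : Fin 2) : SuperFun := fun x =>
  -(contract (ΘbarTilde j x) (XTilde k x) (ΘTilde i x) *
    sinv (spow (XPlusSq x * XMinusSq x) (1 / 2)))

/-- `T₂₂₂ = - ρ₁₄ + ρ₁₃ + ρ₃₄ + 2 i (ρ₁₄² - ρ₁₃² - ρ₃₄²)`. -/
def T222 : SuperFun := fun x =>
  -rho 0 3 x + rho 0 2 x + rho 2 3 x +
    (2 * Complex.I) • (rho 0 3 x ^ 2 - rho 0 2 x ^ 2 - rho 2 3 x ^ 2)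

/-- `T_Σ = - ρ₁₃ + ρ₁₂ + ρ₂₃ + 2 i (ρ₁₃² - ρ₁₂² - ρ₂₃²)`. -/
def TSigma : SuperFun := fun x =>
  -rho 0 2 x + rho 0 1 x + rho 1 2 x +
    (2 * Complex.I) • (rho 0 2 x ^ 2 - rho 0 1 x ^ 2 - rho 1 2 x ^ 2)

/-- `T₂₁₂ = C + 2 i C²` with `C = 𝓘₆ √J_{1(1)} I₂₁₂`. -/
def T212 : SuperFun := fun x =>
  I₆ x * spow (J x) (1 / 2) * nilInv 1 0 1 x +
    (2 * Complex.I) • (I₆ x * spow (J x) (1 / 2) * nilInv 1 0 1 x) ^ 2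

/-- `T = T₂₂₂ + T_Σ - T₂₁₂`. -/
def T : SuperFun := fun x => T222 x + TSigma x - T212 x

/-! ### Superconformal symmetry and chirality -/

/-- `(σ^μ θ̄_i)_α`. -/
def σθbar (μ i : Fin 4) (α : Fin 2) : Grassmann := ∑ β : Fin 2, pauli μ α β • θbar i β

/-- `(θ_i σ^μ)_α̇`. -/
def θσ (μ i : Fin 4) (β : Fin 2) : Grassmann := ∑ α : Fin 2, pauli μ α β • θ i α

/-- The matrix `𝐱̃_{i+}`, with upper indices `α̇ α`. -/
def xPlusTilde (i : Fin 4) (x : Configuration) (β α : Fin 2) : Grassmann :=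
  ∑ μ : Fin 4, sigmaTildeLower μ β α • xPlus i μ x

/-- The matrix `𝐱̃_{i-}`, with upper indices `α̇ α`. -/
def xMinusTilde (i : Fin 4) (x : Configuration) (β α : Fin 2) : Grassmann :=
  ∑ μ : Fin 4, sigmaTildeLower μ β α • xMinus i μ x

/-- The covariant derivative `D_{iα} = ∂/∂θ_i^α - i (σ^μ θ̄_i)_α ∂/∂x_i^μ`.  In the coordinates
`(x_{i-}, θ_i, θ̄_i)` it is `∂/∂θ_i^α`. -/
def D (i : Fin 4) (α : Fin 2) (G : SuperFun) : SuperFun := fun x =>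
  dθ i α (G x) - Complex.I • ∑ μ : Fin 4, σθbar μ i α * dx i μ G x

/-- The covariant derivative `D̄_{iα̇} = - ∂/∂θ̄_i^α̇ + i (θ_i σ^μ)_α̇ ∂/∂x_i^μ`.  In the coordinates
`(x_{i+}, θ_i, θ̄_i)` it is `- ∂/∂θ̄_i^α̇`. -/
def Dbar (i : Fin 4) (β : Fin 2) (G : SuperFun) : SuperFun := fun x =>
  -dθbar i β (G x) + Complex.I • ∑ μ : Fin 4, θσ μ i β * dx i μ G x

/-- The supersymmetry generator `Q_α = ∑_i [∂/∂θ_i^α + i (σ^μ θ̄_i)_α ∂/∂x_i^μ]`. -/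
def Q (α : Fin 2) (G : SuperFun) : SuperFun := fun x =>
  ∑ i : Fin 4, (dθ i α (G x) + Complex.I • ∑ μ : Fin 4, σθbar μ i α * dx i μ G x)

/-- The supersymmetry generator `Q̄_α̇ = ∑_i [∂/∂θ̄_i^α̇ + i (θ_i σ^μ)_α̇ ∂/∂x_i^μ]`. -/
def Qbar (β : Fin 2) (G : SuperFun) : SuperFun := fun x =>
  ∑ i : Fin 4, (dθbar i β (G x) + Complex.I • ∑ μ : Fin 4, θσ μ i β * dx i μ G x)

/-- The generator of special supersymmetry
`S^β = ∑_i [𝐱̃_{i-}^{α̇β} ∂/∂θ̄_i^α̇ - 4 i θ_i^β θ_i^α ∂/∂θ_i^α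
  + i (θ_i σ^μ 𝐱̃_{i+})^β ∂/∂x_i^μ + 2 i (η_i - 3 κ_i) θ_i^β]`
on a product of scalar superfields of scale dimensions `η_i` and R-charges `κ_i`. -/
def S (η κ : Fin 4 → ℝ) (β : Fin 2) (G : SuperFun) : SuperFun := fun x =>
  ∑ i : Fin 4,
    ((∑ a : Fin 2, xMinusTilde i x a β * dθbar i a (G x)) -
      (4 * Complex.I) • ∑ a : Fin 2, θ i β * θ i a * dθ i a (G x) +
      Complex.I • ∑ μ : Fin 4, (∑ a : Fin 2, θσ μ i a * xPlusTilde i x a β) * dx i μ G x +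
      (2 * Complex.I * ((η i - 3 * κ i : ℝ) : ℂ)) • (θ i β * G x))

/-- The generator of special supersymmetry
`S̄^β̇ = ∑_i [𝐱̃_{i+}^{β̇α} ∂/∂θ_i^α + 4 i θ̄_i^α̇ θ̄_i^β̇ ∂/∂θ̄_i^α̇
  + i (𝐱̃_{i-} σ^μ θ̄_i)^β̇ ∂/∂x_i^μ + 2 i (η_i + 3 κ_i) θ̄_i^β̇]`
on a product of scalar superfields of scale dimensions `η_i` and R-charges `κ_i`. -/
def Sbar (η κ : Fin 4 → ℝ) (β : Fin 2) (G : SuperFun) : SuperFun := fun x =>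
  ∑ i : Fin 4,
    ((∑ a : Fin 2, xPlusTilde i x β a * dθ i a (G x)) +
      (4 * Complex.I) • ∑ a : Fin 2, θbar i a * θbar i β * dθbar i a (G x) +
      Complex.I • ∑ μ : Fin 4, (∑ a : Fin 2, xMinusTilde i x β a * σθbar μ i a) * dx i μ G x +
      (2 * Complex.I * ((η i + 3 * κ i : ℝ) : ℂ)) • (θbar i β * G x))

/-- Configurations of pairwise space-like separated points, on which correlation functions are
(single-valued, real-analytic) functions rather than distributions. -/
def spacelike : Set Configuration :=
  {x | ∀ i j : Fin 4, i ≠ j →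
    (x i 0 - x j 0) ^ 2 < (x i 1 - x j 1) ^ 2 + (x i 2 - x j 2) ^ 2 + (x i 3 - x j 3) ^ 2}

/-- The values of the two cross ratios on space-like configurations. -/
def crossRatioRange : Set (ℝ × ℝ) := {p | 0 < p.1 ∧ 0 < p.2}

/-- `G` is superconformally covariant, like a correlation function of four scalar superfields of
scale dimensions `η_i` and R-charges `κ_i`: it obeys the superconformal Ward identities.  The
eight odd generators generate the superconformal algebra: the anticommutators `{Q, Q̄}`, `{S, S̄}`,
`{Q, S}`, `{Q̄, S̄}` give the translations, the special conformal transformations, and the Lorentz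
transformations, dilatation and R-symmetry. -/
structure IsSuperconformal (η κ : Fin 4 → ℝ) (G : SuperFun) : Prop where
  analytic : AnalyticOnNhd ℝ G spacelike
  Q_eq : ∀ α, ∀ x ∈ spacelike, Q α G x = 0
  Qbar_eq : ∀ α, ∀ x ∈ spacelike, Qbar α G x = 0
  S_eq : ∀ α, ∀ x ∈ spacelike, S η κ α G x = 0
  Sbar_eq : ∀ α, ∀ x ∈ spacelike, Sbar η κ α G x = 0

/-- `G` is a four-point function `⟨Φ̄₁ Φ̄₂ Φ₃ Φ₄⟩` of scalar superfields of scale dimensions `η_i`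
and R-charges `κ_i`, anti-chiral at the points `1, 2` and chiral at the points `3, 4`. -/
structure IsChiralFourPointFunction (η κ : Fin 4 → ℝ) (G : SuperFun) : Prop extends
    IsSuperconformal η κ G where
  D_one : ∀ α, ∀ x ∈ spacelike, D 0 α G x = 0
  D_two : ∀ α, ∀ x ∈ spacelike, D 1 α G x = 0
  Dbar_three : ∀ α, ∀ x ∈ spacelike, Dbar 2 α G x = 0
  Dbar_four : ∀ α, ∀ x ∈ spacelike, Dbar 3 α G x = 0

/-! ### The exponential of the operator `𝒟` -/

/-- `1 / (x_{1̄3}^{2 (η₃ - η₂)} x_{1̄4}^{2 η₄} x_{2̄3}^{2 η₂})`. -/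
def prefactor (η : Fin 4 → ℝ) : SuperFun := fun x =>
  spow (sq 0 2 x) (-(η 2 - η 1)) * spow (sq 0 3 x) (-η 3) * spow (sq 1 2 x) (-η 1)

/-- The operator `𝓘₁ ∂/∂𝓘₁` on functions of the two cross ratios. -/
def eulerOp (f : ℝ × ℝ → ℂ) : ℝ × ℝ → ℂ := fun p => p.1 * deriv (fun s => f (s, p.2)) p.1

/-- `e^𝒟 [f (𝓘₁, 𝓘₂) / (x_{1̄3}^{2 (η₃ - η₂)} x_{1̄4}^{2 η₄} x_{2̄3}^{2 η₂})]` with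
`𝒟 = 4 i T 𝓘₁ ∂/∂𝓘₁`, that is, the (terminating) Taylor series
`∑_k (4 i T)^k / k! (𝓘₁ ∂/∂𝓘₁)^k`, in which the derivatives act on `f` alone. -/
def expD (η : Fin 4 → ℝ) (f : ℝ × ℝ → ℂ) : SuperFun := fun x =>
  (∑ k ∈ Finset.range 17,
    ((k.factorial : ℂ)⁻¹ • ((4 * Complex.I) • T x) ^ k) *
      superEval (eulerOp^[k] f) (I₁ x) (I₂ x)) * prefactor η x

/-- The monomial `∏ I_{kij} ^ m (k, i, j)` in the nilpotent invariants. -/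
def nilMonomial (m : Fin 2 × Fin 2 × Fin 2 → ℕ) : SuperFun := fun x =>
  ((List.finRange 2).flatMap fun k => (List.finRange 2).flatMap fun i =>
    (List.finRange 2).map fun j => nilInv k i j x ^ m (k, i, j)).prod

/-- `c` is the family of coefficients of an expansion with respect to the nilpotent invariants of
the function `f_{4PF}` in `G = f_{4PF} / (x_{1̄3}^{2 (η₃ - η₂)} x_{1̄4}^{2 η₄} x_{2̄3}^{2 η₂})`: it has
finitely many non-zero members, and `f_{4PF} = ∑_m c_m (𝓘₁, 𝓘₂) ∏ I_{kij} ^ m (k, i, j)`. -/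
def IsNilpotentExpansion (η : Fin 4 → ℝ) (G : SuperFun)
    (c : (Fin 2 × Fin 2 × Fin 2 → ℕ) →₀ (ℝ × ℝ → ℂ)) : Prop :=
  ∀ x ∈ spacelike,
    G x = (c.sum fun m f => superEval f (I₁ x) (I₂ x) * nilMonomial m x) * prefactor η x

end

end ChiralFourPoint

open ChiralFourPoint

/-! The points are numbered 1 to 4 in these comments, as in the docstrings, and 0 to 3 in the code.
Write `K` for `chiralProd`, a combination of the intervals x_{1̄3}, x_{1̄4}, x_{2̄3}, x_{2̄4} only.
These are the chiral intervals: `D` at points 1, 2 and `D̄` at points 3, 4 annihilate them.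

Existence. The operator 𝓘₁ ∂/∂𝓘₁ generates rescalings of 𝓘₁, so e^𝒟 turns f(𝓘₁, 𝓘₂) into f(e^{4iT}
𝓘₁, 𝓘₂). All the pieces of `T` are logarithms of unipotent ratios: x_{j̄i}² / x_{īj}² is a quadratic
polynomial in `ρ_{ij}` whose logarithm is -4i(ρ - 2iρ²), and 1 - 4iC is again a ratio of intervals
and `K` (`chiralProd_mul`), with logarithm -4i(C + 2iC²). Adding them (`smul_T_eq`) gives e^{4iT} =
x_{1̄2}² x_{3̄4}² x_{2̄3}² / (x_{3̄2}² K), hence e^{4iT} 𝓘₁ = x_{1̄4}² x_{2̄3}² / K. Both arguments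
of f thus become chiral invariants. Every generator acts on an interval matrix by one factor at each
endpoint (`IsConformal`), so the squares and `K` have logarithmic derivatives that are sums of local
weights; these cancel in `T`, in e^{4iT} 𝓘₁ and in 𝓘₂ (`isSuperconformal_T`, `isChiral_expSum`), and
the prefactor carries the weights (`isChiral_expD`).

Uniqueness. A four-point function whose body vanishes is zero (`IsChiralFourPointFunction.eq_zero`).
If it has degree at least n in the odd variables, then to leading order the chirality conditions
give the odd derivatives at half of the variables, and the pairs Q, S̄ and Q̄, S are invertible
linear systems for the other half. All sixteen derivatives are therefore of higher degree than they
should be, and the Euler operator raises n.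

Form of the body. At second order in the odd variables the identities fix the weights wherever the
body is non-zero (`IsChiralFourPointFunction.matched`), so the prefactor can be divided out. For
weight zero they express the gradient of the body through 2 × 2 matrices of mixed odd derivatives.
These are all determined by one matrix commuting with a fixed matrix `loopMat`, which generically
leaves two free parameters. Hence any three invariants have dependent differentials
(`fderiv_dependent`), and the body of an invariant has its differential in the span of those of 𝓘₁,
𝓘₂. It is then locally a function of the cross ratios, and globally so by the identity theorem on
the connected set of space-like configurations (`IsChiralFourPointFunction.body_eq_section₀`). An
explicit section of the cross ratios over the whole quadrant supplies f, and subtracting e^𝒟 leaves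
a four-point function without body. -/

namespace ChiralFourPoint
noncomputable section

/-! ### Parity and filtration of the Grassmann algebra -/

/-- The inclusion of vectors into the Grassmann algebra. -/
abbrev vec (v : OddIndex → ℂ) : Grassmann := ExteriorAlgebra.ι ℂ v

/-- The left derivative with respect to the generator with label `k`. -/
def dgen (k : OddIndex) : Grassmann →ₗ[ℂ] Grassmann :=
  CliffordAlgebra.contractLeft (LinearMap.proj k : (OddIndex → ℂ) →ₗ[ℂ] ℂ)

/-- The generator with label `k`. -/
def gen (k : OddIndex) : Grassmann := vec (Pi.single k 1)

lemma dθ_eq_dgen (i : Fin 4) (α : Fin 2) : dθ i α = dgen (Sum.inl (i, α)) := rfl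

lemma dθbar_eq_dgen (i : Fin 4) (α : Fin 2) : dθbar i α = dgen (Sum.inr (i, α)) := rfl

lemma dgen_vec_mul (k : OddIndex) (v : OddIndex → ℂ) (b : Grassmann) :
    dgen k (vec v * b) = v k • b - vec v * dgen k b :=
  CliffordAlgebra.contractLeft_ι_mul _ _ _

lemma dgen_vec (k : OddIndex) (v : OddIndex → ℂ) :
    dgen k (vec v) = algebraMap ℂ Grassmann (v k) :=
  CliffordAlgebra.contractLeft_ι _ _ _

lemma dgen_algebraMap (k : OddIndex) (c : ℂ) : dgen k (algebraMap ℂ Grassmann c) = 0 :=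
  CliffordAlgebra.contractLeft_algebraMap _ _ _

lemma dgen_one (k : OddIndex) : dgen k 1 = 0 := CliffordAlgebra.contractLeft_one _ _

lemma dgen_comm (k l : OddIndex) (a : Grassmann) : dgen k (dgen l a) = -dgen l (dgen k a) :=
  CliffordAlgebra.contractLeft_comm _ _ _

lemma vec_mul_vec (v w : OddIndex → ℂ) : vec v * vec w = -(vec w * vec v) :=
  eq_neg_of_add_eq_zero_left (ExteriorAlgebra.ι_add_mul_swap v w)

lemma body_vec (v : OddIndex → ℂ) : body (vec v) = 0 := by
  simp [body, ExteriorAlgebra.algebraMapInv, vec]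

lemma body_algebraMap (c : ℂ) : body (algebraMap ℂ Grassmann c) = c := by simp

/-- The subalgebra of even elements. -/
abbrev evenPart : Subalgebra ℂ Grassmann :=
  CliffordAlgebra.even (0 : QuadraticForm ℂ (OddIndex → ℂ))

/-- The submodule of odd elements. -/
abbrev oddPart : Submodule ℂ Grassmann :=
  CliffordAlgebra.evenOdd (0 : QuadraticForm ℂ (OddIndex → ℂ)) 1

lemma mem_evenPart {a : Grassmann} :
    a ∈ evenPart ↔ a ∈ CliffordAlgebra.evenOdd (0 : QuadraticForm ℂ (OddIndex → ℂ)) 0 := by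
  rw [← CliffordAlgebra.even_toSubmodule]; rfl

lemma vec_mem_oddPart (v : OddIndex → ℂ) : vec v ∈ oddPart :=
  CliffordAlgebra.ι_mem_evenOdd_one _ v

lemma mul_mem_evenPart {a b : Grassmann} (ha : a ∈ oddPart) (hb : b ∈ oddPart) :
    a * b ∈ evenPart :=
  mem_evenPart.2 (CliffordAlgebra.evenOdd_mul_le _ 1 1 (Submodule.mul_mem_mul ha hb))

lemma even_mul_mem_oddPart {a b : Grassmann} (ha : a ∈ evenPart) (hb : b ∈ oddPart) :
    a * b ∈ oddPart :=
  CliffordAlgebra.evenOdd_mul_le _ 0 1 (Submodule.mul_mem_mul (mem_evenPart.1 ha) hb)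

lemma vec_commute_even {a : Grassmann} (ha : a ∈ evenPart) (v : OddIndex → ℂ) :
    Commute (vec v) a := by
  rw [mem_evenPart] at ha
  induction a, ha using CliffordAlgebra.even_induction with
  | algebraMap r => exact (Algebra.commutes r _).symm
  | add x y _ _ hx hy => exact hx.add_right hy
  | ι_mul_ι_mul m₁ m₂ x _ hx =>
    refine Commute.mul_right ?_ hx
    change vec v * (vec m₁ * vec m₂) = vec m₁ * vec m₂ * vec v
    rw [← mul_assoc, vec_mul_vec v m₁, neg_mul, mul_assoc, vec_mul_vec v m₂, mul_neg, neg_neg,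
      mul_assoc]

lemma even_commute {a : Grassmann} (ha : a ∈ evenPart) (b : Grassmann) : Commute a b := by
  induction b using ExteriorAlgebra.induction with
  | algebraMap r => exact (Algebra.commutes r _).symm
  | ι v => exact (vec_commute_even ha v).symm
  | mul x y hx hy => exact hx.mul_right hy
  | add x y hx hy => exact hx.add_right hy

lemma odd_mul_odd {a b : Grassmann} (ha : a ∈ oddPart) (hb : b ∈ oddPart) : a * b = -(b * a) := by
  have key : ∀ (v : OddIndex → ℂ) {c : Grassmann}, c ∈ oddPart → vec v * c = -(c * vec v) := by
    intro v c hc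
    induction c, hc using CliffordAlgebra.odd_induction with
    | ι w => exact vec_mul_vec v w
    | add x y _ _ hx hy => rw [mul_add, hx, hy, add_mul, neg_add]
    | ι_mul_ι_mul m₁ m₂ x _ hx =>
      have h := (vec_commute_even (mul_mem_evenPart (vec_mem_oddPart m₁) (vec_mem_oddPart m₂)) v).eq
      change vec v * (vec m₁ * vec m₂ * x) = -(vec m₁ * vec m₂ * x * vec v)
      rw [← mul_assoc, h, mul_assoc, hx, mul_neg, mul_assoc _ x]
  induction a, ha using CliffordAlgebra.odd_induction with
  | ι w => exact key w hb
  | add x y _ _ hx hy => rw [mul_add, add_mul, hx, hy, neg_add]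
  | ι_mul_ι_mul m₁ m₂ x _ hx =>
    have h := (even_commute (mul_mem_evenPart (vec_mem_oddPart m₁) (vec_mem_oddPart m₂)) b).eq
    change vec m₁ * vec m₂ * x * b = -(b * (vec m₁ * vec m₂ * x))
    rw [mul_assoc, hx, mul_neg, ← mul_assoc, h, mul_assoc]

lemma odd_mul_self {a : Grassmann} (ha : a ∈ oddPart) : a * a = 0 := by
  have h := odd_mul_odd ha ha
  have h2 : (2 : ℂ) • (a * a) = 0 := by rw [two_smul]; nth_rewrite 1 [h]; exact neg_add_cancel _
  exact (smul_eq_zero.1 h2).resolve_left two_ne_zero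

/-- With this instance the identities between intervals, which only involve even elements, can be
proved by `ring` and `linear_combination`. -/
instance : CommRing evenPart :=
  { (inferInstance : Ring evenPart) with
    mul_comm := fun a b => Subtype.ext (even_commute a.2 b) }

/-- An odd derivative picks up two signs when passing a pair of vectors, hence none when passing an
even factor. -/
lemma dgen_even_mul (k : OddIndex) {a : Grassmann} (ha : a ∈ evenPart) (b : Grassmann) :
    dgen k (a * b) = dgen k a * b + a * dgen k b := by
  rw [mem_evenPart] at ha
  induction a, ha using CliffordAlgebra.even_induction with
  | algebraMap r => rw [dgen_algebraMap, zero_mul, zero_add, ← Algebra.smul_def, ← Algebra.smul_def,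
      map_smul]
  | add x y _ _ hx hy => rw [add_mul, map_add, hx, hy, map_add]; noncomm_ring
  | ι_mul_ι_mul m₁ m₂ x _ hx =>
    change dgen k (vec m₁ * vec m₂ * x * b) = dgen k (vec m₁ * vec m₂ * x) * b +
      vec m₁ * vec m₂ * x * dgen k b
    rw [mul_assoc, mul_assoc, mul_assoc (vec m₁) (vec m₂) x, dgen_vec_mul, dgen_vec_mul, hx,
      dgen_vec_mul, dgen_vec_mul]
    simp only [Algebra.smul_def, mul_add, mul_sub, sub_mul]
    noncomm_ring

/-! #### The filtration by degree -/

/-- The elements of degree at least `n`. -/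
def filt (n : ℕ) : Submodule ℂ Grassmann :=
  Submodule.span ℂ {a | ∃ L : List (OddIndex → ℂ), n ≤ L.length ∧ a = (L.map vec).prod}

lemma prod_mem_filt (L : List (OddIndex → ℂ)) : (L.map vec).prod ∈ filt L.length :=
  Submodule.subset_span ⟨L, le_rfl, rfl⟩

lemma filt_anti {m n : ℕ} (h : m ≤ n) : filt n ≤ filt m :=
  Submodule.span_mono fun _ ⟨L, hL, ha⟩ => ⟨L, h.trans hL, ha⟩

lemma mul_mem_filt {m n : ℕ} {a b : Grassmann} (ha : a ∈ filt m) (hb : b ∈ filt n) :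
    a * b ∈ filt (m + n) := by
  have h : filt m * filt n ≤ filt (m + n) := by
    rw [filt, filt, Submodule.span_mul_span]
    refine Submodule.span_mono ?_
    rintro _ ⟨_, ⟨L, hL, rfl⟩, _, ⟨L', hL', rfl⟩, rfl⟩
    exact ⟨L ++ L', by simp; omega, by simp⟩
  exact h (Submodule.mul_mem_mul ha hb)

lemma vec_mem_filt (v : OddIndex → ℂ) : vec v ∈ filt 1 := by
  simpa using prod_mem_filt [v]

lemma mem_filt_zero (a : Grassmann) : a ∈ filt 0 := by
  induction a using ExteriorAlgebra.induction with
  | algebraMap r =>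
    rw [Algebra.algebraMap_eq_smul_one]
    exact Submodule.smul_mem _ _ (by simpa using prod_mem_filt [])
  | ι v => exact filt_anti zero_le_one (vec_mem_filt v)
  | mul x y hx hy => simpa using mul_mem_filt hx hy
  | add x y hx hy => exact add_mem hx hy

lemma mul_mem_filt_left {n : ℕ} {a b : Grassmann} (ha : a ∈ filt n) : a * b ∈ filt n := by
  simpa using mul_mem_filt ha (mem_filt_zero b)

lemma mul_mem_filt_right {n : ℕ} {a b : Grassmann} (hb : b ∈ filt n) : a * b ∈ filt n := by
  simpa using mul_mem_filt (mem_filt_zero a) hb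

lemma pow_mem_filt {n : ℕ} {a : Grassmann} (ha : a ∈ filt n) (k : ℕ) : a ^ k ∈ filt (k * n) := by
  induction k with
  | zero => exact filt_anti (by simp) (mem_filt_zero _)
  | succ k ih => rw [pow_succ, add_mul, one_mul]; exact mul_mem_filt ih ha

/-- Seventeen vectors in a space of dimension sixteen are dependent, and an alternating product of
dependent vectors vanishes. -/
lemma filt_eq_bot {n : ℕ} (hn : 17 ≤ n) : filt n = ⊥ := by
  refine (Submodule.span_eq_bot).2 ?_
  rintro _ ⟨L, hL, rfl⟩
  have h := (ExteriorAlgebra.ιMulti ℂ L.length (M := OddIndex → ℂ)).map_linearDependent L.get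
    (fun h => by
      have := h.fintype_card_le_finrank
      simp at this
      omega)
  rw [ExteriorAlgebra.ιMulti_apply] at h
  rw [← h]
  congr 1
  conv_lhs => rw [← List.ofFn_get L]
  rw [List.map_ofFn]
  rfl

lemma eq_zero_of_mem_filt {n : ℕ} (hn : 17 ≤ n) {a : Grassmann} (ha : a ∈ filt n) : a = 0 := by
  rw [filt_eq_bot hn] at ha
  exact (Submodule.mem_bot ℂ).1 ha

lemma dgen_mem_filt (k : OddIndex) {n : ℕ} {a : Grassmann} (ha : a ∈ filt (n + 1)) :
    dgen k a ∈ filt n := by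
  -- The truncated subtraction does no harm for the empty list, since the derivative of 1 is zero.
  have key : ∀ L : List (OddIndex → ℂ), dgen k (L.map vec).prod ∈ filt (L.length - 1) := by
    intro L
    induction L with
    | nil => simp [dgen_one]
    | cons v L ih =>
      simp only [List.map_cons, List.prod_cons, List.length_cons, Nat.add_sub_cancel]
      rw [dgen_vec_mul]
      refine sub_mem (Submodule.smul_mem _ _ (prod_mem_filt L)) ?_
      rcases L with _ | ⟨w, L⟩
      · simp [dgen_one]
      · have := mul_mem_filt (vec_mem_filt v) ih
        simpa [add_comm] using this
  have h : filt (n + 1) ≤ (filt n).comap (dgen k) := by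
    refine Submodule.span_le.2 ?_
    rintro _ ⟨L, hL, rfl⟩
    exact filt_anti (by omega) (key L)
  exact h ha

lemma soul_mem_filt (a : Grassmann) : soul a ∈ filt 1 := by
  induction a using ExteriorAlgebra.induction with
  | algebraMap r => simp [soul]
  | ι v => rw [soul, body_vec, map_zero, sub_zero]; exact vec_mem_filt v
  | mul x y hx hy =>
    have : soul (x * y) = soul x * y + algebraMap ℂ Grassmann (body x) * soul y := by
      simp only [soul, map_mul]; noncomm_ring
    rw [this]
    exact add_mem (mul_mem_filt_left hx) (mul_mem_filt_right hy)
  | add x y hx hy =>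
    have : soul (x + y) = soul x + soul y := by simp only [soul, map_add]; abel
    rw [this]
    exact add_mem hx hy

lemma mem_filt_one_of_body {a : Grassmann} (h : body a = 0) : a ∈ filt 1 := by
  have := soul_mem_filt a
  rwa [soul, h, map_zero, sub_zero] at this

lemma soul_mem_filt_two {a : Grassmann} (ha : a ∈ evenPart) : soul a ∈ filt 2 := by
  rw [mem_evenPart] at ha
  induction a, ha using CliffordAlgebra.even_induction with
  | algebraMap r => simp [soul]
  | add x y _ _ hx hy =>
    have : soul (x + y) = soul x + soul y := by simp only [soul, map_add]; abel
    rw [this]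
    exact add_mem hx hy
  | ι_mul_ι_mul m₁ m₂ x _ hx =>
    have h : vec m₁ * vec m₂ ∈ filt 2 :=
      mul_mem_filt (m := 1) (n := 1) (vec_mem_filt m₁) (vec_mem_filt m₂)
    change soul (vec m₁ * vec m₂ * x) ∈ _
    rw [soul, map_mul body, map_mul body, body_vec, zero_mul, zero_mul, map_zero, sub_zero]
    exact mul_mem_filt_left h

/-- An even soul has degree at least two, so nine factors already exceed degree sixteen. In
particular the sixteenth power vanishes, which lets the index of a Taylor sum over `range 17` be
shifted without boundary terms. -/
lemma soul_pow_eq_zero {a : Grassmann} (ha : a ∈ evenPart) {k : ℕ} (hk : 9 ≤ k) :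
    soul a ^ k = 0 :=
  eq_zero_of_mem_filt (by omega) (pow_mem_filt (soul_mem_filt_two ha) k)

lemma isUnit_of_body_ne_zero {a : Grassmann} (ha : body a ≠ 0) : IsUnit a := by
  have h1 : a = algebraMap ℂ Grassmann (body a) + soul a := by simp [soul]
  have h2 : IsNilpotent (soul a) :=
    ⟨17, eq_zero_of_mem_filt (by norm_num) (pow_mem_filt (soul_mem_filt a) 17)⟩
  have h3 : IsUnit (algebraMap ℂ Grassmann (body a)) := (IsUnit.mk0 _ ha).map _
  rw [h1, add_comm]
  exact h2.isUnit_add_right_of_commute h3 (Algebra.commutes _ _).symm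

/-- The Euler operator `∑ θ ∂/∂θ`. -/
def euler : Grassmann →ₗ[ℂ] Grassmann := ∑ k : OddIndex, (LinearMap.mulLeft ℂ (gen k)).comp (dgen k)

lemma euler_apply (a : Grassmann) : euler a = ∑ k, gen k * dgen k a := by
  simp [euler, LinearMap.sum_apply]

/-- The sign of the Leibniz rule cancels against the sign from moving the generator past the first
vector, so each vector of the product contributes once. -/
lemma euler_prod (L : List (OddIndex → ℂ)) :
    euler (L.map vec).prod = (L.length : ℂ) • (L.map vec).prod := by
  induction L with
  | nil => simp [euler_apply, dgen_one]
  | cons v L ih =>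
    rw [euler_apply] at ih ⊢
    simp only [List.map_cons, List.prod_cons, List.length_cons, Nat.cast_add, Nat.cast_one]
    have hv : vec v = ∑ k, v k • gen k := by
      simp only [gen, vec, ← map_smul, ← map_sum]
      congr 1
      ext l
      simp [Finset.sum_apply, Pi.single_apply]
    have h2 : ∀ k, gen k * (vec v * dgen k (L.map vec).prod) =
        -(vec v * (gen k * dgen k (L.map vec).prod)) := by
      intro k
      rw [← mul_assoc, gen, vec_mul_vec, neg_mul, mul_assoc]
    simp only [dgen_vec_mul, mul_sub, h2, sub_neg_eq_add, Finset.sum_add_distrib]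
    rw [← Finset.mul_sum, ih]
    conv_rhs => rw [add_smul, one_smul, add_comm]
    congr 1
    · conv_rhs => rw [hv, Finset.sum_mul]
      exact Finset.sum_congr rfl fun k _ => by rw [mul_smul_comm, smul_mul_assoc]
    · rw [mul_smul_comm]

/-- An element without body all of whose derivatives have degree at least `n` has degree at
least `n + 1`. -/
lemma mem_filt_succ_of_dgen {n : ℕ} {a : Grassmann} (hn : n ≠ 0) (ha : a ∈ filt n)
    (hd : ∀ k, dgen k a ∈ filt n) : a ∈ filt (n + 1) := by
  -- On products of exactly `n` vectors the Euler operator is multiplication by `n`, so `euler - n`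
  -- sends `filt n` into the next step. The hypothesis on the derivatives puts `euler a` there as
  -- well; hence so is `n • a`, and `n` is invertible.
  have h1 : filt n ≤ (filt (n + 1)).comap (euler - (n : ℂ) • LinearMap.id) := by
    refine Submodule.span_le.2 ?_
    rintro _ ⟨L, hL, rfl⟩
    simp only [SetLike.mem_coe, Submodule.mem_comap, LinearMap.sub_apply, euler_prod,
      LinearMap.smul_apply, LinearMap.id_apply, ← sub_smul]
    rcases hL.eq_or_lt with h | h
    · simp [← h]
    · exact Submodule.smul_mem _ _ (filt_anti h (prod_mem_filt L))
  have h2 : euler a - (n : ℂ) • a ∈ filt (n + 1) := h1 ha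
  have h3 : euler a ∈ filt (n + 1) := by
    rw [euler_apply]
    refine sum_mem fun k _ => ?_
    rw [add_comm]
    exact mul_mem_filt (vec_mem_filt _) (hd k)
  have h4 := sub_mem h3 h2
  rw [sub_sub_cancel] at h4
  exact (Submodule.smul_mem_iff _ (Nat.cast_ne_zero.2 hn)).1 h4

end
end ChiralFourPoint

namespace ChiralFourPoint
noncomputable section

/-! ### Calculus of superfunctions -/

/-- Multiplication as a continuous real-bilinear map. -/
def mulCLM : Grassmann →L[ℝ] Grassmann →L[ℝ] Grassmann :=
  (LinearMap.toContinuousBilinearMap (LinearMap.mul ℂ Grassmann)).bilinearRestrictScalars ℝ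

lemma mulCLM_apply (a b : Grassmann) : mulCLM a b = a * b := rfl

/-- The body as a continuous linear map. -/
def bodyCLM : Grassmann →L[ℝ] ℂ :=
  (LinearMap.toContinuousLinearMap body.toLinearMap).restrictScalars ℝ

/-- The inclusion of numbers as a continuous linear map. -/
def scalarCLM : ℂ →L[ℝ] Grassmann :=
  (LinearMap.toContinuousLinearMap (Algebra.linearMap ℂ Grassmann)).restrictScalars ℝ

/-- A complex-linear map of the Grassmann algebra as a continuous real-linear map. -/
def linCLM (f : Grassmann →ₗ[ℂ] Grassmann) : Grassmann →L[ℝ] Grassmann :=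
  (LinearMap.toContinuousLinearMap f).restrictScalars ℝ

section Analytic
variable {E : Type*} [NormedAddCommGroup E] [NormedSpace ℝ E]

lemma analyticAt_mul {G H : E → Grassmann} {x : E} (hG : AnalyticAt ℝ G x)
    (hH : AnalyticAt ℝ H x) : AnalyticAt ℝ (fun y => G y * H y) x :=
  (mulCLM.analyticAt_bilinear (G x, H x)).comp₂ hG hH

lemma analyticAt_pow {G : E → Grassmann} {x : E} (hG : AnalyticAt ℝ G x) (n : ℕ) :
    AnalyticAt ℝ (fun y => G y ^ n) x := by
  induction n with
  | zero => simpa using analyticAt_const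
  | succ n ih => simpa only [pow_succ] using analyticAt_mul ih hG

lemma analyticAt_body {G : E → Grassmann} {x : E} (hG : AnalyticAt ℝ G x) :
    AnalyticAt ℝ (fun y => body (G y)) x :=
  (bodyCLM.analyticAt (G x)).comp hG

lemma analyticAt_scalar {c : E → ℂ} {x : E} (hc : AnalyticAt ℝ c x) :
    AnalyticAt ℝ (fun y => algebraMap ℂ Grassmann (c y)) x :=
  (scalarCLM.analyticAt (c x)).comp hc

lemma analyticAt_smul {G : E → Grassmann} {c : E → ℂ} {x : E} (hc : AnalyticAt ℝ c x)
    (hG : AnalyticAt ℝ G x) : AnalyticAt ℝ (fun y => c y • G y) x := by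
  simpa only [Algebra.smul_def] using analyticAt_mul (analyticAt_scalar hc) hG

lemma analyticAt_const_smul {G : E → Grassmann} (c : ℂ) {x : E}
    (hG : AnalyticAt ℝ G x) : AnalyticAt ℝ (fun y => c • G y) x :=
  analyticAt_smul analyticAt_const hG

lemma analyticAt_soul {G : E → Grassmann} {x : E} (hG : AnalyticAt ℝ G x) :
    AnalyticAt ℝ (fun y => soul (G y)) x :=
  hG.sub (analyticAt_scalar (analyticAt_body hG))

lemma analyticAt_finset_sum {ι : Type*} (s : Finset ι) {G : ι → E → Grassmann} {x : E}
    (hG : ∀ i ∈ s, AnalyticAt ℝ (G i) x) : AnalyticAt ℝ (fun y => ∑ i ∈ s, G i y) x := by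
  classical
  induction s using Finset.induction_on with
  | empty => simpa using analyticAt_const
  | insert i s hi ih =>
    simp only [Finset.sum_insert hi]
    exact (hG i (Finset.mem_insert_self i s)).add
      (ih fun j hj => hG j (Finset.mem_insert_of_mem hj))

end Analytic

lemma isOpen_spacelike : IsOpen spacelike := by
  have : spacelike = ⋂ (i : Fin 4) (j : Fin 4) (_ : i ≠ j), {x : Configuration |
      (x i 0 - x j 0) ^ 2 < (x i 1 - x j 1) ^ 2 + (x i 2 - x j 2) ^ 2 + (x i 3 - x j 3) ^ 2} := by
    ext x; simp [spacelike]
  rw [this]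
  refine isOpen_iInter_of_finite fun i => isOpen_iInter_of_finite fun j =>
    isOpen_iInter_of_finite fun _ => isOpen_lt ?_ ?_ <;> fun_prop

/-! #### First-order differential operators -/

/-- The basis vector of `∂/∂x_i^μ`. -/
def dir (i μ : Fin 4) : Configuration := Pi.single i (Pi.single μ 1)

lemma dx_def (i μ : Fin 4) (G : SuperFun) (x : Configuration) :
    dx i μ G x = fderiv ℝ G x (dir i μ) := rfl

lemma dx_mul {G H : SuperFun} {x : Configuration} (i μ : Fin 4) (hG : DifferentiableAt ℝ G x)
    (hH : DifferentiableAt ℝ H x) :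
    dx i μ (fun y => G y * H y) x = dx i μ G x * H x + G x * dx i μ H x := by
  have h := (mulCLM.hasFDerivAt_of_bilinear hG.hasFDerivAt hH.hasFDerivAt).fderiv
  rw [dx_def, show (fun y => G y * H y) = fun y => mulCLM (G y) (H y) from rfl, h]
  simp [mulCLM_apply, dx_def, add_comm]

lemma dx_add {G H : SuperFun} {x : Configuration} (i μ : Fin 4) (hG : DifferentiableAt ℝ G x)
    (hH : DifferentiableAt ℝ H x) :
    dx i μ (fun y => G y + H y) x = dx i μ G x + dx i μ H x := by
  rw [dx_def, fderiv_fun_add hG hH]; rfl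

lemma body_dx {G : SuperFun} {x : Configuration} (i μ : Fin 4) (hG : DifferentiableAt ℝ G x) :
    body (dx i μ G x) = fderiv ℝ (fun y => body (G y)) x (dir i μ) := by
  have h : HasFDerivAt (fun y => body (G y)) (bodyCLM.comp (fderiv ℝ G x)) x :=
    bodyCLM.hasFDerivAt.comp x hG.hasFDerivAt
  rw [h.fderiv]
  rfl

lemma dx_linear {G : SuperFun} {x : Configuration} (f : Grassmann →ₗ[ℂ] Grassmann) (i μ : Fin 4)
    (hG : DifferentiableAt ℝ G x) : dx i μ (fun y => f (G y)) x = f (dx i μ G x) := by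
  have h : HasFDerivAt (fun y => f (G y)) ((linCLM f).comp (fderiv ℝ G x)) x :=
    (linCLM f).hasFDerivAt.comp x hG.hasFDerivAt
  rw [dx_def, h.fderiv]
  rfl

lemma dx_scalar {c : Configuration → ℂ} {x : Configuration} (i μ : Fin 4)
    (hc : DifferentiableAt ℝ c x) :
    dx i μ (fun y => algebraMap ℂ Grassmann (c y)) x =
      algebraMap ℂ Grassmann (fderiv ℝ c x (dir i μ)) := by
  have h : HasFDerivAt (fun y => algebraMap ℂ Grassmann (c y)) (scalarCLM.comp (fderiv ℝ c x)) x :=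
    scalarCLM.hasFDerivAt.comp x hc.hasFDerivAt
  rw [dx_def, h.fderiv]
  rfl

lemma dx_const (i μ : Fin 4) (a : Grassmann) (x : Configuration) : dx i μ (fun _ => a) x = 0 := by
  simp [dx_def]

lemma dx_congr {G H : SuperFun} {x : Configuration} (i μ : Fin 4)
    (h : ∀ᶠ y in nhds x, G y = H y) : dx i μ G x = dx i μ H x := by
  rw [dx_def, dx_def, Filter.EventuallyEq.fderiv_eq h]

/-- The value at `x` of the first-order operator with coefficients `a` of the derivatives with
respect to the generators and `b` of those with respect to the coordinates. -/
def tangent (a : OddIndex → Grassmann) (b : Fin 4 → Fin 4 → Grassmann) (G : SuperFun)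
    (x : Configuration) : Grassmann :=
  ∑ k, a k * dgen k (G x) + ∑ i, ∑ μ, b i μ * dx i μ G x

section Tangent
variable {a : OddIndex → Grassmann} {b : Fin 4 → Fin 4 → Grassmann} {G H : SuperFun}
  {x : Configuration}

lemma tangent_congr (hx : x ∈ spacelike) (h : ∀ y ∈ spacelike, G y = H y) :
    tangent a b G x = tangent a b H x := by
  have h' : ∀ᶠ y in nhds x, G y = H y :=
    Filter.eventually_of_mem (isOpen_spacelike.mem_nhds hx) h
  simp only [tangent, dx_congr _ _ h', h x hx]

lemma tangent_add (hG : DifferentiableAt ℝ G x) (hH : DifferentiableAt ℝ H x) :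
    tangent a b (fun y => G y + H y) x = tangent a b G x + tangent a b H x := by
  simp only [tangent, dx_add _ _ hG hH, map_add, mul_add, Finset.sum_add_distrib]
  abel

lemma tangent_smul (c : ℂ) (hG : DifferentiableAt ℝ G x) :
    tangent a b (fun y => c • G y) x = c • tangent a b G x := by
  have : ∀ i μ, dx i μ (fun y => c • G y) x = c • dx i μ G x := fun i μ =>
    dx_linear (c • LinearMap.id) i μ hG
  simp only [tangent, this, map_smul, mul_smul_comm, Finset.smul_sum, smul_add]

lemma tangent_neg (hG : DifferentiableAt ℝ G x) :
    tangent a b (fun y => -G y) x = -tangent a b G x := by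
  simpa using tangent_smul (a := a) (b := b) (-1) hG

lemma tangent_sub (hG : DifferentiableAt ℝ G x) (hH : DifferentiableAt ℝ H x) :
    tangent a b (fun y => G y - H y) x = tangent a b G x - tangent a b H x := by
  simp only [sub_eq_add_neg]
  rw [tangent_add hG hH.fun_neg, tangent_neg hH]

lemma tangent_const (c : ℂ) : tangent a b (fun _ => algebraMap ℂ Grassmann c) x = 0 := by
  simp only [tangent, dx_const, dgen_algebraMap, mul_zero, Finset.sum_const_zero, add_zero]

lemma tangent_one : tangent a b (fun _ => 1) x = 0 := by
  simpa using tangent_const (a := a) (b := b) (x := x) 1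

lemma tangent_sum {ι : Type*} (s : Finset ι) {G : ι → SuperFun}
    (hG : ∀ i ∈ s, DifferentiableAt ℝ (G i) x) :
    tangent a b (fun y => ∑ i ∈ s, G i y) x = ∑ i ∈ s, tangent a b (G i) x := by
  classical
  induction s using Finset.induction_on with
  | empty => simpa using tangent_const (a := a) (b := b) (x := x) 0
  | insert i s hi ih =>
    simp only [Finset.sum_insert hi]
    have h1 : ∀ j ∈ s, DifferentiableAt ℝ (G j) x := fun j hj => hG j (Finset.mem_insert_of_mem hj)
    rw [tangent_add (hG i (Finset.mem_insert_self i s)) (DifferentiableAt.fun_sum h1), ih h1]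

/-- The coefficients may have any parity: evenness of the first factor alone lets it commute with
them and with the odd derivatives. -/
lemma tangent_mul (hG : DifferentiableAt ℝ G x) (hH : DifferentiableAt ℝ H x)
    (he : G x ∈ evenPart) :
    tangent a b (fun y => G y * H y) x = tangent a b G x * H x + G x * tangent a b H x := by
  have hc : ∀ c, c * G x = G x * c := fun c => ((even_commute he c).eq).symm
  simp only [tangent, dx_mul _ _ hG hH, dgen_even_mul _ he, mul_add, add_mul, Finset.sum_mul,
    Finset.mul_sum, Finset.sum_add_distrib, ← mul_assoc, hc]
  abel

lemma differentiableAt_mul (hG : DifferentiableAt ℝ G x) (hH : DifferentiableAt ℝ H x) :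
    DifferentiableAt ℝ (fun y => G y * H y) x :=
  (mulCLM.hasFDerivAt_of_bilinear hG.hasFDerivAt hH.hasFDerivAt).differentiableAt

lemma differentiableAt_pow (hG : DifferentiableAt ℝ G x) (n : ℕ) :
    DifferentiableAt ℝ (fun y => G y ^ n) x := by
  induction n with
  | zero => simp
  | succ n ih => simpa only [pow_succ] using differentiableAt_mul ih hG

lemma tangent_pow (hG : DifferentiableAt ℝ G x) (he : G x ∈ evenPart) (n : ℕ) :
    tangent a b (fun y => G y ^ n) x = (n : ℂ) • (G x ^ (n - 1) * tangent a b G x) := by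
  induction n with
  | zero => simpa using tangent_one
  | succ n ih =>
    simp only [pow_succ, Nat.add_sub_cancel]
    rw [tangent_mul (differentiableAt_pow hG n) hG (pow_mem he n), ih]
    rcases n with _ | n
    · simp
    · simp only [Nat.add_sub_cancel]
      rw [smul_mul_assoc, mul_assoc, ← (even_commute he _).eq, ← mul_assoc, ← pow_succ]
      push_cast
      module

lemma tangent_scalar {c : Configuration → ℂ} (hc : DifferentiableAt ℝ c x) :
    tangent a b (fun y => algebraMap ℂ Grassmann (c y)) x =
      ∑ i, ∑ μ, b i μ * algebraMap ℂ Grassmann (fderiv ℝ c x (dir i μ)) := by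
  simp only [tangent, dx_scalar _ _ hc, dgen_algebraMap, mul_zero, Finset.sum_const_zero, zero_add]

end Tangent

/-! #### Regular even superfunctions -/

/-- Analytic superfunctions on space-like configurations with even values. -/
structure EvenFun (G : SuperFun) : Prop where
  analytic : AnalyticOnNhd ℝ G spacelike
  even : ∀ x ∈ spacelike, G x ∈ evenPart

/-- Analytic even superfunctions on space-like configurations with real body. -/
structure RealFun (G : SuperFun) : Prop extends EvenFun G where
  real : ∀ x ∈ spacelike, ((body (G x)).re : ℂ) = body (G x)

/-- Analytic even superfunctions on space-like configurations with real non-zero body. -/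
structure UnitFun (G : SuperFun) : Prop extends RealFun G where
  ne : ∀ x ∈ spacelike, body (G x) ≠ 0

lemma EvenFun.diff {G : SuperFun} (h : EvenFun G) {x : Configuration} (hx : x ∈ spacelike) :
    DifferentiableAt ℝ G x := (h.analytic x hx).differentiableAt

lemma EvenFun.add {G H : SuperFun} (hG : EvenFun G) (hH : EvenFun H) :
    EvenFun fun x => G x + H x :=
  ⟨fun x hx => (hG.analytic x hx).add (hH.analytic x hx),
    fun x hx => add_mem (hG.even x hx) (hH.even x hx)⟩

lemma EvenFun.sub {G H : SuperFun} (hG : EvenFun G) (hH : EvenFun H) :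
    EvenFun fun x => G x - H x :=
  ⟨fun x hx => (hG.analytic x hx).sub (hH.analytic x hx),
    fun x hx => sub_mem (hG.even x hx) (hH.even x hx)⟩

lemma EvenFun.mul {G H : SuperFun} (hG : EvenFun G) (hH : EvenFun H) :
    EvenFun fun x => G x * H x :=
  ⟨fun x hx => analyticAt_mul (hG.analytic x hx) (hH.analytic x hx),
    fun x hx => mul_mem (hG.even x hx) (hH.even x hx)⟩

lemma EvenFun.pow {G : SuperFun} (hG : EvenFun G) (n : ℕ) : EvenFun fun x => G x ^ n :=
  ⟨fun x hx => analyticAt_pow (hG.analytic x hx) n, fun x hx => pow_mem (hG.even x hx) n⟩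

lemma EvenFun.smul {G : SuperFun} (c : ℂ) (hG : EvenFun G) : EvenFun fun x => c • G x :=
  ⟨fun x hx => analyticAt_const_smul c (hG.analytic x hx),
    fun x hx => Subalgebra.smul_mem _ (hG.even x hx) c⟩

lemma EvenFun.const {c : Grassmann} (hc : c ∈ evenPart) : EvenFun fun _ => c :=
  ⟨fun _ _ => analyticAt_const, fun _ _ => hc⟩

lemma EvenFun.sum {ι : Type*} (s : Finset ι) {G : ι → SuperFun} (hG : ∀ i ∈ s, EvenFun (G i)) :
    EvenFun fun x => ∑ i ∈ s, G i x :=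
  ⟨fun x hx => analyticAt_finset_sum s fun i hi => (hG i hi).analytic x hx,
    fun x hx => sum_mem fun i hi => (hG i hi).even x hx⟩

lemma RealFun.mul {G H : SuperFun} (hG : RealFun G) (hH : RealFun H) :
    RealFun fun x => G x * H x :=
  ⟨hG.toEvenFun.mul hH.toEvenFun, fun x hx => by
    rw [map_mul, ← hG.real x hx, ← hH.real x hx, ← Complex.ofReal_mul, Complex.ofReal_re]⟩

lemma RealFun.zero : RealFun fun _ => 0 :=
  ⟨.const (zero_mem _), by simp⟩

lemma UnitFun.mul {G H : SuperFun} (hG : UnitFun G) (hH : UnitFun H) :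
    UnitFun fun x => G x * H x :=
  ⟨hG.toRealFun.mul hH.toRealFun, fun x hx => by
    rw [map_mul]; exact mul_ne_zero (hG.ne x hx) (hH.ne x hx)⟩

/-! #### Taylor expansions about the body -/

/-- The Taylor expansion about the bodies of two even Grassmann numbers, for a family `φ k l` of
partial derivatives of order `k`, `l`. -/
def taylor (φ : ℕ → ℕ → ℝ × ℝ → ℂ) (A B : Grassmann) : Grassmann :=
  ∑ k ∈ Finset.range 17, ∑ l ∈ Finset.range 17,
    (φ k l ((body A).re, (body B).re) / ((k.factorial : ℂ) * (l.factorial : ℂ))) •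
      (soul A ^ k * soul B ^ l)

/-- `φ k l` is the family of partial derivatives of the analytic function `φ 0 0` on `W`. -/
structure IsJet (φ : ℕ → ℕ → ℝ × ℝ → ℂ) (W : Set (ℝ × ℝ)) : Prop where
  analytic : ∀ k l, AnalyticOnNhd ℝ (φ k l) W
  fst : ∀ k l, ∀ p ∈ W, fderiv ℝ (φ k l) p (1, 0) = φ (k + 1) l p
  snd : ∀ k l, ∀ p ∈ W, fderiv ℝ (φ k l) p (0, 1) = φ k (l + 1) p

lemma fderiv_prod_apply (g : ℝ × ℝ → ℂ) (p v : ℝ × ℝ) :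
    fderiv ℝ g p v = v.1 * fderiv ℝ g p (1, 0) + v.2 * fderiv ℝ g p (0, 1) := by
  have : v = v.1 • (1, 0) + v.2 • (0, 1) := by ext <;> simp
  conv_lhs => rw [this]
  rw [map_add, map_smul, map_smul, Complex.real_smul, Complex.real_smul]

lemma soul_even {a : Grassmann} (ha : a ∈ evenPart) : soul a ∈ evenPart :=
  sub_mem ha (Subalgebra.algebraMap_mem _ _)

section Taylor
variable {φ : ℕ → ℕ → ℝ × ℝ → ℂ} {W : Set (ℝ × ℝ)} {A B : SuperFun}

lemma analyticAt_bodies (hA : RealFun A) (hB : RealFun B) {x : Configuration}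
    (hx : x ∈ spacelike) :
    AnalyticAt ℝ (fun y => ((body (A y)).re, (body (B y)).re)) x :=
  ((Complex.reCLM.analyticAt _).comp (analyticAt_body (hA.analytic x hx))).prod
    ((Complex.reCLM.analyticAt _).comp (analyticAt_body (hB.analytic x hx)))

lemma evenFun_taylor (hφ : IsJet φ W) (hA : RealFun A) (hB : RealFun B)
    (hW : ∀ x ∈ spacelike, ((body (A x)).re, (body (B x)).re) ∈ W) :
    EvenFun fun x => taylor φ (A x) (B x) := by
  refine .sum _ fun k _ => .sum _ fun l _ => ⟨fun x hx => ?_, fun x hx => ?_⟩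
  · refine analyticAt_smul (AnalyticAt.div_const ?_) (analyticAt_mul
      (analyticAt_pow (analyticAt_soul (hA.analytic x hx)) k)
      (analyticAt_pow (analyticAt_soul (hB.analytic x hx)) l))
    exact AnalyticAt.fun_comp (hφ.analytic k l _ (hW x hx)) (analyticAt_bodies hA hB hx)
  · exact Subalgebra.smul_mem _ (mul_mem (pow_mem (soul_even (hA.even x hx)) k)
      (pow_mem (soul_even (hB.even x hx)) l)) _

/-- The factor `k` from the derivative of a power cancels against the factorial. The truncation is
harmless because the last term of the shifted sum is zero. -/
lemma sum_range_shift {M : Type*} [AddCommGroup M] [Module ℂ M] (f : ℕ → ℂ) (s : ℕ → M)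
    (hs : s 16 = 0) :
    ∑ k ∈ Finset.range 17, (f k / (k.factorial : ℂ)) • ((k : ℂ) • s (k - 1)) =
      ∑ k ∈ Finset.range 17, (f (k + 1) / (k.factorial : ℂ)) • s k := by
  rw [Finset.sum_range_succ', Finset.sum_range_succ (n := 16), hs]
  simp only [Nat.cast_zero, zero_smul, smul_zero, add_zero, Nat.add_sub_cancel, smul_smul]
  refine Finset.sum_congr rfl fun k _ => ?_
  congr 1
  rw [Nat.factorial_succ]
  push_cast
  have h1 : (k : ℂ) + 1 ≠ 0 := Nat.cast_add_one_ne_zero k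
  have h2 : (k.factorial : ℂ) ≠ 0 := Nat.cast_ne_zero.2 k.factorial_ne_zero
  field_simp

variable {a : OddIndex → Grassmann} {b : Fin 4 → Fin 4 → Grassmann} {x : Configuration}

/-- The ordinary chain rule for the bodies. Since the bodies are real, their real parts, at which
`φ` is evaluated, have the same derivatives as the bodies themselves. -/
lemma tangent_jet (hφ : IsJet φ W) (hA : RealFun A) (hB : RealFun B) (hx : x ∈ spacelike)
    (hW : ((body (A x)).re, (body (B x)).re) ∈ W) (k l : ℕ) :
    tangent a b (fun y => algebraMap ℂ Grassmann (φ k l ((body (A y)).re, (body (B y)).re))) x =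
      φ (k + 1) l ((body (A x)).re, (body (B x)).re) •
        tangent a b (fun y => algebraMap ℂ Grassmann (body (A y))) x +
      φ k (l + 1) ((body (A x)).re, (body (B x)).re) •
        tangent a b (fun y => algebraMap ℂ Grassmann (body (B y))) x := by
  have hp := analyticAt_bodies hA hB hx
  have hAd := (analyticAt_body (hA.analytic x hx)).differentiableAt
  have hBd := (analyticAt_body (hB.analytic x hx)).differentiableAt
  have hd := (hφ.analytic k l _ hW).differentiableAt
  have key : ∀ {C : SuperFun}, RealFun C → ∀ v,
      ((fderiv ℝ (fun y => (body (C y)).re) x v : ℝ) : ℂ) = fderiv ℝ (fun y => body (C y)) x v := by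
    intro C hC v
    have hCd := (analyticAt_body (hC.analytic x hx)).differentiableAt
    have h1 : HasFDerivAt (fun y => ((body (C y)).re : ℂ))
        (Complex.ofRealCLM.comp (Complex.reCLM.comp (fderiv ℝ (fun y => body (C y)) x))) x :=
      Complex.ofRealCLM.hasFDerivAt.comp x (Complex.reCLM.hasFDerivAt.comp x hCd.hasFDerivAt)
    have h2 : (fun y => ((body (C y)).re : ℂ)) =ᶠ[nhds x] fun y => body (C y) :=
      Filter.eventually_of_mem (isOpen_spacelike.mem_nhds hx) hC.real
    have h3 : HasFDerivAt (fun y => (body (C y)).re)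
        (Complex.reCLM.comp (fderiv ℝ (fun y => body (C y)) x)) x :=
      Complex.reCLM.hasFDerivAt.comp x hCd.hasFDerivAt
    rw [h3.fderiv, ← h2.fderiv_eq, h1.fderiv]
    simp
  have hrA : DifferentiableAt ℝ (fun y => (body (A y)).re) x :=
    (Complex.reCLM.hasFDerivAt.comp x hAd.hasFDerivAt).differentiableAt
  have hrB : DifferentiableAt ℝ (fun y => (body (B y)).re) x :=
    (Complex.reCLM.hasFDerivAt.comp x hBd.hasFDerivAt).differentiableAt
  have hchain := hd.hasFDerivAt.comp x (hrA.hasFDerivAt.prodMk hrB.hasFDerivAt)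
  have hc : DifferentiableAt ℝ (fun y => φ k l ((body (A y)).re, (body (B y)).re)) x :=
    hchain.differentiableAt
  have hfd : ∀ v, fderiv ℝ (fun y => φ k l ((body (A y)).re, (body (B y)).re)) x v =
      φ (k + 1) l ((body (A x)).re, (body (B x)).re) * fderiv ℝ (fun y => body (A y)) x v +
      φ k (l + 1) ((body (A x)).re, (body (B x)).re) * fderiv ℝ (fun y => body (B y)) x v := by
    intro v
    have := hchain.fderiv
    rw [Function.comp_def] at this
    rw [this, ContinuousLinearMap.comp_apply, fderiv_prod_apply, hφ.fst k l _ hW, hφ.snd k l _ hW]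
    simp only [ContinuousLinearMap.prod_apply]
    rw [key hA, key hB]
    ring
  rw [tangent_scalar hc, tangent_scalar hAd, tangent_scalar hBd]
  simp only [hfd, map_add, map_mul, mul_add, Finset.sum_add_distrib, Finset.smul_sum,
    ← Algebra.smul_def, mul_smul_comm]

/-- The derivative of each term has a part from the coefficient, proportional to the derivative of
the body, and a part from the powers of the soul. After the index shift both carry the same Taylor
sum, so the derivative of the body cancels and that of the whole argument remains. -/
lemma tangent_taylor (hφ : IsJet φ W) (hA : RealFun A) (hB : RealFun B) (hx : x ∈ spacelike)
    (hW : ((body (A x)).re, (body (B x)).re) ∈ W) :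
    tangent a b (fun y => taylor φ (A y) (B y)) x =
      taylor (fun k l => φ (k + 1) l) (A x) (B x) * tangent a b A x +
        taylor (fun k l => φ k (l + 1)) (A x) (B x) * tangent a b B x := by
  set p := ((body (A x)).re, (body (B x)).re) with hpdef
  set TA := tangent a b A x with hTA
  set TB := tangent a b B x with hTB
  set Tα := tangent a b (fun y => algebraMap ℂ Grassmann (body (A y))) x with hTα
  set Tβ := tangent a b (fun y => algebraMap ℂ Grassmann (body (B y))) x with hTβ
  have hAa := hA.analytic x hx
  have hBa := hB.analytic x hx
  have hsA := soul_even (hA.even x hx)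
  have hsB := soul_even (hB.even x hx)
  have dA : DifferentiableAt ℝ (fun y => soul (A y)) x := (analyticAt_soul hAa).differentiableAt
  have dB : DifferentiableAt ℝ (fun y => soul (B y)) x := (analyticAt_soul hBa).differentiableAt
  have tA : tangent a b (fun y => soul (A y)) x = TA - Tα :=
    tangent_sub hAa.differentiableAt (analyticAt_scalar (analyticAt_body hAa)).differentiableAt
  have tB : tangent a b (fun y => soul (B y)) x = TB - Tβ :=
    tangent_sub hBa.differentiableAt (analyticAt_scalar (analyticAt_body hBa)).differentiableAt
  have hterm : ∀ k l : ℕ, tangent a b (fun y =>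
      (φ k l ((body (A y)).re, (body (B y)).re) / ((k.factorial : ℂ) * (l.factorial : ℂ))) •
        (soul (A y) ^ k * soul (B y) ^ l)) x =
      ((φ (k + 1) l p / ((k.factorial : ℂ) * (l.factorial : ℂ))) • (soul (A x) ^ k * soul (B x) ^ l)) * Tα +
      ((φ k (l + 1) p / ((k.factorial : ℂ) * (l.factorial : ℂ))) • (soul (A x) ^ k * soul (B x) ^ l)) * Tβ +
      ((φ k l p / ((k.factorial : ℂ) * (l.factorial : ℂ))) •
        ((k : ℂ) • soul (A x) ^ (k - 1) * soul (B x) ^ l)) * (TA - Tα) +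
      ((φ k l p / ((k.factorial : ℂ) * (l.factorial : ℂ))) •
        (soul (A x) ^ k * ((l : ℂ) • soul (B x) ^ (l - 1)))) * (TB - Tβ) := by
    intro k l
    have e : (fun y => (φ k l ((body (A y)).re, (body (B y)).re) /
        ((k.factorial : ℂ) * (l.factorial : ℂ))) • (soul (A y) ^ k * soul (B y) ^ l)) =
        fun y => ((k.factorial : ℂ) * (l.factorial : ℂ))⁻¹ •
          (algebraMap ℂ Grassmann (φ k l ((body (A y)).re, (body (B y)).re)) *
            (soul (A y) ^ k * soul (B y) ^ l)) := by
      funext y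
      rw [← Algebra.smul_def, smul_smul, div_eq_inv_mul]
    have d1 : DifferentiableAt ℝ (fun y => algebraMap ℂ Grassmann
        (φ k l ((body (A y)).re, (body (B y)).re))) x := by
      refine (analyticAt_scalar ?_).differentiableAt
      exact AnalyticAt.fun_comp (hφ.analytic k l _ hW) (analyticAt_bodies hA hB hx)
    have d2 := differentiableAt_pow dA k
    have d3 := differentiableAt_pow dB l
    have hcomm : ∀ c, c * soul (B x) ^ l = soul (B x) ^ l * c :=
      fun c => ((even_commute (pow_mem hsB l) c).eq).symm
    rw [e, tangent_smul _ (differentiableAt_mul d1 (differentiableAt_mul d2 d3)),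
      tangent_mul d1 (differentiableAt_mul d2 d3) (Subalgebra.algebraMap_mem _ _),
      tangent_mul d2 d3 (pow_mem hsA k), tangent_pow dA hsA, tangent_pow dB hsB,
      tangent_jet hφ hA hB hx hW, tA, tB, ← Algebra.smul_def]
    have hc1 : ∀ c, c * (soul (A x) ^ k * soul (B x) ^ l) =
        soul (A x) ^ k * soul (B x) ^ l * c := fun c =>
      ((even_commute (mul_mem (pow_mem hsA k) (pow_mem hsB l)) c).eq).symm
    have hc2 : soul (A x) ^ (k - 1) * (TA - Tα) * soul (B x) ^ l =
        soul (A x) ^ (k - 1) * soul (B x) ^ l * (TA - Tα) := by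
      rw [mul_assoc, hcomm, mul_assoc]
    simp only [add_mul, smul_mul_assoc]
    rw [hc1, hc1, hc2]
    simp only [smul_mul_assoc, mul_smul_comm, ← mul_assoc, div_eq_mul_inv, mul_inv, smul_add,
      smul_smul, ← hpdef]
    module
  have hzA : ∀ l, soul (A x) ^ 16 * soul (B x) ^ l = 0 := fun l => by
    rw [soul_pow_eq_zero (hA.even x hx) (by norm_num), zero_mul]
  have hzB : ∀ k, soul (A x) ^ k * soul (B x) ^ 16 = 0 := fun k => by
    rw [soul_pow_eq_zero (hB.even x hx) (by norm_num), mul_zero]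
  have hdiff : ∀ k l : ℕ, DifferentiableAt ℝ (fun y =>
      (φ k l ((body (A y)).re, (body (B y)).re) / ((k.factorial : ℂ) * (l.factorial : ℂ))) •
        (soul (A y) ^ k * soul (B y) ^ l)) x := by
    intro k l
    refine (analyticAt_smul (AnalyticAt.div_const ?_) (analyticAt_mul
      (analyticAt_pow (analyticAt_soul hAa) k)
      (analyticAt_pow (analyticAt_soul hBa) l))).differentiableAt
    exact AnalyticAt.fun_comp (hφ.analytic k l _ hW) (analyticAt_bodies hA hB hx)
  have s1 : ∑ k ∈ Finset.range 17, ∑ l ∈ Finset.range 17, (φ k l p / ((k.factorial : ℂ) * (l.factorial : ℂ))) •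
        ((k : ℂ) • soul (A x) ^ (k - 1) * soul (B x) ^ l) =
      taylor (fun k l => φ (k + 1) l) (A x) (B x) := by
    refine Finset.sum_comm.trans (Eq.trans ?_ Finset.sum_comm)
    refine Finset.sum_congr rfl fun l _ => ?_
    have := sum_range_shift (fun k => φ k l p / l.factorial)
      (fun k => soul (A x) ^ k * soul (B x) ^ l) (hzA l)
    simp only [smul_mul_assoc, div_div] at this ⊢
    simp only [mul_comm ((Nat.factorial l : ℕ) : ℂ)] at this
    exact this
  have s2 : ∑ k ∈ Finset.range 17, ∑ l ∈ Finset.range 17, (φ k l p / ((k.factorial : ℂ) * (l.factorial : ℂ))) •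
        (soul (A x) ^ k * ((l : ℂ) • soul (B x) ^ (l - 1))) =
      taylor (fun k l => φ k (l + 1)) (A x) (B x) := by
    rw [taylor]
    refine Finset.sum_congr rfl fun k _ => ?_
    have := sum_range_shift (fun l => φ k l p / k.factorial)
      (fun l => soul (A x) ^ k * soul (B x) ^ l) (hzB k)
    simp only [mul_smul_comm, div_div] at this ⊢
    exact this
  have e1 : tangent a b (fun y => taylor φ (A y) (B y)) x =
      taylor (fun k l => φ (k + 1) l) (A x) (B x) * Tα +
      taylor (fun k l => φ k (l + 1)) (A x) (B x) * Tβ +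
      taylor (fun k l => φ (k + 1) l) (A x) (B x) * (TA - Tα) +
      taylor (fun k l => φ k (l + 1)) (A x) (B x) * (TB - Tβ) := by
    rw [show (fun y => taylor φ (A y) (B y)) = fun y => ∑ k ∈ Finset.range 17,
      ∑ l ∈ Finset.range 17, (φ k l ((body (A y)).re, (body (B y)).re) /
        ((k.factorial : ℂ) * (l.factorial : ℂ))) • (soul (A y) ^ k * soul (B y) ^ l) from rfl,
      tangent_sum _ fun k _ => DifferentiableAt.fun_sum fun l _ => hdiff k l]
    simp only [fun k => tangent_sum (a := a) (b := b) (Finset.range 17) fun l _ => hdiff k l,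
      hterm, Finset.sum_add_distrib, ← Finset.sum_mul]
    rw [s1, s2]
    rfl
  rw [e1]
  noncomm_ring

end Taylor

end
end ChiralFourPoint

namespace ChiralFourPoint
noncomputable section

/-! ### Powers -/

/-- The power series of `(b + X) ^ r` in `X`. -/
def powSeries (b : ℂ) (r : ℝ) : PowerSeries ℂ :=
  PowerSeries.mk fun k =>
    ((∏ j ∈ Finset.range k, ((r : ℂ) - j)) / (k.factorial : ℂ)) * b ^ ((r : ℂ) - k)

lemma choose_eq_prod (r : ℂ) (k : ℕ) :
    Ring.choose r k = (∏ j ∈ Finset.range k, (r - j)) / (k.factorial : ℂ) := by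
  rw [Ring.choose_eq_smul, ← descPochhammer_eval_eq_prod_range, smul_eq_mul, div_eq_inv_mul,
    Polynomial.descPochhammer_smeval_eq_ascPochhammer]
  rw [descPochhammer_eval_eq_ascPochhammer, Polynomial.ascPochhammer_smeval_eq_eval]

/-- This is the Chu–Vandermonde identity for generalised binomial coefficients. -/
lemma powSeries_mul {b : ℂ} (hb : b ≠ 0) (r s : ℝ) :
    powSeries b r * powSeries b s = powSeries b (r + s) := by
  ext n
  rw [PowerSeries.coeff_mul]
  simp only [powSeries, PowerSeries.coeff_mk, ← choose_eq_prod]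
  rw [Complex.ofReal_add, Ring.add_choose_eq n (Commute.all (r : ℂ) (s : ℂ)), Finset.sum_mul]
  refine Finset.sum_congr rfl fun p hp' => ?_
  have hp := Finset.HasAntidiagonal.mem_antidiagonal.1 hp'
  have : b ^ ((r : ℂ) + s - n) = b ^ ((r : ℂ) - p.1) * b ^ ((s : ℂ) - p.2) := by
    rw [← Complex.cpow_add _ _ hb, ← hp]
    push_cast
    ring_nf
  rw [this]
  ring

lemma spow_eq_aeval (a : Grassmann) (r : ℝ) :
    spow a r = Polynomial.aeval (soul a) (PowerSeries.trunc 17 (powSeries (body a) r)) := by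
  rw [Polynomial.aeval_def, PowerSeries.eval₂_trunc_eq_sum_range, spow]
  refine Finset.sum_congr rfl fun k _ => ?_
  rw [powSeries, PowerSeries.coeff_mk, Algebra.smul_def]

lemma soul_pow_seventeen (a : Grassmann) : soul a ^ 17 = 0 :=
  eq_zero_of_mem_filt (n := 17 * 1) (by norm_num) (pow_mem_filt (soul_mem_filt a) 17)

lemma aeval_soul_trunc (a : Grassmann) (p : Polynomial ℂ) :
    Polynomial.aeval (soul a) (PowerSeries.trunc 17 (p : PowerSeries ℂ)) =
      Polynomial.aeval (soul a) p := by
  have h : Polynomial.X ^ 17 ∣ PowerSeries.trunc 17 (p : PowerSeries ℂ) - p := by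
    rw [Polynomial.X_pow_dvd_iff]
    intro d hd
    rw [Polynomial.coeff_sub, PowerSeries.coeff_trunc, if_pos hd, Polynomial.coeff_coe, sub_self]
  obtain ⟨q, hq⟩ := h
  have := congrArg (Polynomial.aeval (soul a)) hq
  rw [map_sub, map_mul, map_pow, Polynomial.aeval_X, soul_pow_seventeen, zero_mul] at this
  exact sub_eq_zero.1 this

/-- The exponent law holds for the power series at the body, and evaluation at the soul only sees
series modulo `X ^ 17`. -/
lemma spow_add {a : Grassmann} (ha : body a ≠ 0) (r s : ℝ) :
    spow a (r + s) = spow a r * spow a s := by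
  rw [spow_eq_aeval, spow_eq_aeval, spow_eq_aeval, ← map_mul, ← aeval_soul_trunc a (_ * _),
    Polynomial.coe_mul, PowerSeries.trunc_trunc_mul_trunc, powSeries_mul ha]

lemma spow_zero (a : Grassmann) : spow a 0 = 1 := by
  rw [spow, Finset.sum_range_succ', Finset.sum_eq_zero]
  · simp
  · intro k _
    simp [Finset.prod_range_succ']

lemma spow_one (a : Grassmann) : spow a 1 = a := by
  rw [spow, Finset.sum_range_succ', Finset.sum_range_succ', Finset.sum_eq_zero]
  · simp [soul, Algebra.algebraMap_eq_smul_one]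
  · intro k _
    simp [Finset.prod_range_succ']

lemma sinv_mul {a : Grassmann} (ha : body a ≠ 0) : sinv a * a = 1 := by
  have h := spow_add ha (-1) 1
  rw [spow_one] at h
  rw [sinv, ← h]
  norm_num [spow_zero]

lemma mul_sinv {a : Grassmann} (ha : body a ≠ 0) : a * sinv a = 1 := by
  have h := spow_add ha 1 (-1)
  rw [spow_one] at h
  rw [sinv, ← h]
  norm_num [spow_zero]

lemma body_soul (a : Grassmann) : body (soul a) = 0 := by simp [soul]

lemma body_spow (a : Grassmann) (r : ℝ) : body (spow a r) = body a ^ (r : ℂ) := by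
  rw [spow, map_sum, Finset.sum_range_succ', Finset.sum_eq_zero]
  · simp
  · intro k _
    simp [body_soul]

lemma spow_even {a : Grassmann} (ha : a ∈ evenPart) (r : ℝ) : spow a r ∈ evenPart :=
  sum_mem fun k _ => Subalgebra.smul_mem _ (pow_mem (soul_even ha) k) _

lemma body_sinv (a : Grassmann) : body (sinv a) = (body a)⁻¹ := by
  rw [sinv, body_spow, Complex.ofReal_neg, Complex.ofReal_one, Complex.cpow_neg_one]

/-- The partial derivatives of `(s, t) ↦ s ^ r`. -/
def powJet (r : ℝ) (k l : ℕ) (p : ℝ × ℝ) : ℂ :=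
  if l = 0 then (∏ j ∈ Finset.range k, ((r : ℂ) - j)) * (p.1 : ℂ) ^ ((r : ℂ) - k) else 0

/-- The squares of space-like intervals have negative bodies, on the cut of the principal branch.
Restricted to the negative axis the branch is nevertheless analytic, being a constant phase times
the power of `-y`. -/
lemma analyticAt_ofReal_cpow {x : ℝ} (hx : x ≠ 0) (r : ℂ) :
    AnalyticAt ℝ (fun y : ℝ => (y : ℂ) ^ r) x := by
  have hof : AnalyticAt ℝ (fun y : ℝ => (y : ℂ)) x := Complex.ofRealCLM.analyticAt x
  rcases lt_or_gt_of_ne hx with h | h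
  · have h1 : AnalyticAt ℝ (fun y : ℝ => (-(y : ℂ)) ^ r * Complex.exp (Real.pi * Complex.I * r)) x := by
      have h2 : AnalyticAt ℝ (fun z : ℂ => z ^ r) (-(x : ℂ)) :=
        (AnalyticAt.cpow analyticAt_id analyticAt_const
          (by simp [Complex.slitPlane, h])).restrictScalars
      exact (h2.fun_comp (f := fun y : ℝ => -(y : ℂ)) hof.neg).mul analyticAt_const
    refine h1.congr ?_
    filter_upwards [gt_mem_nhds h] with y hy
    rw [Complex.ofReal_cpow_of_nonpos (le_of_lt hy)]
  · have h2 : AnalyticAt ℝ (fun z : ℂ => z ^ r) (x : ℂ) :=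
      (AnalyticAt.cpow analyticAt_id analyticAt_const
        (by simp [Complex.slitPlane, h])).restrictScalars
    exact h2.fun_comp (f := fun y : ℝ => (y : ℂ)) hof

lemma hasDerivAt_ofReal_cpow_all {x : ℝ} (hx : x ≠ 0) (r : ℂ) :
    HasDerivAt (fun y : ℝ => (y : ℂ) ^ r) (r * (x : ℂ) ^ (r - 1)) x := by
  by_cases hr : r = 0
  · simpa [hr] using hasDerivAt_const x (1 : ℂ)
  · exact hasDerivAt_ofReal_cpow_const hx hr

lemma isJet_powJet (r : ℝ) : IsJet (powJet r) {p | p.1 ≠ 0} := by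
  have key : ∀ k l, ∀ p ∈ {p : ℝ × ℝ | p.1 ≠ 0}, HasFDerivAt (powJet r k l)
      ((ContinuousLinearMap.fst ℝ ℝ ℝ).smulRight (powJet r (k + 1) l p)) p := by
    intro k l p hp
    by_cases hl : l = 0
    · have h := (hasDerivAt_ofReal_cpow_all hp ((r : ℂ) - k)).const_mul
        (∏ j ∈ Finset.range k, ((r : ℂ) - j))
      have h2 := h.hasFDerivAt.comp p (hasFDerivAt_fst (𝕜 := ℝ) (p := p))
      refine (h2.congr_fderiv ?_).congr_of_eventuallyEq (Filter.Eventually.of_forall fun q => ?_)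
      · ext <;> simp [powJet, hl, Finset.prod_range_succ]
        rw [mul_assoc, sub_sub]
      · simp [powJet, hl]
    · have : powJet r k l = fun _ => 0 := by funext q; simp [powJet, hl]
      rw [this]
      refine (hasFDerivAt_const (0 : ℂ) p).congr_fderiv ?_
      ext <;> simp [powJet, hl]
  refine ⟨fun k l p hp => ?_, fun k l p hp => ?_, fun k l p hp => ?_⟩
  · by_cases hl : l = 0
    · have h1 : AnalyticAt ℝ (fun q : ℝ × ℝ => (∏ j ∈ Finset.range k, ((r : ℂ) - j)) *
          (q.1 : ℂ) ^ ((r : ℂ) - k)) p :=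
        analyticAt_const.mul
          ((analyticAt_ofReal_cpow hp _).fun_comp (f := fun q : ℝ × ℝ => q.1) analyticAt_fst)
      exact h1.congr (Filter.Eventually.of_forall fun q => by simp [powJet, hl])
    · have h1 : AnalyticAt ℝ (fun _ : ℝ × ℝ => (0 : ℂ)) p := analyticAt_const
      exact h1.congr (Filter.Eventually.of_forall fun q => by simp [powJet, hl])
  · rw [(key k l p hp).fderiv]; simp
  · rw [(key k l p hp).fderiv]
    by_cases hl : l = 0 <;> simp [powJet, hl]

/-- Powers are treated as functions of two arguments, the second one idle, so that the chain rule
`tangent_taylor` covers them too. -/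
lemma spow_eq_taylor {a : Grassmann} (ha : ((body a).re : ℂ) = body a) (r : ℝ) :
    spow a r = taylor (powJet r) a 0 := by
  rw [spow, taylor]
  refine Finset.sum_congr rfl fun k _ => ?_
  rw [Finset.sum_eq_single 0]
  · simp only [powJet, if_pos, ha, pow_zero, mul_one, Nat.factorial_zero, Nat.cast_one]
    congr 1
    ring
  · intro l _ hl
    simp [powJet, hl]
  · simp

lemma powJet_succ (r : ℝ) (k l : ℕ) (p : ℝ × ℝ) :
    powJet r (k + 1) l p = r * powJet (r - 1) k l p := by
  by_cases hl : l = 0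
  · simp only [powJet, hl, if_true, Finset.prod_range_succ', Nat.cast_zero, sub_zero]
    push_cast
    rw [show (r : ℂ) - (k + 1) = r - 1 - k by ring]
    simp only [show ∀ j : ℕ, (r : ℂ) - (j + 1) = r - 1 - j from fun j => by ring]
    ring
  · simp [powJet, hl]

lemma taylor_const_mul (c : ℂ) (φ : ℕ → ℕ → ℝ × ℝ → ℂ) (A B : Grassmann) :
    taylor (fun k l p => c * φ k l p) A B = c • taylor φ A B := by
  simp only [taylor, Finset.smul_sum, smul_smul, mul_div_assoc]

lemma taylor_congr {φ ψ : ℕ → ℕ → ℝ × ℝ → ℂ} {A B : Grassmann}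
    (h : ∀ k l, φ k l ((body A).re, (body B).re) = ψ k l ((body A).re, (body B).re)) :
    taylor φ A B = taylor ψ A B := by
  simp only [taylor, h]

lemma UnitFun.mem {A : SuperFun} (hA : UnitFun A) {x : Configuration} (hx : x ∈ spacelike)
    (B : Grassmann) : ((body (A x)).re, (body B).re) ∈ {p : ℝ × ℝ | p.1 ≠ 0} := by
  have h1 := hA.ne x hx
  rw [← hA.real x hx] at h1
  exact_mod_cast h1

lemma UnitFun.spow_evenFun {A : SuperFun} (hA : UnitFun A) (r : ℝ) :
    EvenFun fun x => spow (A x) r := by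
  have h := evenFun_taylor (isJet_powJet r) hA.toRealFun RealFun.zero fun x hx => hA.mem hx 0
  refine ⟨fun x hx => (h.analytic x hx).congr ?_, fun x hx => spow_even (hA.even x hx) r⟩
  filter_upwards [isOpen_spacelike.mem_nhds hx] with y hy
  rw [spow_eq_taylor (hA.real y hy)]

lemma UnitFun.sinv {A : SuperFun} (hA : UnitFun A) : UnitFun fun x => sinv (A x) :=
  ⟨⟨hA.spow_evenFun (-1), fun x hx => by
    rw [body_sinv, ← hA.real x hx, ← Complex.ofReal_inv, Complex.ofReal_re]⟩,
    fun x hx => by rw [body_sinv]; exact inv_ne_zero (hA.ne x hx)⟩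

section
variable {a : OddIndex → Grassmann} {b : Fin 4 → Fin 4 → Grassmann} {x : Configuration}

lemma tangent_spow {A : SuperFun} (hA : UnitFun A) (hx : x ∈ spacelike) (r : ℝ) :
    tangent a b (fun y => spow (A y) r) x = (r : ℂ) • (spow (A x) (r - 1) * tangent a b A x) := by
  rw [tangent_congr hx fun y hy => spow_eq_taylor (hA.real y hy) r,
    tangent_taylor (B := fun _ => 0) (isJet_powJet r) hA.toRealFun RealFun.zero hx (hA.mem hx 0)]
  have h0 : tangent a b (fun _ => (0 : Grassmann)) x = 0 := by
    simpa using tangent_const (a := a) (b := b) (x := x) 0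
  rw [h0, mul_zero, add_zero,
    taylor_congr (ψ := fun k l p => r * powJet (r - 1) k l p) fun k l => powJet_succ r k l _,
    taylor_const_mul,
    smul_mul_assoc, spow_eq_taylor (hA.real x hx)]

/-- `A` has logarithmic derivative `l` at `x` along the operator with coefficients `a`, `b`. -/
def HasLog (a : OddIndex → Grassmann) (b : Fin 4 → Fin 4 → Grassmann) (x : Configuration)
    (A : SuperFun) (l : Grassmann) : Prop := tangent a b A x = A x * l

lemma HasLog.mul {A B : SuperFun} {l m : Grassmann} (hA : EvenFun A) (hB : EvenFun B)
    (hx : x ∈ spacelike) (h : HasLog a b x A l) (k : HasLog a b x B m) :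
    HasLog a b x (fun y => A y * B y) (l + m) := by
  rw [HasLog] at *
  rw [tangent_mul (hA.diff hx) (hB.diff hx) (hA.even x hx), h, k, mul_assoc (A x) l,
    ← (even_commute (hB.even x hx) l).eq, mul_add, mul_assoc, mul_assoc]

lemma HasLog.spow {A : SuperFun} {l : Grassmann} (hA : UnitFun A) (hx : x ∈ spacelike)
    (h : HasLog a b x A l) (r : ℝ) : HasLog a b x (fun y => spow (A y) r) ((r : ℂ) • l) := by
  rw [HasLog] at *
  rw [tangent_spow hA hx, h, ← mul_assoc]
  nth_rewrite 2 [← spow_one (A x)]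
  rw [← spow_add (hA.ne x hx), sub_add_cancel, mul_smul_comm]

lemma HasLog.sinv {A : SuperFun} {l : Grassmann} (hA : UnitFun A) (hx : x ∈ spacelike)
    (h : HasLog a b x A l) : HasLog a b x (fun y => sinv (A y)) (-l) := by
  have := h.spow hA hx (-1)
  rwa [Complex.ofReal_neg, Complex.ofReal_one, neg_one_smul] at this

lemma hasLog_sinv_mul {A : SuperFun} (hA : UnitFun A) (hx : x ∈ spacelike) :
    HasLog a b x A (ChiralFourPoint.sinv (A x) * tangent a b A x) := by
  rw [HasLog, ← mul_assoc, mul_sinv (hA.ne x hx), one_mul]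

lemma HasLog.unique {A : SuperFun} {l m : Grassmann} (hA : UnitFun A) (hx : x ∈ spacelike)
    (h : HasLog a b x A l) (k : HasLog a b x A m) : l = m := by
  have := h.symm.trans k
  have h2 := congrArg (ChiralFourPoint.sinv (A x) * ·) this
  simpa only [← mul_assoc, sinv_mul (hA.ne x hx), one_mul] using h2

end

/-! ### Functions of two even Grassmann numbers -/

/-- The partial derivative with respect to the first variable. -/
def pd1 (f : ℝ × ℝ → ℂ) : ℝ × ℝ → ℂ := fun p => fderiv ℝ f p (1, 0)

/-- The partial derivative with respect to the second variable. -/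
def pd2 (f : ℝ × ℝ → ℂ) : ℝ × ℝ → ℂ := fun p => fderiv ℝ f p (0, 1)

lemma isOpen_crossRatioRange : IsOpen crossRatioRange :=
  (isOpen_lt continuous_const continuous_fst).inter (isOpen_lt continuous_const continuous_snd)

section Partial
variable {f g : ℝ × ℝ → ℂ}

local notation "W" => crossRatioRange

lemma analytic_pd1 (hf : AnalyticOnNhd ℝ f W) : AnalyticOnNhd ℝ (pd1 f) W := fun p hp =>
  ((ContinuousLinearMap.apply ℝ ℂ ((1, 0) : ℝ × ℝ)).analyticAt _).comp (hf p hp).fderiv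

lemma analytic_pd2 (hf : AnalyticOnNhd ℝ f W) : AnalyticOnNhd ℝ (pd2 f) W := fun p hp =>
  ((ContinuousLinearMap.apply ℝ ℂ ((0, 1) : ℝ × ℝ)).analyticAt _).comp (hf p hp).fderiv

lemma analytic_iterate {op : (ℝ × ℝ → ℂ) → ℝ × ℝ → ℂ}
    (hop : ∀ {f}, AnalyticOnNhd ℝ f W → AnalyticOnNhd ℝ (op f) W) (hf : AnalyticOnNhd ℝ f W)
    (k : ℕ) : AnalyticOnNhd ℝ (op^[k] f) W := by
  induction k generalizing f with
  | zero => exact hf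
  | succ k ih => exact ih (hop hf)

lemma eqOn_fderiv (h : Set.EqOn f g W) {p : ℝ × ℝ} (hp : p ∈ W) : fderiv ℝ f p = fderiv ℝ g p :=
  Filter.EventuallyEq.fderiv_eq (Filter.eventually_of_mem (isOpen_crossRatioRange.mem_nhds hp) h)

lemma eqOn_pd1 (h : Set.EqOn f g W) : Set.EqOn (pd1 f) (pd1 g) W := fun p hp => by
  rw [pd1, eqOn_fderiv h hp, pd1]

lemma eqOn_pd2 (h : Set.EqOn f g W) : Set.EqOn (pd2 f) (pd2 g) W := fun p hp => by
  rw [pd2, eqOn_fderiv h hp, pd2]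

lemma eqOn_iterate {op : (ℝ × ℝ → ℂ) → ℝ × ℝ → ℂ}
    (hop : ∀ {f g}, Set.EqOn f g W → Set.EqOn (op f) (op g) W) (h : Set.EqOn f g W) (k : ℕ) :
    Set.EqOn (op^[k] f) (op^[k] g) W := by
  induction k generalizing f g with
  | zero => exact h
  | succ k ih => exact ih (hop h)

lemma pd2_pd1 (hf : AnalyticOnNhd ℝ f W) : Set.EqOn (pd2 (pd1 f)) (pd1 (pd2 f)) W := by
  intro p hp
  have hs : IsSymmSndFDerivAt ℝ f p :=
    ContDiffAt.isSymmSndFDerivAt (n := 2) (hf p hp).contDiffAt (by simp)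
  have hd : DifferentiableAt ℝ (fderiv ℝ f) p := (hf p hp).fderiv.differentiableAt
  have key : ∀ v w : ℝ × ℝ, fderiv ℝ (fun q => fderiv ℝ f q v) p w =
      fderiv ℝ (fderiv ℝ f) p w v := by
    intro v w
    have h : HasFDerivAt (fun q => fderiv ℝ f q v)
        ((ContinuousLinearMap.apply ℝ ℂ v).comp (fderiv ℝ (fderiv ℝ f) p)) p :=
      (ContinuousLinearMap.apply ℝ ℂ v).hasFDerivAt.comp p hd.hasFDerivAt
    rw [h.fderiv]; rfl
  change fderiv ℝ (fun q => fderiv ℝ f q (1, 0)) p (0, 1) =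
    fderiv ℝ (fun q => fderiv ℝ f q (0, 1)) p (1, 0)
  rw [key, key, hs.eq]

lemma pd2_iterate_pd1 (hf : AnalyticOnNhd ℝ f W) (k : ℕ) :
    Set.EqOn (pd2 (pd1^[k] f)) (pd1^[k] (pd2 f)) W := by
  induction k generalizing f with
  | zero => exact fun _ _ => rfl
  | succ k ih => exact (ih (analytic_pd1 hf)).trans (eqOn_iterate eqOn_pd1 (pd2_pd1 hf) k)

lemma iterate_pd2_pd1 (hf : AnalyticOnNhd ℝ f W) (l : ℕ) :
    Set.EqOn (pd2^[l] (pd1 f)) (pd1 (pd2^[l] f)) W := by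
  induction l generalizing f with
  | zero => exact fun _ _ => rfl
  | succ k ih => exact (eqOn_iterate eqOn_pd2 (pd2_pd1 hf) k).trans (ih (analytic_pd2 hf))

/-- The family of all partial derivatives. -/
def jetOf (f : ℝ × ℝ → ℂ) (k l : ℕ) : ℝ × ℝ → ℂ := pd1^[k] (pd2^[l] f)

lemma isJet_jetOf (hf : AnalyticOnNhd ℝ f W) : IsJet (jetOf f) W := by
  have ha : ∀ l, AnalyticOnNhd ℝ (pd2^[l] f) W := analytic_iterate analytic_pd2 hf
  refine ⟨fun k l => analytic_iterate analytic_pd1 (ha l) k, fun k l p _ => ?_, fun k l p hp => ?_⟩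
  · rw [jetOf, jetOf, Function.iterate_succ_apply']; rfl
  · rw [jetOf, jetOf, Function.iterate_succ_apply' pd2]
    exact pd2_iterate_pd1 (ha l) k hp

lemma jetOf_pd1 (hf : AnalyticOnNhd ℝ f W) (k l : ℕ) :
    Set.EqOn (jetOf (pd1 f) k l) (jetOf f (k + 1) l) W :=
  eqOn_iterate eqOn_pd1 (iterate_pd2_pd1 hf l) k

lemma eqOn_jetOf (h : Set.EqOn f g W) (k l : ℕ) : Set.EqOn (jetOf f k l) (jetOf g k l) W :=
  eqOn_iterate eqOn_pd1 (eqOn_iterate eqOn_pd2 h l) k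

lemma deriv_fst (hf : AnalyticOnNhd ℝ f W) {p : ℝ × ℝ} (hp : p ∈ W) :
    deriv (fun s => f (s, p.2)) p.1 = pd1 f p := by
  have h1 : HasFDerivAt f (fderiv ℝ f p) (p.1, p.2) := (hf p hp).differentiableAt.hasFDerivAt
  have h2 : HasDerivAt (fun s : ℝ => (s, p.2)) ((1 : ℝ), (0 : ℝ)) p.1 :=
    (hasDerivAt_id p.1).prodMk (hasDerivAt_const p.1 p.2)
  exact (h1.comp_hasDerivAt p.1 h2).deriv

lemma deriv_snd (hf : AnalyticOnNhd ℝ f W) {p : ℝ × ℝ} (hp : p ∈ W) :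
    deriv (fun t => f (p.1, t)) p.2 = pd2 f p := by
  have h1 : HasFDerivAt f (fderiv ℝ f p) (p.1, p.2) := (hf p hp).differentiableAt.hasFDerivAt
  have h2 : HasDerivAt (fun t : ℝ => (p.1, t)) ((0 : ℝ), (1 : ℝ)) p.2 :=
    (hasDerivAt_const p.2 p.1).prodMk (hasDerivAt_id p.2)
  exact (h1.comp_hasDerivAt p.2 h2).deriv

lemma iteratedDeriv_fst (hf : AnalyticOnNhd ℝ f W) (k : ℕ) {p : ℝ × ℝ} (hp : p ∈ W) :
    iteratedDeriv k (fun s => f (s, p.2)) p.1 = pd1^[k] f p := by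
  induction k generalizing p with
  | zero => simp
  | succ k ih =>
    rw [iteratedDeriv_succ, Function.iterate_succ_apply', ← deriv_fst
      (analytic_iterate analytic_pd1 hf k) hp]
    refine Filter.EventuallyEq.deriv_eq ?_
    filter_upwards [lt_mem_nhds hp.1] with s hs
    exact ih (p := (s, p.2)) ⟨hs, hp.2⟩

lemma iteratedDeriv_snd (hf : AnalyticOnNhd ℝ f W) (l : ℕ) {p : ℝ × ℝ} (hp : p ∈ W) :
    iteratedDeriv l (fun t => f (p.1, t)) p.2 = pd2^[l] f p := by
  induction l generalizing p with
  | zero => simp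
  | succ k ih =>
    rw [iteratedDeriv_succ, Function.iterate_succ_apply', ← deriv_snd
      (analytic_iterate analytic_pd2 hf k) hp]
    refine Filter.EventuallyEq.deriv_eq ?_
    filter_upwards [lt_mem_nhds hp.2] with t ht
    exact ih (p := (p.1, t)) ⟨hp.1, ht⟩

/-- The iterated slice derivatives in `superEval` agree with iterated partial derivatives because
the domain is open, so that slices stay in it for nearby arguments. -/
lemma superEval_eq_taylor (hf : AnalyticOnNhd ℝ f W) {A B : Grassmann}
    (hp : ((body A).re, (body B).re) ∈ W) : superEval f A B = taylor (jetOf f) A B := by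
  rw [superEval, taylor]
  refine Finset.sum_congr rfl fun k _ => Finset.sum_congr rfl fun l _ => ?_
  congr 2
  rw [jetOf, ← iteratedDeriv_fst (analytic_iterate analytic_pd2 hf l) k hp]
  refine Filter.EventuallyEq.iteratedDeriv_eq k ?_
  filter_upwards [lt_mem_nhds hp.1] with s hs
  exact iteratedDeriv_snd hf l (p := (s, (body B).re)) ⟨hs, hp.2⟩

lemma eulerOp_eq (hf : AnalyticOnNhd ℝ f W) : Set.EqOn (eulerOp f) (fun p => p.1 * pd1 f p) W :=
  fun p hp => by rw [eulerOp, deriv_fst hf hp]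

lemma analytic_fst_mul (hf : AnalyticOnNhd ℝ f W) :
    AnalyticOnNhd ℝ (fun p : ℝ × ℝ => (p.1 : ℂ) * f p) W := fun p hp =>
  ((Complex.ofRealCLM.analyticAt p.1).fun_comp (f := fun q : ℝ × ℝ => q.1) analyticAt_fst).mul
    (hf p hp)

lemma analytic_eulerOp (hf : AnalyticOnNhd ℝ f W) : AnalyticOnNhd ℝ (eulerOp f) W := fun p hp =>
  (analytic_fst_mul (analytic_pd1 hf) p hp).congr
    (Filter.eventually_of_mem (isOpen_crossRatioRange.mem_nhds hp)
      fun _ hq => (eulerOp_eq hf hq).symm)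

lemma fderiv_fst_mul (hf : AnalyticOnNhd ℝ f W) {p : ℝ × ℝ} (hp : p ∈ W) (v : ℝ × ℝ) :
    fderiv ℝ (fun p : ℝ × ℝ => (p.1 : ℂ) * f p) p v = p.1 * fderiv ℝ f p v + v.1 * f p := by
  have h1 : HasFDerivAt (fun q : ℝ × ℝ => (q.1 : ℂ))
      (Complex.ofRealCLM.comp (ContinuousLinearMap.fst ℝ ℝ ℝ)) p :=
    Complex.ofRealCLM.hasFDerivAt.comp p hasFDerivAt_fst
  have h2 := h1.mul (hf p hp).differentiableAt.hasFDerivAt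
  have h3 : fderiv ℝ (fun p : ℝ × ℝ => (p.1 : ℂ) * f p) p = _ := h2.fderiv
  rw [h3]
  simp [mul_comm]

lemma pd2_fst_mul (hf : AnalyticOnNhd ℝ f W) :
    Set.EqOn (pd2 fun p : ℝ × ℝ => (p.1 : ℂ) * f p) (fun p => (p.1 : ℂ) * pd2 f p) W :=
  fun p hp => by simp [pd2, fderiv_fst_mul hf hp]

lemma iterate_pd2_fst_mul (hf : AnalyticOnNhd ℝ f W) (l : ℕ) :
    Set.EqOn (pd2^[l] fun p : ℝ × ℝ => (p.1 : ℂ) * f p) (fun p => (p.1 : ℂ) * pd2^[l] f p) W := by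
  induction l generalizing f with
  | zero => exact fun _ _ => rfl
  | succ l ih => exact (eqOn_iterate eqOn_pd2 (pd2_fst_mul hf) l).trans (ih (analytic_pd2 hf))

lemma iterate_pd1_fst_mul (hf : AnalyticOnNhd ℝ f W) (k : ℕ) :
    Set.EqOn (pd1^[k] fun p : ℝ × ℝ => (p.1 : ℂ) * f p)
      (fun p => (p.1 : ℂ) * pd1^[k] f p + k * pd1^[k - 1] f p) W := by
  induction k with
  | zero => intro p _; simp
  | succ k ih =>
    intro p hp
    have ha : ∀ k, AnalyticOnNhd ℝ (pd1^[k] f) W := analytic_iterate analytic_pd1 hf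
    rw [Function.iterate_succ_apply', eqOn_pd1 ih hp]
    have d1 := (analytic_fst_mul (ha k) p hp).differentiableAt
    have d2 := (ha (k - 1) p hp).differentiableAt
    have d3 : DifferentiableAt ℝ (fun q => (k : ℂ) * pd1^[k - 1] f q) p := d2.const_mul _
    rw [pd1, fderiv_fun_add d1 d3, add_apply, fderiv_fst_mul (ha k) hp,
      fderiv_const_mul d2]
    rw [Function.iterate_succ_apply']
    change _ = (p.1 : ℂ) * fderiv ℝ (pd1^[k] f) p (1, 0) + _
    rcases k with _ | k
    · simp
    · simp only [Nat.add_sub_cancel, smul_apply, smul_eq_mul]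
      rw [Function.iterate_succ_apply' pd1 k f]
      simp only [pd1]
      push_cast
      ring

/-- By the Leibniz rule the `k`-th derivative of s·g is s·g^(k) + k·g^(k-1). Summed with powers of
the soul, the first term gives the body of `A` times the Taylor sum of g and the second gives the
soul of `A` times it. -/
lemma superEval_eulerOp (hf : AnalyticOnNhd ℝ f W) {A B : Grassmann}
    (hA : ((body A).re : ℂ) = body A) (hp : ((body A).re, (body B).re) ∈ W) :
    superEval (eulerOp f) A B = A * superEval (pd1 f) A B := by
  set p := ((body A).re, (body B).re) with hpd
  rw [superEval_eq_taylor (analytic_eulerOp hf) hp, superEval_eq_taylor (analytic_pd1 hf) hp]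
  set g := pd1 f with hg
  have hga : AnalyticOnNhd ℝ g W := analytic_pd1 hf
  have h1 : ∀ k l, jetOf (eulerOp f) k l p = p.1 * jetOf g k l p + k * jetOf g (k - 1) l p := by
    intro k l
    rw [eqOn_jetOf (eulerOp_eq hf) k l hp, jetOf,
      eqOn_iterate eqOn_pd1 (iterate_pd2_fst_mul hga l) k hp,
      iterate_pd1_fst_mul (analytic_iterate analytic_pd2 hga l) k hp]
    rfl
  have hAs : A = algebraMap ℂ Grassmann (p.1 : ℂ) + soul A := by
    rw [hpd, hA]; simp [soul]
  have h2 : ∀ (φ : ℕ → ℂ) (c : ℂ) (t : Grassmann), ∑ k ∈ Finset.range 17,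
      (((p.1 : ℂ) * φ k + k * φ (k - 1)) / ((k.factorial : ℂ) * c)) • (soul A ^ k * t) =
      A * ∑ k ∈ Finset.range 17, (φ k / ((k.factorial : ℂ) * c)) • (soul A ^ k * t) := by
    intro φ c t
    have h3 : ∑ k ∈ Finset.range 17,
        ((k * φ (k - 1)) / ((k.factorial : ℂ) * c)) • (soul A ^ k * t) =
        soul A * ∑ k ∈ Finset.range 17, (φ k / ((k.factorial : ℂ) * c)) • (soul A ^ k * t) := by
      rw [Finset.sum_range_succ', Finset.sum_range_succ (n := 16), mul_add, mul_smul_comm,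
        ← mul_assoc (soul A) (soul A ^ 16), ← pow_succ', soul_pow_seventeen]
      simp only [Nat.cast_zero, zero_mul, zero_div, zero_smul, smul_zero, add_zero,
        Finset.mul_sum, mul_smul_comm, ← mul_assoc, ← pow_succ', Nat.add_sub_cancel]
      refine Finset.sum_congr rfl fun k _ => ?_
      congr 1
      rw [Nat.factorial_succ]
      push_cast
      have h1 : (k : ℂ) + 1 ≠ 0 := Nat.cast_add_one_ne_zero k
      rw [mul_assoc, mul_div_mul_left _ _ h1]
    have h4 : ∀ z, A * z = algebraMap ℂ Grassmann (p.1 : ℂ) * z + soul A * z := fun z => by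
      rw [← add_mul, ← hAs]
    rw [h4, ← h3, ← Algebra.smul_def, Finset.smul_sum, ← Finset.sum_add_distrib]
    refine Finset.sum_congr rfl fun k _ => ?_
    rw [smul_smul, ← add_smul]
    congr 1
    ring
  simp only [taylor, ← hpd, h1]
  rw [Finset.sum_comm, Finset.sum_congr rfl fun l _ => h2 (fun k => jetOf g k l p) _ _,
    ← Finset.mul_sum, Finset.sum_comm]

lemma evenFun_superEval (hf : AnalyticOnNhd ℝ f W) {A B : SuperFun} (hA : RealFun A)
    (hB : RealFun B) (hp : ∀ x ∈ spacelike, ((body (A x)).re, (body (B x)).re) ∈ W) :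
    EvenFun fun x => superEval f (A x) (B x) := by
  have h := evenFun_taylor (isJet_jetOf hf) hA hB hp
  refine ⟨fun x hx => (h.analytic x hx).congr ?_, fun x hx => ?_⟩
  · filter_upwards [isOpen_spacelike.mem_nhds hx] with y hy
    rw [superEval_eq_taylor hf (hp y hy)]
  · rw [superEval_eq_taylor hf (hp x hx)]
    exact h.even x hx

lemma body_superEval (f : ℝ × ℝ → ℂ) (A B : Grassmann) :
    body (superEval f A B) = f ((body A).re, (body B).re) := by
  rw [superEval, map_sum, Finset.sum_range_succ', Finset.sum_eq_zero, map_sum,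
    Finset.sum_range_succ', Finset.sum_eq_zero]
  · simp
  · intro k _; simp [body_soul]
  · intro k _; simp [body_soul]

section
variable {a : OddIndex → Grassmann} {b : Fin 4 → Fin 4 → Grassmann} {x : Configuration}

lemma tangent_superEval (hf : AnalyticOnNhd ℝ f W) {A B : SuperFun} (hA : RealFun A)
    (hB : RealFun B) (hp : ∀ x ∈ spacelike, ((body (A x)).re, (body (B x)).re) ∈ W)
    (hx : x ∈ spacelike) :
    tangent a b (fun y => superEval f (A y) (B y)) x =
      superEval (pd1 f) (A x) (B x) * tangent a b A x +
        superEval (pd2 f) (A x) (B x) * tangent a b B x := by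
  rw [tangent_congr hx fun y hy => superEval_eq_taylor hf (hp y hy),
    tangent_taylor (isJet_jetOf hf) hA hB hx (hp x hx),
    superEval_eq_taylor (analytic_pd1 hf) (hp x hx),
    superEval_eq_taylor (analytic_pd2 hf) (hp x hx)]
  have h : taylor (fun k l => jetOf f (k + 1) l) (A x) (B x) =
      taylor (jetOf (pd1 f)) (A x) (B x) :=
    taylor_congr fun k l => (jetOf_pd1 hf k l (hp x hx)).symm
  rw [h]
  rfl

/-- The sum is the expansion of f(e^τ A, B), and the hypotheses say that e^τ A and B are
annihilated. In the series this is a telescoping: differentiating the function raises the order of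
the Euler operator and gives `l`, differentiating the power of `τ` lowers its exponent and gives
`-l`. -/
lemma tangent_exp_euler (hf : AnalyticOnNhd ℝ f W) {A B τ : SuperFun} (hA : RealFun A)
    (hB : RealFun B) (hp : ∀ x ∈ spacelike, ((body (A x)).re, (body (B x)).re) ∈ W)
    (hτ : EvenFun τ) (hx : x ∈ spacelike) (hτ0 : body (τ x) = 0) {l : Grassmann}
    (h1 : HasLog a b x A l) (h2 : tangent a b B x = 0) (h3 : tangent a b τ x = -l) :
    tangent a b (fun y => ∑ k ∈ Finset.range 17,
      ((k.factorial : ℂ)⁻¹ • τ y ^ k) * superEval (eulerOp^[k] f) (A y) (B y)) x = 0 := by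
  have hfk : ∀ k, AnalyticOnNhd ℝ (eulerOp^[k] f) W := analytic_iterate analytic_eulerOp hf
  have hE : ∀ k, EvenFun fun y => superEval (eulerOp^[k] f) (A y) (B y) := fun k =>
    evenFun_superEval (hfk k) hA hB hp
  have hP : ∀ k : ℕ, EvenFun fun y => (k.factorial : ℂ)⁻¹ • τ y ^ k := fun k => (hτ.pow k).smul _
  have hs : soul (τ x) = τ x := by rw [soul, hτ0, map_zero, sub_zero]
  have hz : τ x ^ 16 = 0 := by
    rw [← hs]; exact soul_pow_eq_zero (hτ.even x hx) (by norm_num)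
  have hterm : ∀ k : ℕ, tangent a b (fun y => ((k.factorial : ℂ)⁻¹ • τ y ^ k) *
      superEval (eulerOp^[k] f) (A y) (B y)) x =
      ((k.factorial : ℂ)⁻¹ • (τ x ^ k * superEval (eulerOp^[k + 1] f) (A x) (B x)) -
        (1 / (k.factorial : ℂ)) • ((k : ℂ) • (τ x ^ (k - 1) *
          superEval (eulerOp^[k - 1 + 1] f) (A x) (B x)))) * l := by
    intro k
    have e1 : superEval (eulerOp^[k + 1] f) (A x) (B x) =
        A x * superEval (pd1 (eulerOp^[k] f)) (A x) (B x) := by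
      rw [Function.iterate_succ_apply', superEval_eulerOp (hfk k) (hA.real x hx) (hp x hx)]
    have hEk := hE k
    rw [tangent_mul ((hP k).diff hx) (hEk.diff hx) ((hP k).even x hx),
      tangent_superEval (hfk k) hA hB hp hx, h2, mul_zero, add_zero,
      tangent_smul _ ((hτ.pow k).diff hx), tangent_pow (hτ.diff hx) (hτ.even x hx), h3, e1]
    have h1' : tangent a b A x = A x * l := h1
    rw [h1', sub_mul, smul_mul_assoc, smul_mul_assoc, smul_mul_assoc, smul_mul_assoc]
    rw [smul_mul_assoc]
    have c1 : superEval (pd1 (eulerOp^[k] f)) (A x) (B x) * (A x * l) =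
        A x * superEval (pd1 (eulerOp^[k] f)) (A x) (B x) * l := by
      rw [← mul_assoc, (even_commute (hA.even x hx) _).eq]
    have c2 : τ x ^ (k - 1) * -l * superEval (eulerOp^[k] f) (A x) (B x) =
        -(τ x ^ (k - 1) * superEval (eulerOp^[k] f) (A x) (B x) * l) := by
      rw [mul_neg, neg_mul, mul_assoc, mul_assoc, (even_commute ((hE k).even x hx) l).eq]
    rw [c1, c2, mul_assoc (τ x ^ k)]
    rcases k with _ | k
    · simp
    · simp only [Nat.add_sub_cancel]
      rw [smul_mul_assoc]
      module
  have e : (fun y => ∑ k ∈ Finset.range 17,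
      ((k.factorial : ℂ)⁻¹ • τ y ^ k) * superEval (eulerOp^[k] f) (A y) (B y)) =
    fun y => ∑ k ∈ Finset.range 17, (fun z => ((k.factorial : ℂ)⁻¹ • τ z ^ k) *
      superEval (eulerOp^[k] f) (A z) (B z)) y := rfl
  rw [e, tangent_sum _ fun k _ => ((hP k).mul (hE k)).diff hx]
  simp only [hterm]
  rw [← Finset.sum_mul, Finset.sum_sub_distrib, sum_range_shift (fun _ => 1)
    (fun k => τ x ^ k * superEval (eulerOp^[k + 1] f) (A x) (B x)) (by rw [hz, zero_mul])]
  simp only [one_div, sub_self, zero_mul]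

end

end Partial

end
end ChiralFourPoint

namespace ChiralFourPoint
noncomputable section

/-! ### Algebra of the intervals -/

lemma θ_odd (i : Fin 4) (α : Fin 2) : θ i α ∈ oddPart := vec_mem_oddPart _

lemma θbar_odd (i : Fin 4) (α : Fin 2) : θbar i α ∈ oddPart := vec_mem_oddPart _

lemma θdiff_odd (i j : Fin 4) (α : Fin 2) : θdiff i j α ∈ oddPart :=
  sub_mem (θ_odd i α) (θ_odd j α)

lemma θbarDiff_odd (i j : Fin 4) (α : Fin 2) : θbarDiff i j α ∈ oddPart :=
  sub_mem (θbar_odd i α) (θbar_odd j α)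

lemma θσθbar_even (j i μ : Fin 4) : θσθbar j i μ ∈ evenPart :=
  sum_mem fun α _ => sum_mem fun β _ =>
    Subalgebra.smul_mem _ (mul_mem_evenPart (θ_odd j α) (θbar_odd i β)) _

lemma body_θσθbar (j i μ : Fin 4) : body (θσθbar j i μ) = 0 := by
  simp [θσθbar, θ, body_vec]

lemma interval_eq (i j μ : Fin 4) (x : Configuration) :
    interval i j μ x = algebraMap ℂ Grassmann ((x i μ - x j μ : ℝ) : ℂ) +
      Complex.I • (θσθbar i i μ + θσθbar j j μ - (2 : ℂ) • θσθbar j i μ) := by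
  simp only [interval, xMinus, xPlus, Complex.ofReal_sub, map_sub]
  module

lemma interval_even (i j μ : Fin 4) (x : Configuration) : interval i j μ x ∈ evenPart := by
  rw [interval_eq]
  exact add_mem (Subalgebra.algebraMap_mem _ _) (Subalgebra.smul_mem _ (sub_mem (add_mem
    (θσθbar_even _ _ _) (θσθbar_even _ _ _)) (Subalgebra.smul_mem _ (θσθbar_even _ _ _) _)) _)

lemma body_interval (i j μ : Fin 4) (x : Configuration) :
    body (interval i j μ x) = ((x i μ - x j μ : ℝ) : ℂ) := by
  rw [interval_eq]
  simp [body_θσθbar]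

lemma interval_self (i μ : Fin 4) (x : Configuration) : interval i i μ x = 0 := by
  rw [interval_eq, sub_self, Complex.ofReal_zero, map_zero]
  module

lemma evenFun_interval (i j μ : Fin 4) : EvenFun (interval i j μ) := by
  refine ⟨fun x _ => ?_, fun x _ => interval_even i j μ x⟩
  have h : AnalyticAt ℝ (fun y : Configuration => ((y i μ - y j μ : ℝ) : ℂ)) x := by
    have hp : ∀ k : Fin 4, AnalyticAt ℝ (fun y : Configuration => y k μ) x := fun k =>
      ((ContinuousLinearMap.proj (R := ℝ) (φ := fun _ : Fin 4 => ℝ) μ).comp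
        (ContinuousLinearMap.proj (R := ℝ) (φ := fun _ : Fin 4 => Fin 4 → ℝ) k)).analyticAt x
    exact (Complex.ofRealCLM.analyticAt _).fun_comp (f := fun y : Configuration => y i μ - y j μ)
      ((hp i).sub (hp j))
  rw [funext (interval_eq i j μ)]
  exact (analyticAt_scalar h).add analyticAt_const

lemma evenFun_sq (i j : Fin 4) : EvenFun (sq i j) :=
  .sum _ fun μ _ => ((evenFun_interval i j μ).pow 2).smul _

lemma sq_even (i j : Fin 4) (x : Configuration) : sq i j x ∈ evenPart :=
  sum_mem fun μ _ => Subalgebra.smul_mem _ (pow_mem (interval_even i j μ x) 2) _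

lemma body_sq (i j : Fin 4) (x : Configuration) :
    body (sq i j x) = (((x i 0 - x j 0) ^ 2 - ((x i 1 - x j 1) ^ 2 + (x i 2 - x j 2) ^ 2 +
      (x i 3 - x j 3) ^ 2) : ℝ) : ℂ) := by
  simp [sq, Fin.sum_univ_four, metric, body_interval]
  ring

lemma body_sq_re_neg {i j : Fin 4} (h : i ≠ j) {x : Configuration} (hx : x ∈ spacelike) :
    (body (sq i j x)).re < 0 := by
  rw [body_sq, Complex.ofReal_re]
  linarith [hx i j h]

lemma unitFun_sq {i j : Fin 4} (h : i ≠ j) : UnitFun (sq i j) := by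
  refine ⟨⟨evenFun_sq i j, fun x _ => ?_⟩, fun x hx h0 => ?_⟩
  · rw [body_sq, Complex.ofReal_re]
  · have := body_sq_re_neg h hx
    rw [h0] at this
    simp at this

/-! #### Matrices of even elements -/

/-- The interval matrix with even entries. -/
def matE (i j : Fin 4) (x : Configuration) : Matrix (Fin 2) (Fin 2) evenPart :=
  Matrix.of fun α β => ∑ μ : Fin 4, sigmaLower μ α β • ⟨interval i j μ x, interval_even i j μ x⟩

/-- The square of an interval as an element of the even part. -/
def sqE (i j : Fin 4) (x : Configuration) : evenPart := ⟨sq i j x, sq_even i j x⟩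

/-- The inverse square of an interval as an element of the even part. -/
def invE (i j : Fin 4) (x : Configuration) : evenPart :=
  ⟨sinv (sq i j x), spow_even (sq_even i j x) _⟩

lemma coe_matE (i j : Fin 4) (x : Configuration) (α β : Fin 2) :
    (matE i j x α β : Grassmann) = mat i j x α β := by
  simp [matE, mat]

/-- Raising both spinor indices is passing to the adjugate. The intervals thus become ordinary 2 × 2
matrices over a commutative ring, with the Minkowski square as determinant. -/
lemma coe_adjugate_matE (i j : Fin 4) (x : Configuration) (α β : Fin 2) :
    ((matE i j x).adjugate α β : Grassmann) = matTilde i j x α β := by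
  rw [Matrix.adjugate_fin_two]
  fin_cases α <;> fin_cases β <;>
    simp [coe_matE, mat, matTilde, sigmaTildeLower, sigmaLower, pauli, metric, Fin.sum_univ_four]
  all_goals module

lemma det_matE (i j : Fin 4) (x : Configuration) : (matE i j x).det = sqE i j x := by
  have hI : algebraMap ℂ evenPart Complex.I ^ 2 = -1 := by
    rw [← map_pow, Complex.I_sq, map_neg, map_one]
  have h : sqE i j x = ∑ μ : Fin 4, metric μ •
      (⟨interval i j μ x, interval_even i j μ x⟩ : evenPart) ^ 2 := by
    apply Subtype.ext
    simp [sqE, sq]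
  rw [h, Matrix.det_fin_two]
  simp only [matE, Matrix.of_apply, Fin.sum_univ_four, sigmaLower, pauli, metric]
  simp only [Algebra.smul_def, Matrix.smul_apply, Matrix.of_apply, Matrix.cons_val',
    Matrix.cons_val_zero, Matrix.cons_val_one, Matrix.cons_val_fin_one, Matrix.cons_val, map_mul, map_neg, map_one, map_zero]
  linear_combination (⟨interval i j 2 x, interval_even i j 2 x⟩ : evenPart) ^ 2 * hI

lemma sqE_mul_invE {i j : Fin 4} (h : i ≠ j) {x : Configuration} (hx : x ∈ spacelike) :
    sqE i j x * invE i j x = 1 :=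
  Subtype.ext (mul_sinv ((unitFun_sq h).ne x hx))

/-! ### Two-by-two matrices over a commutative ring and products of odd spinors -/

section Ring
variable {R : Type*} [CommRing R]

/-- The linear map taking the matrix of products of two odd spinors to the matrix of the vector
formed from them. -/
def dyadMat (w : Matrix (Fin 2) (Fin 2) R) : Matrix (Fin 2) (Fin 2) R :=
  !![2 * w 1 1, -(2 * w 1 0); -(2 * w 0 1), 2 * w 0 0]

/-- The relations between the products of the components of two odd spinors. -/
structure IsDyad (w : Matrix (Fin 2) (Fin 2) R) : Prop where
  row : ∀ a b c, w a b * w a c = 0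
  col : ∀ a b c, w a c * w b c = 0
  cross : w 0 0 * w 1 1 = -(w 0 1 * w 1 0)

lemma dyadMat_smul (c : R) (w : Matrix (Fin 2) (Fin 2) R) : dyadMat (c • w) = c • dyadMat w := by
  ext a b; fin_cases a <;> fin_cases b <;> simp [dyadMat] <;> ring

lemma dyadMat_sub (v w : Matrix (Fin 2) (Fin 2) R) : dyadMat (v - w) = dyadMat v - dyadMat w := by
  ext a b; fin_cases a <;> fin_cases b <;> simp [dyadMat] <;> ring

/-- `dyadMat w` is twice the transposed adjugate of `w`, and taking adjugates reverses products. -/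
lemma adjugate_mul_dyadMat (m w : Matrix (Fin 2) (Fin 2) R) :
    m.adjugate * dyadMat w = dyadMat (m.transpose * w) := by
  ext a b
  fin_cases a <;> fin_cases b <;>
    simp [dyadMat, Matrix.adjugate_fin_two, Matrix.mul_apply, Fin.sum_univ_two] <;> ring

lemma dyadMat_mul_adjugate (m w : Matrix (Fin 2) (Fin 2) R) :
    dyadMat w * m.adjugate = dyadMat (w * m.transpose) := by
  ext a b
  fin_cases a <;> fin_cases b <;>
    simp [dyadMat, Matrix.adjugate_fin_two, Matrix.mul_apply, Fin.sum_univ_two] <;> ring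

/-- The contraction of a matrix with the products of two odd spinors. -/
def pair (w m : Matrix (Fin 2) (Fin 2) R) : R := ∑ a, ∑ b, w a b * m a b

/-- Only products containing all four spinor components survive. There are two kinds of them, equal
up to sign by `cross`, and their coefficients combine to the determinant. -/
lemma IsDyad.pair_sq {w : Matrix (Fin 2) (Fin 2) R} (h : IsDyad w) (m : Matrix (Fin 2) (Fin 2) R) :
    pair w m ^ 2 = 2 * (w 0 0 * w 1 1) * m.det := by
  simp only [pair, Fin.sum_univ_two, Matrix.det_fin_two]
  linear_combination m 0 0 ^ 2 * h.row 0 0 0 + 2 * m 0 0 * m 0 1 * h.row 0 0 1 +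
    m 0 1 ^ 2 * h.row 0 1 1 + m 1 0 ^ 2 * h.row 1 0 0 + 2 * m 1 0 * m 1 1 * h.row 1 0 1 +
    m 1 1 ^ 2 * h.row 1 1 1 + 2 * m 0 0 * m 1 0 * h.col 0 1 0 + 2 * m 0 1 * m 1 1 * h.col 0 1 1 +
    2 * m 0 1 * m 1 0 * h.cross

lemma IsDyad.pair_cube {w : Matrix (Fin 2) (Fin 2) R} (h : IsDyad w)
    (m : Matrix (Fin 2) (Fin 2) R) : pair w m ^ 3 = 0 := by
  have h0 : w 0 0 * w 1 1 * pair w m = 0 := by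
    simp only [pair, Fin.sum_univ_two]
    linear_combination w 1 1 * m 0 0 * h.row 0 0 0 + w 1 1 * m 0 1 * h.row 0 0 1 +
      w 0 0 * m 1 0 * h.row 1 0 1 + w 0 0 * m 1 1 * h.row 1 1 1
  rw [pow_succ, h.pair_sq]
  linear_combination 2 * m.det * h0

lemma IsDyad.det_sub {w : Matrix (Fin 2) (Fin 2) R} (h : IsDyad w) (m : Matrix (Fin 2) (Fin 2) R)
    {i : R} (hi : i ^ 2 = -1) :
    (m - (2 * i) • dyadMat w).det = m.det - 4 * i * pair w m - 32 * (w 0 0 * w 1 1) := by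
  simp only [pair, Fin.sum_univ_two, Matrix.det_fin_two, dyadMat, Matrix.sub_apply,
    Matrix.smul_apply, Matrix.of_apply, Matrix.cons_val', Matrix.cons_val_zero,
    Matrix.cons_val_one, Matrix.cons_val_fin_one, smul_eq_mul]
  linear_combination (16 * (w 0 0 * w 1 1) - 16 * (w 0 1 * w 1 0)) * hi + 16 * h.cross

/-- The quartic term of the determinant is, by `pair_sq`, a multiple of the square of the quadratic
one. The ratio of determinants is therefore a polynomial in a single nilpotent element, which makes
it possible to take logarithms. -/
lemma IsDyad.det_sub_mul {w : Matrix (Fin 2) (Fin 2) R} (h : IsDyad w)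
    (m : Matrix (Fin 2) (Fin 2) R) {i d : R} (hi : i ^ 2 = -1) (hd : m.det * d = 1) :
    (m - (2 * i) • dyadMat w).det * d =
      1 - 4 * i * (pair w m * d) - 16 * (pair w m * d) ^ 2 := by
  rw [h.det_sub m hi]
  linear_combination (1 + 32 * (w 0 0 * w 1 1) * d) * hd + (16 * d ^ 2) * h.pair_sq m

lemma det_sub_fin_two (P Q : Matrix (Fin 2) (Fin 2) R) :
    (P - Q).det = P.det + Q.det - (P.adjugate * Q).trace := by
  simp only [Matrix.det_fin_two, Matrix.adjugate_fin_two, Matrix.trace, Matrix.diag,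
    Matrix.mul_apply, Fin.sum_univ_two, Matrix.sub_apply, Matrix.of_apply, Matrix.cons_val',
    Matrix.cons_val_zero, Matrix.cons_val_one, Matrix.cons_val_fin_one]
  ring

/-- Inversion of three intervals in a fourth point. -/
lemma inverted_interval {m p q w : Matrix (Fin 2) (Fin 2) R} {i dp dq : R}
    (hm : m = p + q - (2 * i) • dyadMat w) (hp : p.det * dp = 1) (hq : q.det * dq = 1) :
    (dp * dq) • (p.adjugate * m * q.adjugate) = dp • p.adjugate + dq • q.adjugate -
      (2 * i) • dyadMat ((dp * dq) • (p.transpose * w * q.transpose)) := by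
  have h1 : (dp * dq) • p.det • q.adjugate = dq • q.adjugate := by
    rw [smul_smul]; congr 1; linear_combination dq * hp
  have h2 : (dp * dq) • q.det • p.adjugate = dp • p.adjugate := by
    rw [smul_smul]; congr 1; linear_combination dp * hq
  rw [hm, mul_sub, mul_add, sub_mul, add_mul, Matrix.adjugate_mul, mul_assoc p.adjugate q,
    Matrix.mul_adjugate, Matrix.mul_smul p.adjugate, Matrix.mul_smul p.adjugate,
    adjugate_mul_dyadMat, Matrix.smul_mul, Matrix.smul_mul, dyadMat_mul_adjugate, dyadMat_smul,
    one_mul, mul_one, smul_sub, smul_add, h1, h2, smul_comm (dp * dq) (2 * i)]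
  abel

/-- Inversion sends point 1 to infinity, where intervals combine additively up to spinor products.
The matrix P - Q compares points 3 and 4 as seen from 2; multiplied by the inverse of `m21` it is
the inverted interval `A` of 4 and 3 minus a spinor term `w`. Its determinant is computed twice: by
polarisation it gives the bracket in the conclusion, and by `det_sub_mul` it is det A times 1 + 4iC
- 16C². As C³ = 0, the last factor is the inverse of 1 - 4iC. -/
lemma inverted_frame {m13 m14 m23 m24 m21 m43 m41 us vs ut vt : Matrix (Fin 2) (Fin 2) R}
    {i d13 d14 d21 d43 d41 : R} (hi : i ^ 2 = -1)
    (h23 : m23 = m13 + m21 - (2 * i) • dyadMat us) (h24 : m24 = m14 + m21 - (2 * i) • dyadMat vs)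
    (h43 : m43 = m13 + m41 - (2 * i) • dyadMat ut) (h44 : 0 = m14 + m41 - (2 * i) • dyadMat vt)
    (e13 : m13.det * d13 = 1) (e14 : m14.det * d14 = 1) (e21 : m21.det * d21 = 1)
    (e43 : m43.det * d43 = 1) (e41 : m41.det * d41 = 1)
    {w A : Matrix (Fin 2) (Fin 2) R} (hA : A = (d13 * d41) • (m13.adjugate * m43 * m41.adjugate))
    (hw : w = (d13 * d21) • (m13.transpose * us * m21.transpose) -
      (d14 * d21) • (m14.transpose * vs * m21.transpose) -
      ((d13 * d41) • (m13.transpose * ut * m41.transpose) -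
      (d14 * d41) • (m14.transpose * vt * m41.transpose))) (hd : IsDyad w) {C : R}
    (hC : C = -(pair w A * (m13.det * m41.det * d43))) :
    (m13.det * m24.det + m14.det * m23.det -
      (m23.adjugate * m13 * (m14.adjugate * m24)).trace) * m41.det * (1 - 4 * i * C) =
    m14.det * m43.det * m21.det ∧ C ^ 3 = 0 := by
  set K := m13.det * m24.det + m14.det * m23.det -
      (m23.adjugate * m13 * (m14.adjugate * m24)).trace with hK
  set P := d13 • (m13.adjugate * m23) with hP
  set Q := d14 • (m14.adjugate * m24) with hQ
  have i23 := inverted_interval h23 e13 e21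
  have i24 := inverted_interval h24 e14 e21
  have i43 := inverted_interval h43 e13 e41
  have i44 := inverted_interval h44 e14 e41
  have hW : d21 • ((P - Q) * m21.adjugate) = A - (2 * i) • dyadMat w := by
    have e : d21 • ((P - Q) * m21.adjugate) =
        (d13 * d21) • (m13.adjugate * m23 * m21.adjugate) -
        (d14 * d21) • (m14.adjugate * m24 * m21.adjugate) := by
      rw [hP, hQ, sub_mul, smul_sub, Matrix.smul_mul, Matrix.smul_mul, smul_smul, smul_smul,
        mul_comm d21, mul_comm d21]
    -- The vanishing interval of point 4 with itself, inverted, is subtracted. By `h44` it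
    -- contributes the fourth spinor product, without which the products would not assemble to `w`.
    have e0 : A = A - (d14 * d41) • (m14.adjugate * 0 * m41.adjugate) := by simp
    rw [e, e0, i23, i24, i44, hA, i43, hw, dyadMat_sub, dyadMat_sub, dyadMat_sub]
    simp only [smul_sub]
    abel
  have dA : A.det * (m13.det * m41.det * d43) = 1 := by
    rw [hA, Matrix.det_smul, Matrix.det_mul, Matrix.det_mul, Matrix.det_adjugate,
      Matrix.det_adjugate, Fintype.card_fin, pow_one, pow_one]
    have h1 := e13; have h2 := e41; have h3 := e43
    calc _ = (m13.det * d13) ^ 2 * (m41.det * d41) ^ 2 * (m43.det * d43) := by ring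
      _ = 1 := by rw [e13, e41, e43]; ring
  have hdet := hd.det_sub_mul A hi dA
  have hC3 : C ^ 3 = 0 := by
    rw [hC, Odd.neg_pow (by decide), mul_pow, hd.pair_cube, zero_mul, neg_zero]
  refine ⟨?_, hC3⟩
  have hpC : pair w A * (m13.det * m41.det * d43) = -C := by rw [hC, neg_neg]
  rw [hpC, ← hW, Matrix.det_smul, Matrix.det_mul, Matrix.det_adjugate, Fintype.card_fin,
    pow_one, det_sub_fin_two] at hdet
  have hPd : P.det = d13 * m23.det := by
    rw [hP, Matrix.det_smul, Matrix.det_mul, Matrix.det_adjugate, Fintype.card_fin, pow_one]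
    linear_combination d13 * m23.det * e13
  have hQd : Q.det = d14 * m24.det := by
    rw [hQ, Matrix.det_smul, Matrix.det_mul, Matrix.det_adjugate, Fintype.card_fin, pow_one]
    linear_combination d14 * m24.det * e14
  have hPa : P.adjugate = d13 • (m23.adjugate * m13) := by
    rw [hP, Matrix.adjugate_smul, Matrix.adjugate_mul_distrib, Matrix.adjugate_adjugate _ (by simp)]
    simp
  have hKd : P.det + Q.det - (P.adjugate * Q).trace = d13 * d14 * K := by
    rw [hPd, hQd, hPa, hQ, Matrix.smul_mul, Matrix.mul_smul, smul_smul, Matrix.trace_smul, hK,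
      smul_eq_mul]
    linear_combination (-d14 * m24.det) * e13 + (-d13 * m23.det) * e14
  rw [hKd] at hdet
  -- The geometric series for 1 / (1 - 4iC), which ends at the square because C³ = 0.
  have h1 : d21 ^ 2 * (d13 * d14 * K * m21.det) * (m13.det * m41.det * d43) * (1 - 4 * i * C) = 1 := by
    rw [hdet]
    linear_combination (64 * i) * hC3 + (-16 * C ^ 2) * hi
  have h2 : d21 ^ 2 * (d13 * d14 * K * m21.det) * (m13.det * m41.det * d43) * (1 - 4 * i * C) *
      (m14.det * m43.det * m21.det) = (m13.det * d13) * (m14.det * d14) * (m21.det * d21) ^ 2 *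
      (m43.det * d43) * (K * m41.det * (1 - 4 * i * C)) := by ring
  rw [h1, e13, e14, e21, e43] at h2
  linear_combination -h2

end Ring

end
end ChiralFourPoint

/-! ### Odd spinors, relations between the intervals, and `T` as a logarithm -/

namespace ChiralFourPoint
noncomputable section

/-- The matrix of products of the components of two odd spinors. -/
def oddProd (u v : Fin 2 → oddPart) : Matrix (Fin 2) (Fin 2) evenPart :=
  Matrix.of fun a b => ⟨u a * v b, mul_mem_evenPart (u a).2 (v b).2⟩

lemma coe_oddProd (u v : Fin 2 → oddPart) (a b : Fin 2) :
    (oddProd u v a b : Grassmann) = u a * v b := rfl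

lemma odd_mul_mul_swap (a : Grassmann) {b c : Grassmann} (hb : b ∈ oddPart) (hc : c ∈ oddPart)
    (d : Grassmann) : a * b * (c * d) = -(a * c * (b * d)) := by
  rw [mul_assoc, ← mul_assoc b, odd_mul_odd hb hc, neg_mul, mul_neg, mul_assoc c, ← mul_assoc a]

lemma isDyad_oddProd (u v : Fin 2 → oddPart) : IsDyad (oddProd u v) where
  row a b c := Subtype.ext <| by
    change (u a : Grassmann) * v b * (u a * v c) = 0
    rw [odd_mul_mul_swap _ (v b).2 (u a).2, odd_mul_self (u a).2, zero_mul, neg_zero]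
  col a b c := Subtype.ext <| by
    change (u a : Grassmann) * v c * (u b * v c) = 0
    rw [odd_mul_mul_swap _ (v c).2 (u b).2, odd_mul_self (v c).2, mul_zero, neg_zero]
  cross := Subtype.ext <| by
    change (u 0 : Grassmann) * v 0 * (u 1 * v 1) = -((u 0 : Grassmann) * v 1 * (u 1 * v 0))
    rw [odd_mul_mul_swap _ (v 0).2 (u 1).2, odd_mul_mul_swap _ (v 1).2 (u 1).2,
      odd_mul_odd (v 1).2 (v 0).2, mul_neg, neg_neg]

/-- `θ_{ij}` as an odd spinor. -/
def θO (i j : Fin 4) : Fin 2 → oddPart := fun α => ⟨θdiff i j α, θdiff_odd i j α⟩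

/-- `θ̄_{ij}` as an odd spinor. -/
def θbarO (i j : Fin 4) : Fin 2 → oddPart := fun α => ⟨θbarDiff i j α, θbarDiff_odd i j α⟩

/-- The imaginary unit in the even part. -/
def iE : evenPart := algebraMap ℂ evenPart Complex.I

lemma iE_sq : iE ^ 2 = -1 := by
  rw [iE, ← map_pow, Complex.I_sq, map_neg, map_one]

/-- The matrix of the vector `θ_j σ^μ θ̄_i`. -/
def θMat (j i : Fin 4) : Matrix (Fin 2) (Fin 2) Grassmann :=
  !![(2 : ℂ) • (θ j 1 * θbar i 1), -((2 : ℂ) • (θ j 1 * θbar i 0));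
    -((2 : ℂ) • (θ j 0 * θbar i 1)), (2 : ℂ) • (θ j 0 * θbar i 0)]

lemma sum_sigmaLower_θσθbar (j i : Fin 4) (a b : Fin 2) :
    ∑ μ, sigmaLower μ a b • θσθbar j i μ = θMat j i a b := by
  fin_cases a <;> fin_cases b <;>
    simp [θσθbar, sigmaLower, pauli, metric, Fin.sum_univ_four, θMat, smul_smul, smul_add] <;>
    module

lemma sum_sigmaTildeLower_θσθbar (j i : Fin 4) (a b : Fin 2) :
    ∑ μ, sigmaTildeLower μ a b • θσθbar j i μ = (2 : ℂ) • (θ j b * θbar i a) := by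
  fin_cases a <;> fin_cases b <;>
    simp [θσθbar, sigmaTildeLower, pauli, Fin.sum_univ_four, smul_smul, smul_add] <;>
    module

/-- The matrix of the coordinates of a point. -/
def xMat (i : Fin 4) (x : Configuration) (a b : Fin 2) : ℂ := ∑ μ, sigmaLower μ a b * (x i μ : ℂ)

lemma mat_eq (i j : Fin 4) (x : Configuration) (a b : Fin 2) :
    mat i j x a b = algebraMap ℂ Grassmann (xMat i x a b - xMat j x a b) +
      Complex.I • (θMat i i a b + θMat j j a b - (2 : ℂ) • θMat j i a b) := by
  simp only [← sum_sigmaLower_θσθbar, mat, Matrix.of_apply, interval_eq, smul_add, smul_sub,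
    Finset.sum_add_distrib, Finset.sum_sub_distrib, Finset.smul_sum, xMat, map_sub, map_sum]
  simp only [smul_comm (sigmaLower _ a b), Complex.ofReal_sub, map_sub, smul_sub,
    Finset.sum_sub_distrib, map_mul, ← Algebra.smul_def]

lemma coe_smul_evenPart (c : ℂ) (z : evenPart) :
    ((algebraMap ℂ evenPart c * z : evenPart) : Grassmann) = c • (z : Grassmann) := by
  rw [Algebra.smul_def]; rfl

lemma coe_eight_iE_mul (z : evenPart) :
    ((8 * iE * z : evenPart) : Grassmann) = (8 * Complex.I) • (z : Grassmann) := by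
  have h8 : (8 : evenPart) = algebraMap ℂ evenPart 8 := (map_ofNat (algebraMap ℂ evenPart) 8).symm
  rw [iE, h8, ← map_mul, coe_smul_evenPart]

lemma coe_two_iE_mul (z : evenPart) :
    ((2 * iE * z : evenPart) : Grassmann) = (2 * Complex.I) • (z : Grassmann) := by
  have h8 : (2 : evenPart) = algebraMap ℂ evenPart 2 := (map_ofNat (algebraMap ℂ evenPart) 2).symm
  rw [iE, h8, ← map_mul, coe_smul_evenPart]

lemma coe_four_iE_mul (z : evenPart) :
    ((4 * iE * z : evenPart) : Grassmann) = (4 * Complex.I) • (z : Grassmann) := by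
  have h8 : (4 : evenPart) = algebraMap ℂ evenPart 4 := (map_ofNat (algebraMap ℂ evenPart) 4).symm
  rw [iE, h8, ← map_mul, coe_smul_evenPart]

lemma coe_two_mul (z : evenPart) : ((2 * z : evenPart) : Grassmann) = (2 : ℂ) • (z : Grassmann) := by
  have h2 : (2 : evenPart) = algebraMap ℂ evenPart 2 := (map_ofNat (algebraMap ℂ evenPart) 2).symm
  rw [h2, coe_smul_evenPart]

/-- Intervals add up along a detour through a third point except for the odd terms θ_j θ̄_i - θ_j
θ̄_a - θ_a θ̄_i + θ_a θ̄_a. These factorise as θ_{ja} θ̄_{ia}, so the correction is a single product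
of odd spinors. -/
lemma matE_triangle (i j a : Fin 4) (x : Configuration) :
    matE i j x = matE a j x + matE i a x -
      (2 * iE) • dyadMat (oddProd (θO j a) (θbarO i a)) := by
  refine Matrix.ext fun α β => Subtype.ext ?_
  rw [Matrix.sub_apply, Matrix.add_apply, Matrix.smul_apply, smul_eq_mul, AddSubgroupClass.coe_sub,
    Subalgebra.coe_add, coe_two_iE_mul, coe_matE, coe_matE, coe_matE, mat_eq, mat_eq, mat_eq]
  fin_cases α <;> fin_cases β <;>
  · simp only [Fin.zero_eta, Fin.mk_one, dyadMat, Matrix.of_apply, Matrix.cons_val',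
      Matrix.cons_val_zero, Matrix.cons_val_one, Matrix.cons_val_fin_one, Subalgebra.coe_neg,
      coe_two_mul, coe_oddProd, θO, θbarO, θdiff, θbarDiff, θMat, mul_sub, sub_mul, map_sub]
    module

lemma matE_self (i : Fin 4) (x : Configuration) : matE i i x = 0 := by
  ext α β
  simp [coe_matE, mat, interval_self]

lemma matE_swap (i j : Fin 4) (x : Configuration) :
    matE j i x = -(matE i j x - (2 * iE) • dyadMat (oddProd (θO i j) (θbarO i j))) := by
  have h := matE_triangle i i j x
  rw [matE_self] at h
  rw [eq_neg_iff_add_eq_zero, ← add_sub_assoc]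
  exact h.symm

/-- `ρ_{ij}` as an element of the even part. -/
def rhoE (i j : Fin 4) (x : Configuration) : evenPart :=
  pair (oddProd (θO i j) (θbarO i j)) (matE i j x) * invE i j x

lemma coe_rhoE (i j : Fin 4) (x : Configuration) : (rhoE i j x : Grassmann) = rho i j x := by
  simp only [rhoE, rho, contract, pair, Subalgebra.coe_mul, AddSubmonoidClass.coe_finsetSum,
    coe_oddProd, coe_matE, matTildeInv, Matrix.smul_apply, smul_eq_mul, Finset.sum_mul]
  refine Finset.sum_congr rfl fun a _ => Finset.sum_congr rfl fun b _ => ?_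
  have h1 := even_commute (invE i j x).2
  have h2 := even_commute (mul_mem (invE i j x).2 (matE i j x a b).2) (θbarDiff i j b)
  rw [coe_matE] at h2
  change θdiff i j a * θbarDiff i j b * mat i j x a b * invE i j x =
    θdiff i j a * (invE i j x * mat i j x a b) * θbarDiff i j b
  rw [mul_assoc _ (mat i j x a b), ← (h1 _).eq, mul_assoc, ← h2.eq, mul_assoc]
  simp only [mul_assoc]

/-- The polynomial `2 (a - 1) - (a - 1) ^ 2`, twice the logarithm of `a` if `(a - 1) ^ 3 = 0`. -/
def twoLog (a : Grassmann) : Grassmann := (4 : ℂ) • a - a ^ 2 - algebraMap ℂ Grassmann 3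

/-- The ratio `x_{j̄i}² / x_{īj}²`. -/
def ratio (i j : Fin 4) : SuperFun := fun x => sq j i x * sinv (sq i j x)

lemma sqE_mul_invE_swap {i j : Fin 4} (h : i ≠ j) {x : Configuration} (hx : x ∈ spacelike) :
    sqE j i x * invE i j x = 1 - 4 * iE * rhoE i j x - 16 * rhoE i j x ^ 2 := by
  have hd : (matE i j x).det * invE i j x = 1 := by rw [det_matE, sqE_mul_invE h hx]
  have := (isDyad_oddProd (θO i j) (θbarO i j)).det_sub_mul (matE i j x) iE_sq hd
  rw [← det_matE, matE_swap i j, Matrix.det_neg, Fintype.card_fin, neg_one_sq, one_mul, this, rhoE]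

lemma rhoE_cube (i j : Fin 4) (x : Configuration) : rhoE i j x ^ 3 = 0 := by
  rw [rhoE, mul_pow, (isDyad_oddProd _ _).pair_cube, zero_mul]

lemma twoLog_coe (z : evenPart) : twoLog z = ((4 * z - z ^ 2 - 3 : evenPart) : Grassmann) := by
  have h4 : (4 : evenPart) = algebraMap ℂ evenPart 4 := (map_ofNat (algebraMap ℂ evenPart) 4).symm
  have h3 : (3 : evenPart) = algebraMap ℂ evenPart 3 := (map_ofNat (algebraMap ℂ evenPart) 3).symm
  rw [twoLog, h3, h4, AddSubgroupClass.coe_sub, AddSubgroupClass.coe_sub, coe_smul_evenPart]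
  rfl

/-- Exchanging the two ends shifts the interval matrix by one spinor product, so the ratio is 1 -
4iρ - 16ρ² with ρ³ = 0. Its logarithm explains the combination ρ - 2iρ² from which `T222` and
`TSigma` are formed. -/
lemma twoLog_ratio {i j : Fin 4} (h : i ≠ j) {x : Configuration} (hx : x ∈ spacelike) :
    twoLog (ratio i j x) = -((8 * Complex.I) • (rho i j x - (2 * Complex.I) • rho i j x ^ 2)) ∧
      (ratio i j x - 1) ^ 3 = 0 := by
  have e : ratio i j x = ((sqE j i x * invE i j x : evenPart) : Grassmann) := rfl
  have e2 := sqE_mul_invE_swap h hx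
  have e3 := rhoE_cube i j x
  set z := rhoE i j x with hz
  constructor
  · rw [e, twoLog_coe, e2, ← coe_rhoE, ← hz]
    have : (4 * (1 - 4 * iE * z - 16 * z ^ 2) - (1 - 4 * iE * z - 16 * z ^ 2) ^ 2 - 3 : evenPart) =
        -(8 * iE * (z - 2 * iE * z ^ 2)) := by
      linear_combination (-128 * iE - 256 * z) * e3 + (-32 * z ^ 2) * iE_sq
    rw [this, Subalgebra.coe_neg, coe_eight_iE_mul, AddSubgroupClass.coe_sub, coe_two_iE_mul]
    rfl
  · rw [e, e2]
    have : ((1 - 4 * iE * z - 16 * z ^ 2 - 1) ^ 3 : evenPart) = 0 := by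
      linear_combination (-(4 * iE + 16 * z) ^ 3) * e3
    exact congrArg Subtype.val this

/-! #### The chiral counterpart of `x₁₂² x₃₄²` -/

/-- The superfunction `x_{1̄3}² x_{2̄4}² + x_{1̄4}² x_{2̄3}² - tr (𝐱̃_{2̄3} 𝐱_{1̄3} 𝐱̃_{1̄4} 𝐱_{2̄4})`. -/
def chiralProd : SuperFun := fun x => sq 0 2 x * sq 1 3 x + sq 0 3 x * sq 1 2 x -
  (matTilde 1 2 x * mat 0 2 x * (matTilde 0 3 x * mat 1 3 x)).trace

/-- The nilpotent invariant `C` in `T₂₁₂ = C + 2 i C²`. -/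
def nilC : SuperFun := fun x => I₆ x * spow (J x) (1 / 2) * nilInv 1 0 1 x

/-! ### Square roots, and the invariant `C` as a rational expression in the intervals -/

lemma body_re_mul {a b : Grassmann} (ha : ((body a).re : ℂ) = body a)
    (hb : ((body b).re : ℂ) = body b) : (body (a * b)).re = (body a).re * (body b).re := by
  rw [map_mul, ← ha, ← hb, ← Complex.ofReal_mul, Complex.ofReal_re, Complex.ofReal_re,
    Complex.ofReal_re]

lemma body_re_sinv {a : Grassmann} (ha : ((body a).re : ℂ) = body a) :
    (body (sinv a)).re = (body a).re⁻¹ := by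
  rw [body_sinv, ← ha, ← Complex.ofReal_inv, Complex.ofReal_re, Complex.ofReal_re]

lemma body_sqrt {a : Grassmann} (ha : ((body a).re : ℂ) = body a) (h : 0 < (body a).re) :
    body (spow a (1 / 2)) = (Real.sqrt (body a).re : ℂ) := by
  rw [body_spow, ← ha, Complex.ofReal_re, ← Complex.ofReal_cpow h.le, Real.sqrt_eq_rpow]

lemma sqrt_mul_sqrt {a : Grassmann} (ha : body a ≠ 0) : spow a (1 / 2) * spow a (1 / 2) = a := by
  rw [← spow_add ha]
  norm_num [spow_one]

/-- Up to sign the quotient of roots is 1/M. The sign is negative since both roots have positive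
bodies while M has a negative one. -/
lemma sqrt_div_sqrt {P M : Grassmann} (hP : P ∈ evenPart) (hM : M ∈ evenPart)
    (rP : ((body P).re : ℂ) = body P) (rM : ((body M).re : ℂ) = body M) (nP : (body P).re < 0)
    (nM : (body M).re < 0) :
    spow (P * sinv M) (1 / 2) * sinv (spow (P * M) (1 / 2)) = -sinv M := by
  have zM : body M ≠ 0 := fun h => by rw [h] at nM; simp at nM
  have rS : ((body (sinv M)).re : ℂ) = body (sinv M) := by
    rw [body_sinv, ← rM, ← Complex.ofReal_inv, Complex.ofReal_re]
  have b1 : ((body (P * sinv M)).re : ℂ) = body (P * sinv M) := by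
    rw [body_re_mul rP rS, Complex.ofReal_mul, rP, rS, map_mul]
  have b2 : ((body (P * M)).re : ℂ) = body (P * M) := by
    rw [body_re_mul rP rM, Complex.ofReal_mul, rP, rM, map_mul]
  have p1 : 0 < (body (P * sinv M)).re := by
    rw [body_re_mul rP rS, body_re_sinv rM]
    exact mul_pos_of_neg_of_neg nP (inv_lt_zero.2 nM)
  have p2 : 0 < (body (P * M)).re := by
    rw [body_re_mul rP rM]
    exact mul_pos_of_neg_of_neg nP nM
  have z1 : body (P * sinv M) ≠ 0 := fun h => by rw [h] at p1; simp at p1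
  have z2 : body (P * M) ≠ 0 := fun h => by rw [h] at p2; simp at p2
  have sMe : sinv M ∈ evenPart := spow_even hM _
  set a := spow (P * sinv M) (1 / 2) with ha
  set q := spow (P * M) (1 / 2) with hq
  have ae : a ∈ evenPart := spow_even (mul_mem hP sMe) _
  have qe : q ∈ evenPart := spow_even (mul_mem hP hM) _
  have aa : a * a = P * sinv M := sqrt_mul_sqrt z1
  have qq : q * q = P * M := sqrt_mul_sqrt z2
  have ba : body a = (Real.sqrt (body (P * sinv M)).re : ℂ) := body_sqrt b1 p1
  have bq : body q = (Real.sqrt (body (P * M)).re : ℂ) := body_sqrt b2 p2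
  have zq : body q ≠ 0 := by
    rw [bq]
    exact_mod_cast (Real.sqrt_pos.2 p2).ne'
  -- Of the two factors of the vanishing difference of squares `(a * M) ^ 2 - q ^ 2`, this one has
  -- negative body and is invertible, so the other factor is zero.
  have hu : IsUnit (a * M - q) := by
    apply isUnit_of_body_ne_zero
    rw [map_sub, map_mul, ba, bq, ← rM, ← Complex.ofReal_mul, ← Complex.ofReal_sub]
    have h1 := mul_neg_of_pos_of_neg (Real.sqrt_pos.2 p1) nM
    have h2 := Real.sqrt_pos.2 p2
    exact_mod_cast (by linarith : _ < (0 : ℝ)).ne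
  have hprod : (a * M - q) * (a * M + q) = 0 := by
    have e1 : a * M * (a * M) = P * M := by
      rw [mul_assoc, ← mul_assoc M, ← (even_commute ae M).eq, mul_assoc, ← mul_assoc a, aa, mul_assoc,
        ← mul_assoc (sinv M), sinv_mul zM, one_mul]
    have e2 : a * M * q = q * (a * M) := ((even_commute qe _).eq).symm
    rw [sub_mul, mul_add, mul_add, e1, e2, qq]
    abel
  have h0 : a * M + q = 0 := (hu.mul_right_eq_zero).1 hprod
  have h1 : a = -(q * sinv M) := by
    have : a * M * sinv M = -q * sinv M := by rw [eq_neg_of_add_eq_zero_left h0]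
    rwa [mul_assoc, mul_sinv zM, mul_one, neg_mul] at this
  rw [h1, neg_mul, mul_assoc, (even_commute sMe _).eq, ← mul_assoc, mul_sinv zq, one_mul]

lemma unitFun_XPlusSq : UnitFun XPlusSq :=
  (unitFun_sq (by decide)).mul ((unitFun_sq (by decide)).mul (unitFun_sq (by decide))).sinv

lemma unitFun_XMinusSq : UnitFun XMinusSq :=
  (unitFun_sq (by decide)).mul ((unitFun_sq (by decide)).mul (unitFun_sq (by decide))).sinv

lemma unitFun_crossRatio {r s t u : Fin 4} (h1 : r ≠ s) (h2 : t ≠ u) (h3 : r ≠ u) (h4 : t ≠ s) :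
    UnitFun (crossRatio r s t u) :=
  ((unitFun_sq h1).mul (unitFun_sq h2)).mul ((unitFun_sq h3).mul (unitFun_sq h4)).sinv

lemma body_re_ratio_neg {i j k l m n : Fin 4} (h1 : i ≠ j) (h2 : k ≠ l) (h3 : m ≠ n)
    {x : Configuration} (hx : x ∈ spacelike) :
    (body (sq i j x * sinv (sq k l x * sq m n x))).re < 0 := by
  have u1 := unitFun_sq h1
  have u2 := unitFun_sq h2
  have u3 := unitFun_sq h3
  rw [body_re_mul (u1.real x hx) ((u2.mul u3).sinv.real x hx), body_re_sinv ((u2.mul u3).real x hx),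
    body_re_mul (u2.real x hx) (u3.real x hx)]
  exact mul_neg_of_neg_of_pos (body_sq_re_neg h1 hx)
    (inv_pos.2 (mul_pos_of_neg_of_neg (body_sq_re_neg h2 hx) (body_sq_re_neg h3 hx)))

/-- The odd spinor `θ_{31} 𝐱̃_{1̄3}⁻¹ - θ_{41} 𝐱̃_{1̄4}⁻¹`. -/
def oddLeft (x : Configuration) : Fin 2 → oddPart := fun β =>
  ⟨∑ α, ((invE 0 2 x * matE 0 2 x α β : evenPart) * θdiff 2 0 α -
    (invE 0 3 x * matE 0 3 x α β : evenPart) * θdiff 3 0 α),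
    sum_mem fun _ _ => sub_mem (even_mul_mem_oddPart (Subtype.property _) (θdiff_odd _ _ _))
      (even_mul_mem_oddPart (Subtype.property _) (θdiff_odd _ _ _))⟩

/-- The odd spinor `𝐱̃_{2̄1}⁻¹ θ̄_{21} - 𝐱̃_{4̄1}⁻¹ θ̄_{41}`. -/
def oddRight (x : Configuration) : Fin 2 → oddPart := fun α =>
  ⟨∑ β, ((invE 1 0 x * matE 1 0 x α β : evenPart) * θbarDiff 1 0 β -
    (invE 3 0 x * matE 3 0 x α β : evenPart) * θbarDiff 3 0 β),
    sum_mem fun _ _ => sub_mem (even_mul_mem_oddPart (Subtype.property _) (θbarDiff_odd _ _ _))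
      (even_mul_mem_oddPart (Subtype.property _) (θbarDiff_odd _ _ _))⟩

lemma ΘbarTilde_eq (x : Configuration) (β : Fin 2) :
    ΘbarTilde 1 x β = -(Complex.I • (oddLeft x β : Grassmann)) := by
  have h : ∀ j, θdiff 0 j = fun α => -θdiff j 0 α := fun j => by
    funext α; simp [θdiff]
  simp only [ΘbarTilde, midPoint, oddLeft, matTildeInv, Matrix.smul_apply, smul_eq_mul,
    Subalgebra.coe_mul, coe_matE, h]
  rw [← smul_neg, ← Finset.sum_neg_distrib]
  congr 1
  refine Finset.sum_congr rfl fun α _ => ?_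
  have e : ∀ j : Fin 4, θdiff j 0 α * (sinv (sq 0 j x) * mat 0 j x α β) =
      sinv (sq 0 j x) * mat 0 j x α β * θdiff j 0 α := fun j => by
    have := (even_commute (invE 0 j x * matE 0 j x α β).2 (θdiff j 0 α)).eq
    rw [Subalgebra.coe_mul, coe_matE] at this
    exact this.symm
  simp only [Matrix.cons_val_one, Matrix.cons_val_fin_one, neg_mul, e]
  change _ = -(sinv (sq 0 2 x) * mat 0 2 x α β * θdiff 2 0 α -
    sinv (sq 0 3 x) * mat 0 3 x α β * θdiff 3 0 α)
  abel

lemma ΘTilde_eq (x : Configuration) (α : Fin 2) :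
    ΘTilde 0 x α = -(Complex.I • (oddRight x α : Grassmann)) := by
  simp only [ΘTilde, midPoint, oddRight, matTildeInv, Matrix.smul_apply, smul_eq_mul,
    Subalgebra.coe_mul, coe_matE]
  rw [← smul_neg, ← Finset.sum_neg_distrib]
  congr 1
  refine Finset.sum_congr rfl fun β _ => ?_
  change _ = -(sinv (sq 1 0 x) * mat 1 0 x α β * θbarDiff 1 0 β -
    sinv (sq 3 0 x) * mat 3 0 x α β * θbarDiff 3 0 β)
  simp only [Matrix.cons_val_zero]
  abel

/-- The matrix `𝐗̃_{1(2)-}` with even entries. -/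
def XE (x : Configuration) : Matrix (Fin 2) (Fin 2) evenPart :=
  (invE 0 2 x * invE 3 0 x) • ((matE 0 2 x).adjugate * matE 3 2 x * (matE 3 0 x).adjugate)

lemma coe_XE (x : Configuration) (a b : Fin 2) : (XE x a b : Grassmann) = XTilde 1 x a b := by
  have e1 : ∀ a b, (((invE 0 2 x) • (matE 0 2 x).adjugate) a b : Grassmann) = matInv 0 2 x a b := by
    intro a b
    rw [Matrix.smul_apply, smul_eq_mul, Subalgebra.coe_mul, coe_adjugate_matE]; rfl
  have e2 : ∀ a b, (((invE 3 0 x) • (matE 3 0 x).adjugate) a b : Grassmann) = matInv 3 0 x a b := by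
    intro a b
    rw [Matrix.smul_apply, smul_eq_mul, Subalgebra.coe_mul, coe_adjugate_matE]; rfl
  have e : XE x = ((invE 0 2 x) • (matE 0 2 x).adjugate) * matE 3 2 x *
      ((invE 3 0 x) • (matE 3 0 x).adjugate) := by
    rw [XE, Matrix.smul_mul, Matrix.smul_mul, Matrix.mul_smul, smul_smul]
  rw [e]
  change _ = (matInv 0 2 x * mat 3 2 x * matInv 3 0 x) a b
  simp only [Matrix.mul_apply, AddSubmonoidClass.coe_finsetSum, Subalgebra.coe_mul, e1, e2,
    coe_matE]

lemma coe_chiralProd (x : Configuration) : chiralProd x =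
    (((matE 0 2 x).det * (matE 1 3 x).det + (matE 0 3 x).det * (matE 1 2 x).det -
      ((matE 1 2 x).adjugate * matE 0 2 x * ((matE 0 3 x).adjugate * matE 1 3 x)).trace : evenPart) :
      Grassmann) := by
  simp only [chiralProd, det_matE, AddSubgroupClass.coe_sub, Subalgebra.coe_add,
    Subalgebra.coe_mul, Matrix.trace, Matrix.diag, Matrix.mul_apply,
    AddSubmonoidClass.coe_finsetSum, coe_adjugate_matE, coe_matE]
  rfl

lemma sinv_eq_of_mul_eq_one {a b : Grassmann} (ha : body a ≠ 0) (h : a * b = 1) : sinv a = b := by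
  rw [← mul_one (sinv a), ← h, ← mul_assoc, sinv_mul ha, one_mul]

/-- The root of `J` cancels against the root in `nilInv` by `sqrt_div_sqrt`, and the two imaginary
units in the spinors give a sign. What remains is in the form needed by `inverted_frame`. -/
lemma nilC_eq {x : Configuration} (hx : x ∈ spacelike) : nilC x =
    ((-(pair (oddProd (oddLeft x) (oddRight x)) (XE x) *
      ((matE 0 2 x).det * (matE 3 0 x).det * invE 3 2 x)) : evenPart) : Grassmann) := by
  have hs : spow (J x) (1 / 2) * sinv (spow (XPlusSq x * XMinusSq x) (1 / 2)) =
      -sinv (XMinusSq x) :=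
    sqrt_div_sqrt (unitFun_XPlusSq.even x hx) (unitFun_XMinusSq.even x hx)
      (unitFun_XPlusSq.real x hx) (unitFun_XMinusSq.real x hx)
      (body_re_ratio_neg (by decide) (by decide) (by decide) hx)
      (body_re_ratio_neg (by decide) (by decide) (by decide) hx)
  have hc : contract (ΘbarTilde 1 x) (XTilde 1 x) (ΘTilde 0 x) =
      -((pair (oddProd (oddLeft x) (oddRight x)) (XE x) : evenPart) : Grassmann) := by
    simp only [contract, pair, AddSubmonoidClass.coe_finsetSum, Subalgebra.coe_mul, coe_oddProd,
      ← Finset.sum_neg_distrib]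
    refine Finset.sum_congr rfl fun a _ => Finset.sum_congr rfl fun b _ => ?_
    rw [ΘbarTilde_eq, ΘTilde_eq, ← coe_XE, neg_mul, neg_mul, mul_neg, neg_neg, smul_mul_assoc,
      smul_mul_assoc, mul_smul_comm, smul_smul, Complex.I_mul_I, neg_one_smul, mul_assoc,
      (even_commute (XE x a b).2 _).eq, mul_assoc]
  have hu := fun {i j : Fin 4} (h : i ≠ j) => sqE_mul_invE h hx
  have s01 := hu (show (0 : Fin 4) ≠ 1 by decide)
  have s30 := hu (show (3 : Fin 4) ≠ 0 by decide)
  have s31 := hu (show (3 : Fin 4) ≠ 1 by decide)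
  have s32 := hu (show (3 : Fin 4) ≠ 2 by decide)
  have hX : XMinusSq x = ((sqE 3 1 x * (invE 3 0 x * invE 0 1 x) : evenPart) : Grassmann) := by
    have : sinv (sq 3 0 x * sq 0 1 x) = ((invE 3 0 x * invE 0 1 x : evenPart) : Grassmann) := by
      refine sinv_eq_of_mul_eq_one (a := ((sqE 3 0 x * sqE 0 1 x : evenPart) : Grassmann))
        (((unitFun_sq (by decide)).mul (unitFun_sq (by decide))).ne x hx) (congrArg Subtype.val (?_ :
        sqE 3 0 x * sqE 0 1 x * (invE 3 0 x * invE 0 1 x) = 1))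
      linear_combination (sqE 0 1 x * invE 0 1 x) * s30 + s01
    rw [XMinusSq, this]; rfl
  have hXi : sinv (XMinusSq x) = ((invE 3 1 x * (sqE 3 0 x * sqE 0 1 x) : evenPart) : Grassmann) := by
    refine sinv_eq_of_mul_eq_one (unitFun_XMinusSq.ne x hx) ?_
    rw [hX]
    refine congrArg Subtype.val (?_ : sqE 3 1 x * (invE 3 0 x * invE 0 1 x) *
      (invE 3 1 x * (sqE 3 0 x * sqE 0 1 x)) = 1)
    linear_combination (sqE 0 1 x * invE 0 1 x * sqE 3 1 x * invE 3 1 x) * s30 +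
      (sqE 3 1 x * invE 3 1 x) * s01 + s31
  have h6 : I₆ x * sinv (XMinusSq x) =
      (((matE 0 2 x).det * (matE 3 0 x).det * invE 3 2 x : evenPart) : Grassmann) := by
    have : sinv (sq 0 1 x * sq 3 2 x) = ((invE 0 1 x * invE 3 2 x : evenPart) : Grassmann) := by
      refine sinv_eq_of_mul_eq_one (a := ((sqE 0 1 x * sqE 3 2 x : evenPart) : Grassmann))
        (((unitFun_sq (by decide)).mul (unitFun_sq (by decide))).ne x hx) (congrArg Subtype.val (?_ :
        sqE 0 1 x * sqE 3 2 x * (invE 0 1 x * invE 3 2 x) = 1))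
      linear_combination (sqE 3 2 x * invE 3 2 x) * s01 + s32
    rw [hXi, I₆, crossRatio, this, det_matE, det_matE]
    refine congrArg Subtype.val (?_ : sqE 0 2 x * sqE 3 1 x * (invE 0 1 x * invE 3 2 x) *
      (invE 3 1 x * (sqE 3 0 x * sqE 0 1 x)) = sqE 0 2 x * sqE 3 0 x * invE 3 2 x)
    linear_combination (sqE 0 2 x * sqE 3 0 x * invE 3 2 x * sqE 3 1 x * invE 3 1 x) * s01 +
      (sqE 0 2 x * sqE 3 0 x * invE 3 2 x) * s31
  set p : evenPart := pair (oddProd (oddLeft x) (oddRight x)) (XE x) with hp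
  rw [nilC, nilInv, hc, neg_mul, neg_neg, mul_assoc, ← mul_assoc (spow _ _),
    ← (even_commute p.2 (spow _ _)).eq, mul_assoc (p : Grassmann), hs, ← mul_assoc,
    ← (even_commute p.2 (I₆ x)).eq, mul_assoc, mul_neg, mul_neg, h6]
  rfl

/-- Each spinor is a difference of two inverted ones, so their product has four terms. They belong
to the detours through point 1 of the intervals x_{2̄3}, x_{2̄4}, x_{4̄3} and x_{4̄4}. -/
lemma oddProd_oddLeft_oddRight (x : Configuration) : oddProd (oddLeft x) (oddRight x) =
    (invE 0 2 x * invE 1 0 x) • ((matE 0 2 x).transpose * oddProd (θO 2 0) (θbarO 1 0) *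
      (matE 1 0 x).transpose) -
    (invE 0 3 x * invE 1 0 x) • ((matE 0 3 x).transpose * oddProd (θO 3 0) (θbarO 1 0) *
      (matE 1 0 x).transpose) -
    ((invE 0 2 x * invE 3 0 x) • ((matE 0 2 x).transpose * oddProd (θO 2 0) (θbarO 3 0) *
      (matE 3 0 x).transpose) -
    (invE 0 3 x * invE 3 0 x) • ((matE 0 3 x).transpose * oddProd (θO 3 0) (θbarO 3 0) *
      (matE 3 0 x).transpose)) := by
  have key : ∀ (c d e f : evenPart) (u v : Grassmann), ((c * d : evenPart) : Grassmann) * u *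
      (((e * f : evenPart) : Grassmann) * v) =
      ((c * e : evenPart) : Grassmann) * ((d : Grassmann) * (u * v) * f) := by
    intro c d e f u v
    simp only [Subalgebra.coe_mul, mul_assoc]
    rw [← mul_assoc u (e : Grassmann), ← (even_commute e.2 u).eq, mul_assoc (e : Grassmann),
      ← mul_assoc (d : Grassmann), ← (even_commute e.2 d).eq, mul_assoc,
      ← (even_commute f.2 v).eq]
  refine Matrix.ext fun β α => Subtype.ext ?_
  rw [coe_oddProd]
  simp only [oddLeft, oddRight, Finset.sum_sub_distrib, sub_mul, mul_sub, Finset.sum_mul_sum, key]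
  simp only [Matrix.sub_apply, Matrix.smul_apply, Matrix.mul_apply, Matrix.transpose_apply,
    smul_eq_mul, AddSubgroupClass.coe_sub, AddSubmonoidClass.coe_finsetSum, Subalgebra.coe_mul,
    coe_oddProd, Finset.sum_mul, Finset.mul_sum]
  simp only [Fin.sum_univ_two, θO, θbarO]
  abel

/-- The identity relating the nilpotent invariant `C` to the product `chiralProd`. -/
lemma chiralProd_mul {x : Configuration} (hx : x ∈ spacelike) :
    chiralProd x * sq 3 0 x * (1 - (4 * Complex.I) • nilC x) = sq 0 3 x * sq 3 2 x * sq 1 0 x ∧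
      nilC x ^ 3 = 0 := by
  have hu := fun {i j : Fin 4} (h : i ≠ j) =>
    (show (matE i j x).det * invE i j x = 1 by rw [det_matE, sqE_mul_invE h hx])
  obtain ⟨h1, h2⟩ := inverted_frame iE_sq (matE_triangle 1 2 0 x) (matE_triangle 1 3 0 x)
    (matE_triangle 3 2 0 x) ((matE_self 3 x).symm.trans (matE_triangle 3 3 0 x))
    (hu (show (0 : Fin 4) ≠ 2 by decide)) (hu (show (0 : Fin 4) ≠ 3 by decide))
    (hu (show (1 : Fin 4) ≠ 0 by decide)) (hu (show (3 : Fin 4) ≠ 2 by decide))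
    (hu (show (3 : Fin 4) ≠ 0 by decide)) (A := XE x) rfl (w := oddProd (oddLeft x) (oddRight x))
    (oddProd_oddLeft_oddRight x) (isDyad_oddProd _ _)
    (C := -(pair (oddProd (oddLeft x) (oddRight x)) (XE x) *
      ((matE 0 2 x).det * (matE 3 0 x).det * invE 3 2 x))) rfl
  set C := -(pair (oddProd (oddLeft x) (oddRight x)) (XE x) *
      ((matE 0 2 x).det * (matE 3 0 x).det * invE 3 2 x)) with hC
  have hC' : nilC x = (C : Grassmann) := nilC_eq hx
  rw [hC']
  refine ⟨?_, congrArg Subtype.val h2⟩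
  rw [coe_chiralProd, ← coe_four_iE_mul]
  rw [det_matE 3 0, det_matE 3 2, det_matE 1 0] at h1
  have h1' := congrArg Subtype.val h1
  rw [det_matE 0 3 x] at h1' ⊢
  exact h1'

/-- The cross ratio `1 - 4 i C`. -/
def nilRatio : SuperFun := fun x =>
  sq 0 3 x * sq 3 2 x * sq 1 0 x * sinv (chiralProd x * sq 3 0 x)

lemma body_eq_zero_of_pow {a : Grassmann} {n : ℕ} (h : a ^ n = 0) : body a = 0 :=
  eq_zero_of_pow_eq_zero (n := n) (by rw [← map_pow, h, map_zero])

lemma body_sq_swap (i j : Fin 4) (x : Configuration) : body (sq i j x) = body (sq j i x) := by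
  rw [body_sq, body_sq]
  push_cast
  ring

/-- In the identity `chiralProd_mul` the nilpotent `C` disappears on passing to bodies. This shows
that `chiralProd` is invertible, which is not apparent from its definition. -/
lemma body_chiralProd {x : Configuration} (hx : x ∈ spacelike) :
    body (chiralProd x) = body (sq 3 2 x) * body (sq 1 0 x) := by
  obtain ⟨h1, h2⟩ := chiralProd_mul hx
  have h := congrArg body h1
  have h0 := (unitFun_sq (show (3 : Fin 4) ≠ 0 by decide)).ne x hx
  simp only [map_mul, map_sub, map_one, map_smul, body_eq_zero_of_pow h2, smul_zero, sub_zero,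
    mul_one] at h
  rw [body_sq_swap 0 3] at h
  exact mul_right_cancel₀ h0 (by linear_combination h)

lemma evenFun_mat (i j : Fin 4) (a b : Fin 2) : EvenFun fun x => mat i j x a b := by
  have : EvenFun fun x => ∑ μ : Fin 4, sigmaLower μ a b • interval i j μ x :=
    .sum _ fun μ _ => (evenFun_interval i j μ).smul _
  exact this

lemma evenFun_matTilde (i j : Fin 4) (a b : Fin 2) : EvenFun fun x => matTilde i j x a b := by
  have : EvenFun fun x => ∑ μ : Fin 4, sigmaTildeLower μ a b • interval i j μ x :=
    .sum _ fun μ _ => (evenFun_interval i j μ).smul _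
  exact this

lemma evenFun_matrix_mul {A B : Configuration → Matrix (Fin 2) (Fin 2) Grassmann}
    (hA : ∀ a b, EvenFun fun x => A x a b) (hB : ∀ a b, EvenFun fun x => B x a b) (a b : Fin 2) :
    EvenFun fun x => (A x * B x) a b := by
  simp only [Matrix.mul_apply]
  exact .sum _ fun c _ => (hA a c).mul (hB c b)

lemma unitFun_chiralProd : UnitFun chiralProd := by
  have hu := fun {i j : Fin 4} (h : i ≠ j) => unitFun_sq h
  refine ⟨⟨?_, fun x hx => ?_⟩, fun x hx => ?_⟩
  · refine EvenFun.sub (.add (.mul (evenFun_sq _ _) (evenFun_sq _ _))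
      (.mul (evenFun_sq _ _) (evenFun_sq _ _))) (.sum _ fun a _ => ?_)
    exact evenFun_matrix_mul (evenFun_matrix_mul (evenFun_matTilde _ _) (evenFun_mat _ _))
      (evenFun_matrix_mul (evenFun_matTilde _ _) (evenFun_mat _ _)) a a
  · have h := ((hu (show (3 : Fin 4) ≠ 2 by decide)).mul (hu (show (1 : Fin 4) ≠ 0 by decide))).real x hx
    rwa [map_mul, ← body_chiralProd hx] at h
  · have h := ((hu (show (3 : Fin 4) ≠ 2 by decide)).mul (hu (show (1 : Fin 4) ≠ 0 by decide))).ne x hx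
    rwa [map_mul, ← body_chiralProd hx] at h

lemma unitFun_nilRatio : UnitFun nilRatio :=
  (((unitFun_sq (by decide)).mul (unitFun_sq (by decide))).mul (unitFun_sq (by decide))).mul
    (unitFun_chiralProd.mul (unitFun_sq (by decide))).sinv

lemma nilRatio_eq {x : Configuration} (hx : x ∈ spacelike) :
    nilRatio x = 1 - (4 * Complex.I) • nilC x := by
  have h1 := (chiralProd_mul hx).1
  have hu := unitFun_chiralProd.mul (unitFun_sq (show (3 : Fin 4) ≠ 0 by decide))
  rw [nilRatio, ← h1, ← (even_commute (hu.sinv.even x hx) _).eq, ← mul_assoc,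
    sinv_mul (hu.ne x hx), one_mul]

/-- The logarithm of 1 - 4iC with C³ = 0 is -4i(C + 2iC²), which explains the shape of `T212`. -/
lemma twoLog_nilRatio {x : Configuration} (hx : x ∈ spacelike) :
    twoLog (nilRatio x) = -((8 * Complex.I) • T212 x) ∧ (nilRatio x - 1) ^ 3 = 0 := by
  have h3 := (chiralProd_mul hx).2
  rw [nilRatio_eq hx]
  constructor
  · have : T212 x = nilC x + (2 * Complex.I) • nilC x ^ 2 := rfl
    rw [this, twoLog, pow_two, sub_mul, mul_sub, mul_sub, one_mul, mul_one, one_mul, smul_mul_smul_comm,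
      ← pow_two (nilC x), Algebra.algebraMap_eq_smul_one]
    simp only [smul_add, smul_sub, smul_smul]
    have e : (8 * Complex.I * (2 * Complex.I)) = -16 := by linear_combination 16 * Complex.I_sq
    have e' : (4 * Complex.I * (4 * Complex.I)) = -16 := by linear_combination 16 * Complex.I_sq
    rw [e, e']
    module
  · rw [sub_sub_cancel_left, neg_pow, smul_pow, h3, smul_zero, mul_zero]

/-- Read multiplicatively, e^{4iT} = x_{1̄2}² x_{3̄4}² x_{2̄3}² / (x_{3̄2}² K) with `K` the chiral
product. The two terms ρ₁₃ of `T222` and `TSigma` cancel. -/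
lemma smul_T_eq {x : Configuration} (hx : x ∈ spacelike) : (8 * Complex.I) • T x =
    twoLog (ratio 0 3 x) - twoLog (ratio 2 3 x) - twoLog (ratio 0 1 x) - twoLog (ratio 1 2 x) +
      twoLog (nilRatio x) := by
  rw [(twoLog_ratio (by decide) hx).1, (twoLog_ratio (by decide) hx).1,
    (twoLog_ratio (by decide) hx).1, (twoLog_ratio (by decide) hx).1, (twoLog_nilRatio hx).1, T,
    T222, TSigma]
  module

/-- Even superfunctions with `(r - 1) ^ 3 = 0`. -/
structure UnipotentFun (r : SuperFun) : Prop extends UnitFun r where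
  cube : ∀ x ∈ spacelike, (r x - 1) ^ 3 = 0

lemma unipotentFun_ratio {i j : Fin 4} (h : i ≠ j) : UnipotentFun (ratio i j) :=
  ⟨(unitFun_sq h.symm).mul (unitFun_sq h).sinv, fun _ hx => (twoLog_ratio h hx).2⟩

lemma unipotentFun_nilRatio : UnipotentFun nilRatio :=
  ⟨unitFun_nilRatio, fun _ hx => (twoLog_nilRatio hx).2⟩

lemma EvenFun.congr {G H : SuperFun} (hG : EvenFun G) (h : ∀ x ∈ spacelike, H x = G x) :
    EvenFun H :=
  ⟨fun x hx => (hG.analytic x hx).congr (Filter.eventually_of_mem (isOpen_spacelike.mem_nhds hx)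
    fun y hy => (h y hy).symm), fun x hx => by rw [h x hx]; exact hG.even x hx⟩

lemma evenFun_one : EvenFun fun _ => (1 : Grassmann) := by
  simpa using EvenFun.const (c := (1 : Grassmann)) (one_mem _)

lemma UnipotentFun.evenFun_twoLog {r : SuperFun} (hr : UnipotentFun r) :
    EvenFun fun x => twoLog (r x) :=
  ((hr.toEvenFun.smul 4).sub (hr.toEvenFun.pow 2)).sub (.const (Subalgebra.algebraMap_mem _ _))

lemma UnipotentFun.body_twoLog {r : SuperFun} (hr : UnipotentFun r) {x : Configuration}
    (hx : x ∈ spacelike) : body (twoLog (r x)) = 0 := by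
  have h := body_eq_zero_of_pow (hr.cube x hx)
  rw [map_sub, map_one, sub_eq_zero] at h
  simp only [twoLog, map_sub, map_smul, map_pow, h, body_algebraMap]
  norm_num

/-! ### Derivatives of `T` and of the exponential series -/

section
variable {a : OddIndex → Grassmann} {b : Fin 4 → Fin 4 → Grassmann} {x : Configuration}

/-- Formally the derivative of 2 log r. Differentiating (r - 1)³ = 0 and cancelling the unit r gives
(r - 1)² l = 0, so 2r - r² acts on `l` as the identity. -/
lemma UnipotentFun.tangent_twoLog {r : SuperFun} (hr : UnipotentFun r) (hx : x ∈ spacelike)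
    {l : Grassmann} (h : HasLog a b x r l) :
    tangent a b (fun y => twoLog (r y)) x = (2 : ℂ) • l := by
  have hd := hr.toEvenFun.diff hx
  have he := hr.even x hx
  have h1 : EvenFun fun y => r y - 1 := hr.toEvenFun.sub evenFun_one
  have t1 : tangent a b (fun y => r y - 1) x = r x * l := by
    rw [tangent_sub hd (evenFun_one.diff hx), tangent_one, sub_zero, h]
  have h3 : tangent a b (fun y => (r y - 1) ^ 3) x = 0 := by
    rw [tangent_congr hx (H := fun _ => algebraMap ℂ Grassmann 0) fun y hy => by
      rw [hr.cube y hy, map_zero], tangent_const]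
  rw [tangent_pow (h1.diff hx) (h1.even x hx), t1] at h3
  have h4 : (r x - 1) ^ 2 * l = 0 := by
    have h5 := (smul_eq_zero.1 h3).resolve_left (by norm_num)
    have h6 := congrArg (ChiralFourPoint.sinv (r x) * ·) h5
    simp only [mul_zero] at h6
    rw [← mul_assoc, (even_commute (pow_mem (h1.even x hx) _) _).eq.symm] at h6
    have h7 : (r x - 1) ^ (3 - 1) * ChiralFourPoint.sinv (r x) * (r x * l) = (r x - 1) ^ 2 * l := by
      rw [mul_assoc, ← mul_assoc (ChiralFourPoint.sinv _), sinv_mul (hr.ne x hx), one_mul]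
    rw [h7] at h6
    exact h6
  have e4 := hr.toEvenFun.smul 4
  have e2 := hr.toEvenFun.pow 2
  simp only [twoLog]
  rw [tangent_sub ((e4.sub e2).diff hx) ((EvenFun.const (Subalgebra.algebraMap_mem _ _)).diff hx),
    tangent_const, sub_zero, tangent_sub (e4.diff hx) (e2.diff hx), tangent_smul _ hd,
    tangent_pow hd he, h]
  rw [pow_two, sub_mul (r x), mul_sub, mul_one, one_mul, sub_mul, sub_mul, sub_mul, one_mul,
    ← pow_two] at h4
  have h8 : l = r x * l + r x * l - r x ^ 2 * l := by
    rw [← sub_eq_zero, ← h4]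
    abel
  simp only [Nat.add_one_sub_one, pow_one, Nat.cast_ofNat, ← mul_assoc]
  rw [← pow_two]
  conv_rhs => rw [h8]
  module

variable {l : Fin 4 → Fin 4 → Grassmann} {m : Grassmann}

lemma evenFun_smul_T : EvenFun fun x => (4 * Complex.I) • T x := by
  have h : EvenFun fun x => (2⁻¹ : ℂ) • (twoLog (ratio 0 3 x) - twoLog (ratio 2 3 x) -
      twoLog (ratio 0 1 x) - twoLog (ratio 1 2 x) + twoLog (nilRatio x)) :=
    .smul _ (.add (.sub (.sub (.sub (unipotentFun_ratio (by decide)).evenFun_twoLog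
      (unipotentFun_ratio (by decide)).evenFun_twoLog)
      (unipotentFun_ratio (by decide)).evenFun_twoLog)
      (unipotentFun_ratio (by decide)).evenFun_twoLog) unipotentFun_nilRatio.evenFun_twoLog)
  refine h.congr fun x hx => ?_
  rw [← smul_T_eq hx, smul_smul]
  congr 1
  ring

lemma tangent_smul_T (hx : x ∈ spacelike) (h : ∀ i j, i ≠ j → HasLog a b x (sq i j) (l i j))
    (hK : HasLog a b x chiralProd m) : tangent a b (fun y => (4 * Complex.I) • T y) x =
      l 2 3 + l 0 1 + l 1 2 - l 2 1 - m := by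
  have hr : ∀ {i j : Fin 4}, i ≠ j →
      tangent a b (fun y => twoLog (ratio i j y)) x = (2 : ℂ) • (l j i + -l i j) := fun {i j} hij =>
    (unipotentFun_ratio hij).tangent_twoLog hx
      ((h j i hij.symm).mul (evenFun_sq _ _) (unitFun_sq hij).sinv.toEvenFun hx
        ((h i j hij).sinv (unitFun_sq hij) hx))
  have hc : tangent a b (fun y => twoLog (nilRatio y)) x =
      (2 : ℂ) • (l 0 3 + l 3 2 + l 1 0 + -(m + l 3 0)) :=
    unipotentFun_nilRatio.tangent_twoLog hx
      ((((h 0 3 (by decide)).mul (evenFun_sq _ _) (evenFun_sq _ _) hx (h 3 2 (by decide))).mul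
        ((evenFun_sq _ _).mul (evenFun_sq _ _)) (evenFun_sq _ _) hx (h 1 0 (by decide))).mul
        (((evenFun_sq _ _).mul (evenFun_sq _ _)).mul (evenFun_sq _ _))
        (unitFun_chiralProd.mul (unitFun_sq (by decide))).sinv.toEvenFun hx
        ((hK.mul unitFun_chiralProd.toEvenFun (evenFun_sq _ _) hx (h 3 0 (by decide))).sinv
          (unitFun_chiralProd.mul (unitFun_sq (by decide))) hx))
  have e1 : ∀ {i j : Fin 4}, i ≠ j → DifferentiableAt ℝ (fun y => twoLog (ratio i j y)) x :=
    fun hij => (unipotentFun_ratio hij).evenFun_twoLog.diff hx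
  have e2 := unipotentFun_nilRatio.evenFun_twoLog.diff hx
  have d3 : (0 : Fin 4) ≠ 3 := by decide
  have d23 : (2 : Fin 4) ≠ 3 := by decide
  have d01 : (0 : Fin 4) ≠ 1 := by decide
  have d12 : (1 : Fin 4) ≠ 2 := by decide
  have key := tangent_congr (a := a) (b := b) hx fun y hy => smul_T_eq hy
  have s2 : (fun y => (8 * Complex.I) • T y) = fun y => (2 : ℂ) • ((4 * Complex.I) • T y) := by
    funext y; rw [smul_smul]; congr 1; ring
  rw [s2, tangent_smul _ (evenFun_smul_T.diff hx),
    tangent_add ((((e1 d3).fun_sub (e1 d23)).fun_sub (e1 d01)).fun_sub (e1 d12)) e2,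
    tangent_sub (((e1 d3).fun_sub (e1 d23)).fun_sub (e1 d01)) (e1 d12),
    tangent_sub ((e1 d3).fun_sub (e1 d23)) (e1 d01), tangent_sub (e1 d3) (e1 d23),
    hr d3, hr d23, hr d01, hr d12, hc] at key
  rw [← inv_smul_smul₀ (two_ne_zero (α := ℂ)) (tangent a b _ x), key]
  module

lemma body_T (hx : x ∈ spacelike) : body ((4 * Complex.I) • T x) = 0 := by
  have h := congrArg body (smul_T_eq hx)
  have hr := fun {i j : Fin 4} (h : i ≠ j) => (unipotentFun_ratio h).body_twoLog hx
  rw [map_add, map_sub, map_sub, map_sub, hr (by decide), hr (by decide), hr (by decide),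
    hr (by decide), unipotentFun_nilRatio.body_twoLog hx, map_smul, smul_eq_mul] at h
  rw [map_smul, smul_eq_mul]
  linear_combination 2⁻¹ * h

lemma crossRatio_pos {i j k r s t u v : Fin 4} (h1 : i ≠ j) (h2 : k ≠ r) (h3 : s ≠ t) (h4 : u ≠ v)
    (hx : x ∈ spacelike) : 0 < (body (sq i j x * sq k r x * sinv (sq s t x * sq u v x))).re := by
  have u1 := unitFun_sq h1
  have u2 := unitFun_sq h2
  have u3 := (unitFun_sq h3).mul (unitFun_sq h4)
  rw [body_re_mul ((u1.mul u2).real x hx) (u3.sinv.real x hx), body_re_sinv (u3.real x hx),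
    body_re_mul (u1.real x hx) (u2.real x hx),
    body_re_mul ((unitFun_sq h3).real x hx) ((unitFun_sq h4).real x hx)]
  exact mul_pos (mul_pos_of_neg_of_neg (body_sq_re_neg h1 hx) (body_sq_re_neg h2 hx))
    (inv_pos.2 (mul_pos_of_neg_of_neg (body_sq_re_neg h3 hx) (body_sq_re_neg h4 hx)))

lemma unitFun_I₁ : UnitFun I₁ :=
  unitFun_crossRatio (by decide) (by decide) (by decide) (by decide)

lemma unitFun_I₂ : UnitFun I₂ :=
  unitFun_crossRatio (by decide) (by decide) (by decide) (by decide)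

lemma crossRatios_mem (hx : x ∈ spacelike) :
    ((body (I₁ x)).re, (body (I₂ x)).re) ∈ crossRatioRange :=
  ⟨crossRatio_pos (by decide) (by decide) (by decide) (by decide) hx,
    crossRatio_pos (by decide) (by decide) (by decide) (by decide) hx⟩

/-- The superfunction `∑_k (4 i T)^k / k! (𝓘₁ ∂/∂𝓘₁)^k f (𝓘₁, 𝓘₂)`. -/
def expSum (f : ℝ × ℝ → ℂ) : SuperFun := fun x => ∑ k ∈ Finset.range 17,
  ((k.factorial : ℂ)⁻¹ • ((4 * Complex.I) • T x) ^ k) * superEval (eulerOp^[k] f) (I₁ x) (I₂ x)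

/-- The hypotheses `h1`, `h2` say that x_{1̄4}² x_{2̄3}² / K and 𝓘₂ are annihilated. The derivatives
of the non-chiral intervals in 𝓘₁ are opposite to those in 4iT, so nothing has to be known about
them. -/
lemma tangent_expSum {f : ℝ × ℝ → ℂ} (hf : AnalyticOnNhd ℝ f crossRatioRange)
    (hx : x ∈ spacelike) (h : ∀ i j, i ≠ j → HasLog a b x (sq i j) (l i j))
    (hK : HasLog a b x chiralProd m) (h1 : l 0 3 + l 1 2 = m) (h2 : l 0 2 + l 1 3 = m) :
    tangent a b (expSum f) x = 0 := by
  have hI : ∀ {r s t u : Fin 4}, r ≠ s → t ≠ u → r ≠ u → t ≠ s →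
      HasLog a b x (crossRatio r s t u) (l r s + l t u + -(l r u + l t s)) :=
    fun {r s t u} hrs htu hru hts => ((h r s hrs).mul (evenFun_sq _ _) (evenFun_sq _ _) hx
      (h t u htu)).mul ((evenFun_sq _ _).mul (evenFun_sq _ _))
      ((unitFun_sq hru).mul (unitFun_sq hts)).sinv.toEvenFun hx
      (((h r u hru).mul (evenFun_sq _ _) (evenFun_sq _ _) hx (h t s hts)).sinv
        ((unitFun_sq hru).mul (unitFun_sq hts)) hx)
  refine tangent_exp_euler hf unitFun_I₁.toRealFun unitFun_I₂.toRealFun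
    (fun x hx => crossRatios_mem hx) evenFun_smul_T hx (body_T hx)
    (hI (by decide) (by decide) (by decide) (by decide)) ?_ ?_
  · have := hI (show (0 : Fin 4) ≠ 3 by decide) (show (1 : Fin 4) ≠ 2 by decide)
      (show (0 : Fin 4) ≠ 2 by decide) (show (1 : Fin 4) ≠ 3 by decide)
    rw [h1, h2, add_neg_cancel, HasLog, mul_zero] at this
    exact this
  · rw [tangent_smul_T hx h hK, ← h1]
    abel

end

end
end ChiralFourPoint

namespace ChiralFourPoint
noncomputable section

/-! ### The generators as first-order operators -/

section
variable {a : OddIndex → Grassmann} {b : Fin 4 → Fin 4 → Grassmann} {x : Configuration}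

lemma tangent_coord (i μ : Fin 4) :
    tangent a b (fun y => algebraMap ℂ Grassmann ((y i μ : ℝ) : ℂ)) x = b i μ := by
  have hL : HasFDerivAt (fun y : Configuration => ((y i μ : ℝ) : ℂ))
      (Complex.ofRealCLM.comp ((ContinuousLinearMap.proj (R := ℝ) (φ := fun _ : Fin 4 => ℝ) μ).comp
        (ContinuousLinearMap.proj (R := ℝ) (φ := fun _ : Fin 4 => Fin 4 → ℝ) i))) x :=
    (Complex.ofRealCLM.comp ((ContinuousLinearMap.proj (R := ℝ) (φ := fun _ : Fin 4 => ℝ) μ).comp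
        (ContinuousLinearMap.proj (R := ℝ) (φ := fun _ : Fin 4 => Fin 4 → ℝ) i))).hasFDerivAt
  rw [tangent_scalar hL.differentiableAt, hL.fderiv]
  have : ∀ j ν, (Complex.ofRealCLM.comp ((ContinuousLinearMap.proj (R := ℝ)
      (φ := fun _ : Fin 4 => ℝ) μ).comp
        (ContinuousLinearMap.proj (R := ℝ) (φ := fun _ : Fin 4 => Fin 4 → ℝ) i))) (dir j ν) =
      if j = i ∧ ν = μ then 1 else 0 := by
    intro j ν
    by_cases h1 : j = i
    · subst h1
      by_cases h2 : ν = μ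
      · subst h2; simp [dir]
      · simp [dir, h2, Ne.symm h2]
    · simp [dir, h1, Ne.symm h1]
  simp only [this]
  rw [Finset.sum_eq_single i (by intro j _ hj; simp [hj]) (by simp),
    Finset.sum_eq_single μ (by intro j _ hj; simp [hj]) (by simp)]
  simp

lemma tangent_const_grassmann (c : Grassmann) :
    tangent a b (fun _ => c) x = ∑ k, a k * dgen k c := by
  simp [tangent, dx_const]

lemma dgen_θ_mul_θbar (j i : Fin 4) (α β : Fin 2) :
    ∑ k, a k * dgen k (θ j α * θbar i β) =
      a (Sum.inl (j, α)) * θbar i β - a (Sum.inr (i, β)) * θ j α := by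
  have h : ∀ k, dgen k (θ j α * θbar i β) =
      (if k = Sum.inl (j, α) then θbar i β else 0) - (if k = Sum.inr (i, β) then θ j α else 0) := by
    intro k
    have h1 : dgen k (θ j α * θbar i β) = _ := dgen_vec_mul k (Pi.single (Sum.inl (j, α)) 1) _
    have h2 : dgen k (θbar i β) = _ := dgen_vec k (Pi.single (Sum.inr (i, β)) 1)
    rw [h1, h2, Pi.single_apply, Pi.single_apply]
    congr 1
    · split_ifs <;> simp
    · split_ifs <;> simp [θ, vec]
  simp only [h, mul_sub, Finset.sum_sub_distrib, mul_ite, mul_zero, Finset.sum_ite_eq',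
    Finset.mem_univ, if_true]

/-- The matrix of the coordinates of a point, with upper indices. -/
def xTilde (i : Fin 4) (x : Configuration) (c d : Fin 2) : ℂ :=
  ∑ μ, sigmaTildeLower μ c d * (x i μ : ℂ)

lemma matTilde_eq (i j : Fin 4) (x : Configuration) (c d : Fin 2) :
    matTilde i j x c d = algebraMap ℂ Grassmann (xTilde i x c d - xTilde j x c d) +
      Complex.I • ((2 : ℂ) • (θ i d * θbar i c) + (2 : ℂ) • (θ j d * θbar j c) -
        (4 : ℂ) • (θ j d * θbar i c)) := by
  have h4 : (4 : ℂ) = 2 * 2 := by norm_num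
  rw [h4, mul_smul]
  simp only [← sum_sigmaTildeLower_θσθbar, matTilde, Matrix.of_apply, interval_eq, smul_add,
    smul_sub, Finset.sum_add_distrib, Finset.sum_sub_distrib, Finset.smul_sum, xTilde, map_sub,
    map_sum]
  simp only [smul_comm (sigmaTildeLower _ c d), Complex.ofReal_sub, map_sub, smul_sub,
    Finset.sum_sub_distrib, map_mul, ← Algebra.smul_def]

lemma xPlusTilde_eq (i : Fin 4) (x : Configuration) (c d : Fin 2) :
    xPlusTilde i x c d = algebraMap ℂ Grassmann (xTilde i x c d) -
      (2 * Complex.I) • (θ i d * θbar i c) := by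
  rw [mul_comm, mul_smul]
  simp only [← sum_sigmaTildeLower_θσθbar, xPlusTilde, xPlus, smul_sub, Finset.sum_sub_distrib,
    Finset.smul_sum, xTilde, map_sum, map_mul, ← Algebra.smul_def]
  simp only [smul_comm (sigmaTildeLower _ c d)]

lemma xMinusTilde_eq (i : Fin 4) (x : Configuration) (c d : Fin 2) :
    xMinusTilde i x c d = algebraMap ℂ Grassmann (xTilde i x c d) +
      (2 * Complex.I) • (θ i d * θbar i c) := by
  rw [mul_comm, mul_smul]
  simp only [← sum_sigmaTildeLower_θσθbar, xMinusTilde, xMinus, smul_add, Finset.sum_add_distrib,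
    Finset.smul_sum, xTilde, map_sum, map_mul, ← Algebra.smul_def]
  simp only [smul_comm (sigmaTildeLower _ c d)]

lemma sum_sigmaTildeLower_θσ (i : Fin 4) (c d e : Fin 2) :
    ∑ μ, sigmaTildeLower μ c d • θσ μ i e = if e = c then (2 : ℂ) • θ i d else 0 := by
  fin_cases c <;> fin_cases d <;> fin_cases e <;>
    simp [θσ, sigmaTildeLower, pauli, Fin.sum_univ_four, smul_smul] <;> module

lemma sum_sigmaTildeLower_σθbar (i : Fin 4) (c d e : Fin 2) :
    ∑ μ, sigmaTildeLower μ c d • σθbar μ i e = if e = d then (2 : ℂ) • θbar i c else 0 := by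
  fin_cases c <;> fin_cases d <;> fin_cases e <;>
    simp [σθbar, sigmaTildeLower, pauli, Fin.sum_univ_four, smul_smul] <;> module

lemma diff_coord (i μ : Fin 4) :
    DifferentiableAt ℝ (fun y : Configuration => algebraMap ℂ Grassmann ((y i μ : ℝ) : ℂ)) x := by
  have h : AnalyticAt ℝ (fun y : Configuration => ((y i μ : ℝ) : ℂ)) x :=
    (Complex.ofRealCLM.comp ((ContinuousLinearMap.proj (R := ℝ) (φ := fun _ : Fin 4 => ℝ) μ).comp
        (ContinuousLinearMap.proj (R := ℝ) (φ := fun _ : Fin 4 => Fin 4 → ℝ) i))).analyticAt x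
  exact (analyticAt_scalar h).differentiableAt

lemma diff_xTilde (i : Fin 4) (c d : Fin 2) :
    DifferentiableAt ℝ (fun y => algebraMap ℂ Grassmann (xTilde i y c d)) x := by
  simp only [xTilde, map_sum, map_mul, ← Algebra.smul_def]
  exact DifferentiableAt.fun_sum fun μ _ => (diff_coord i μ).fun_const_smul (sigmaTildeLower μ c d)

lemma tangent_xTilde (i : Fin 4) (c d : Fin 2) :
    tangent a b (fun y => algebraMap ℂ Grassmann (xTilde i y c d)) x =
      ∑ μ, sigmaTildeLower μ c d • b i μ := by
  simp only [xTilde, map_sum, map_mul, ← Algebra.smul_def]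
  rw [tangent_sum _ fun μ _ => (diff_coord i μ).fun_const_smul (sigmaTildeLower μ c d)]
  refine Finset.sum_congr rfl fun μ _ => ?_
  rw [tangent_smul _ (diff_coord i μ), tangent_coord]

/-- The entries are linear in the coordinates and bilinear in the odd variables, so the coefficients
of an operator determine its action. The action of each generator on the intervals is read off from
this formula. -/
lemma tangent_matTilde (i j : Fin 4) (c d : Fin 2) :
    tangent a b (fun y => matTilde i j y c d) x =
      (∑ μ, sigmaTildeLower μ c d • b i μ) - (∑ μ, sigmaTildeLower μ c d • b j μ) +
      (Complex.I • ((2 : ℂ) • (a (Sum.inl (i, d)) * θbar i c - a (Sum.inr (i, c)) * θ i d) +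
        (2 : ℂ) • (a (Sum.inl (j, d)) * θbar j c - a (Sum.inr (j, c)) * θ j d) -
        (4 : ℂ) • (a (Sum.inl (j, d)) * θbar i c - a (Sum.inr (i, c)) * θ j d))) := by
  simp only [matTilde_eq, map_sub]
  rw [tangent_add ((diff_xTilde _ _ _).fun_sub (diff_xTilde _ _ _)) (differentiableAt_const _),
    tangent_sub (diff_xTilde _ _ _) (diff_xTilde _ _ _), tangent_xTilde, tangent_xTilde,
    tangent_const_grassmann]
  simp only [← dgen_θ_mul_θbar, map_sub, map_add, map_smul, mul_sub, mul_add, mul_smul_comm,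
    Finset.sum_sub_distrib, Finset.sum_add_distrib, Finset.smul_sum, smul_sub, smul_add]

end

/-- The coefficients of the odd derivatives in `D_{iα}`. -/
def coeffD (i : Fin 4) (α : Fin 2) : OddIndex → Grassmann := Pi.single (Sum.inl (i, α)) 1

/-- The coefficients of the space-time derivatives in `D_{iα}`. -/
def shiftD (i : Fin 4) (α : Fin 2) (j μ : Fin 4) : Grassmann :=
  if j = i then -(Complex.I • σθbar μ i α) else 0

/-- The coefficients of the odd derivatives in `D̄_{iα̇}`. -/
def coeffDbar (i : Fin 4) (β : Fin 2) : OddIndex → Grassmann := Pi.single (Sum.inr (i, β)) (-1)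

/-- The coefficients of the space-time derivatives in `D̄_{iα̇}`. -/
def shiftDbar (i : Fin 4) (β : Fin 2) (j μ : Fin 4) : Grassmann :=
  if j = i then Complex.I • θσ μ i β else 0

/-- The coefficients of the odd derivatives in `Q_α`. -/
def coeffQ (α : Fin 2) : OddIndex → Grassmann := Sum.elim (fun p => if p.2 = α then 1 else 0) 0

/-- The coefficients of the space-time derivatives in `Q_α`. -/
def shiftQ (α : Fin 2) (i μ : Fin 4) : Grassmann := Complex.I • σθbar μ i α

/-- The coefficients of the odd derivatives in `Q̄_α̇`. -/
def coeffQbar (β : Fin 2) : OddIndex → Grassmann := Sum.elim 0 (fun p => if p.2 = β then 1 else 0)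

/-- The coefficients of the space-time derivatives in `Q̄_α̇`. -/
def shiftQbar (β : Fin 2) (i μ : Fin 4) : Grassmann := Complex.I • θσ μ i β

/-- The coefficients of the odd derivatives in `S^β`. -/
def coeffS (x : Configuration) (β : Fin 2) : OddIndex → Grassmann :=
  Sum.elim (fun p => -((4 * Complex.I) • (θ p.1 β * θ p.1 p.2))) (fun p => xMinusTilde p.1 x p.2 β)

/-- The coefficients of the space-time derivatives in `S^β`. -/
def shiftS (x : Configuration) (β : Fin 2) (i μ : Fin 4) : Grassmann :=
  Complex.I • ∑ c : Fin 2, θσ μ i c * xPlusTilde i x c β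

/-- The coefficients of the odd derivatives in `S̄^β̇`. -/
def coeffSbar (x : Configuration) (β : Fin 2) : OddIndex → Grassmann :=
  Sum.elim (fun p => xPlusTilde p.1 x β p.2) (fun p => (4 * Complex.I) • (θbar p.1 p.2 * θbar p.1 β))

/-- The coefficients of the space-time derivatives in `S̄^β̇`. -/
def shiftSbar (x : Configuration) (β : Fin 2) (i μ : Fin 4) : Grassmann :=
  Complex.I • ∑ c : Fin 2, xMinusTilde i x β c * σθbar μ i c

section
variable (G : SuperFun) (x : Configuration)

lemma D_eq_tangent (i : Fin 4) (α : Fin 2) :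
    D i α G x = tangent (coeffD i α) (shiftD i α) G x := by
  have h1 : ∑ k, coeffD i α k * dgen k (G x) = dθ i α (G x) := by
    rw [Finset.sum_eq_single (Sum.inl (i, α)) (by intro k _ hk; simp [coeffD, hk]) (by simp)]
    simp [coeffD, dθ_eq_dgen]
  have h2 : ∑ j, ∑ μ, shiftD i α j μ * dx j μ G x =
      -(Complex.I • ∑ μ, σθbar μ i α * dx i μ G x) := by
    rw [Finset.sum_eq_single i (by intro k _ hk; simp [shiftD, hk]) (by simp)]
    simp [shiftD, Finset.smul_sum]
  rw [tangent, h1, h2, D, sub_eq_add_neg]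

lemma Dbar_eq_tangent (i : Fin 4) (β : Fin 2) :
    Dbar i β G x = tangent (coeffDbar i β) (shiftDbar i β) G x := by
  have h1 : ∑ k, coeffDbar i β k * dgen k (G x) = -dθbar i β (G x) := by
    rw [Finset.sum_eq_single (Sum.inr (i, β)) (by intro k _ hk; simp [coeffDbar, hk]) (by simp)]
    simp [coeffDbar, dθbar_eq_dgen]
  have h2 : ∑ j, ∑ μ, shiftDbar i β j μ * dx j μ G x =
      Complex.I • ∑ μ, θσ μ i β * dx i μ G x := by
    rw [Finset.sum_eq_single i (by intro k _ hk; simp [shiftDbar, hk]) (by simp)]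
    simp [shiftDbar, Finset.smul_sum]
  rw [tangent, h1, h2, Dbar]

lemma Q_eq_tangent (α : Fin 2) : Q α G x = tangent (coeffQ α) (shiftQ α) G x := by
  simp only [tangent, Q, Finset.sum_add_distrib, Fintype.sum_sum_type, coeffQ, Sum.elim_inl,
    Sum.elim_inr, Pi.zero_apply, zero_mul, Finset.sum_const_zero, add_zero, Fintype.sum_prod_type,
    ite_mul, one_mul, Finset.sum_ite_eq', Finset.mem_univ, if_true, shiftQ, smul_mul_assoc,
    Finset.smul_sum, dθ_eq_dgen]

lemma Qbar_eq_tangent (β : Fin 2) : Qbar β G x = tangent (coeffQbar β) (shiftQbar β) G x := by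
  simp only [tangent, Qbar, Finset.sum_add_distrib, Fintype.sum_sum_type, coeffQbar, Sum.elim_inl,
    Sum.elim_inr, Pi.zero_apply, zero_mul, Finset.sum_const_zero, zero_add, Fintype.sum_prod_type,
    ite_mul, one_mul, Finset.sum_ite_eq', Finset.mem_univ, if_true, shiftQbar, smul_mul_assoc,
    Finset.smul_sum, dθbar_eq_dgen]

lemma S_eq_tangent (η κ : Fin 4 → ℝ) (β : Fin 2) :
    S η κ β G x = tangent (coeffS x β) (shiftS x β) G x +
      ∑ i, (2 * Complex.I * ((η i - 3 * κ i : ℝ) : ℂ)) • (θ i β * G x) := by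
  simp only [tangent, S, Finset.sum_add_distrib, Finset.sum_sub_distrib, Fintype.sum_sum_type,
    coeffS, Sum.elim_inl, Sum.elim_inr, Fintype.sum_prod_type, shiftS, smul_mul_assoc,
    Finset.smul_sum, Finset.sum_mul, dθ_eq_dgen, dθbar_eq_dgen, neg_mul, Finset.sum_neg_distrib]
  abel

lemma Sbar_eq_tangent (η κ : Fin 4 → ℝ) (β : Fin 2) :
    Sbar η κ β G x = tangent (coeffSbar x β) (shiftSbar x β) G x +
      ∑ i, (2 * Complex.I * ((η i + 3 * κ i : ℝ) : ℂ)) • (θbar i β * G x) := by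
  simp only [tangent, Sbar, Finset.sum_add_distrib, Fintype.sum_sum_type,
    coeffSbar, Sum.elim_inl, Sum.elim_inr, Fintype.sum_prod_type, shiftSbar, smul_mul_assoc,
    Finset.smul_sum, Finset.sum_mul, dθ_eq_dgen, dθbar_eq_dgen]

end

/-! #### Action on intervals -/

section
variable (x : Configuration) (i j : Fin 4) (c d : Fin 2)

lemma sum_smul_I_σθbar (i : Fin 4) (c d e : Fin 2) :
    ∑ μ, sigmaTildeLower μ c d • Complex.I • σθbar μ i e =
      if e = d then (2 * Complex.I) • θbar i c else 0 := by
  simp only [smul_comm _ Complex.I, ← Finset.smul_sum, sum_sigmaTildeLower_σθbar]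
  split_ifs
  · rw [smul_smul, mul_comm]
  · rw [smul_zero]

lemma sum_smul_I_θσ (i : Fin 4) (c d e : Fin 2) :
    ∑ μ, sigmaTildeLower μ c d • Complex.I • θσ μ i e =
      if e = c then (2 * Complex.I) • θ i d else 0 := by
  simp only [smul_comm _ Complex.I, ← Finset.smul_sum, sum_sigmaTildeLower_θσ]
  split_ifs
  · rw [smul_smul, mul_comm]
  · rw [smul_zero]

lemma tangent_Q_matTilde (α : Fin 2) :
    tangent (coeffQ α) (shiftQ α) (fun y => matTilde i j y c d) x = 0 := by
  rw [tangent_matTilde]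
  simp only [shiftQ, sum_smul_I_σθbar, coeffQ, Sum.elim_inl, Sum.elim_inr, Pi.zero_apply, zero_mul,
    sub_zero, eq_comm (a := d)]
  split_ifs
  · simp only [one_mul]
    module
  · simp

lemma tangent_Qbar_matTilde (β : Fin 2) :
    tangent (coeffQbar β) (shiftQbar β) (fun y => matTilde i j y c d) x = 0 := by
  rw [tangent_matTilde]
  simp only [shiftQbar, sum_smul_I_θσ, coeffQbar, Sum.elim_inl, Sum.elim_inr, Pi.zero_apply,
    zero_mul, zero_sub, eq_comm (a := c)]
  split_ifs
  · simp only [one_mul]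
    module
  · simp

/-- The interval x_{īj} depends on point i only through x_{i-} and θ̄_i, both of which `D` at i
annihilates. At the other end it involves x_{j+} and θ_j, whence the restriction on `k`. -/
lemma tangent_D_matTilde {k : Fin 4} (hk : k ≠ j) (α : Fin 2) :
    tangent (coeffD k α) (shiftD k α) (fun y => matTilde i j y c d) x = 0 := by
  have h : ∀ l, ∑ μ, sigmaTildeLower μ c d • shiftD k α l μ =
      if l = k ∧ α = d then -((2 * Complex.I) • θbar k c) else 0 := by
    intro l
    by_cases hl : l = k
    · simp only [shiftD, hl, if_true, smul_neg, Finset.sum_neg_distrib, sum_smul_I_σθbar, true_and]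
      split_ifs <;> simp
    · simp [shiftD, hl]
  rw [tangent_matTilde, h, h]
  have h2 : ∀ l e, coeffD k α (Sum.inl (l, e)) = if l = k ∧ α = e then 1 else 0 := by
    intro l e
    simp [coeffD, Pi.single_apply, eq_comm (a := e)]
  have h3 : ∀ l e, coeffD k α (Sum.inr (l, e)) = 0 := by
    intro l e
    simp [coeffD]
  simp only [h2, h3, hk.symm, false_and, if_false, zero_mul, sub_zero, smul_zero, add_zero]
  by_cases hi : i = k ∧ α = d
  · obtain ⟨rfl, rfl⟩ := hi
    simp only [and_self, if_true, one_mul]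
    module
  · simp [if_neg hi]

/-- The mirror image: the dependence on point j is only through x_{j+} and θ_j, which `D̄` at j
annihilates. -/
lemma tangent_Dbar_matTilde {k : Fin 4} (hk : k ≠ i) (β : Fin 2) :
    tangent (coeffDbar k β) (shiftDbar k β) (fun y => matTilde i j y c d) x = 0 := by
  have h : ∀ l, ∑ μ, sigmaTildeLower μ c d • shiftDbar k β l μ =
      if l = k ∧ β = c then (2 * Complex.I) • θ k d else 0 := by
    intro l
    by_cases hl : l = k
    · simp only [shiftDbar, hl, if_true, sum_smul_I_θσ, true_and]
    · simp [shiftDbar, hl]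
  rw [tangent_matTilde, h, h]
  have h2 : ∀ l e, coeffDbar k β (Sum.inr (l, e)) = if l = k ∧ β = e then -1 else 0 := by
    intro l e
    simp [coeffDbar, Pi.single_apply, eq_comm (a := e)]
  have h3 : ∀ l e, coeffDbar k β (Sum.inl (l, e)) = 0 := by
    intro l e
    simp [coeffDbar]
  simp only [h2, h3, hk.symm, false_and, if_false, zero_mul, sub_zero, smul_zero, zero_sub]
  by_cases hi : j = k ∧ β = c
  · obtain ⟨rfl, rfl⟩ := hi
    simp only [and_self, if_true, one_mul, neg_mul]
    module
  · simp [if_neg hi]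

lemma θ_swap (i j : Fin 4) (c d : Fin 2) : θ i c * θ j d = -(θ j d * θ i c) :=
  odd_mul_odd (θ_odd _ _) (θ_odd _ _)

lemma θbar_swap (i j : Fin 4) (c d : Fin 2) : θbar i c * θbar j d = -(θbar j d * θbar i c) :=
  odd_mul_odd (θbar_odd _ _) (θbar_odd _ _)

lemma θ_mul_θbar_comm (i j : Fin 4) (c d : Fin 2) (z : Grassmann) :
    θ i c * θbar j d * z = z * (θ i c * θbar j d) :=
  (even_commute (mul_mem_evenPart (θ_odd _ _) (θbar_odd _ _)) z).eq

/-- The terms that do not factorise cancel between the two endpoints. What is left involves θ at the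
unbarred end only: an infinitesimal scaling and Lorentz rotation located at the point j. -/
lemma tangent_S_matTilde (β : Fin 2) :
    tangent (coeffS x β) (shiftS x β) (fun y => matTilde i j y c d) x =
      (4 * Complex.I) • (θ j d * matTilde i j x c β) := by
  have hb : ∀ i, ∑ μ, sigmaTildeLower μ c d • shiftS x β i μ =
      (2 * Complex.I) • (θ i d * xPlusTilde i x c β) := by
    intro i
    have : ∀ μ, sigmaTildeLower μ c d • shiftS x β i μ = ∑ e : Fin 2,
        (sigmaTildeLower μ c d • Complex.I • θσ μ i e) * xPlusTilde i x e β := fun μ => by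
      simp only [shiftS, Finset.smul_sum, smul_mul_assoc]
    simp only [this]
    rw [Finset.sum_comm]
    simp only [← Finset.sum_mul, sum_smul_I_θσ]
    simp only [ite_mul, zero_mul, Finset.sum_ite_eq', Finset.mem_univ, if_true, smul_mul_assoc]
  rw [tangent_matTilde, hb, hb]
  simp only [coeffS, Sum.elim_inl, Sum.elim_inr, xPlusTilde_eq, xMinusTilde_eq, matTilde_eq,
    mul_add, mul_sub, add_mul, ← Algebra.smul_def, ← Algebra.commutes _ (θ _ _),
    mul_smul_comm, smul_mul_assoc, neg_mul, map_sub]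
  simp only [θ_mul_θbar_comm _ _ _ _ (θ _ _)]
  simp only [← mul_assoc, θ_swap i i β d, θ_swap j j β d, neg_mul, smul_neg, neg_neg]
  module

lemma θbar_mul_θbar_comm (i j : Fin 4) (c d : Fin 2) (z : Grassmann) :
    θbar i c * θbar j d * z = z * (θbar i c * θbar j d) :=
  (even_commute (mul_mem_evenPart (θbar_odd _ _) (θbar_odd _ _)) z).eq

lemma tangent_Sbar_matTilde (β : Fin 2) :
    tangent (coeffSbar x β) (shiftSbar x β) (fun y => matTilde i j y c d) x =
      (4 * Complex.I) • (matTilde i j x β d * θbar i c) := by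
  have hb : ∀ i, ∑ μ, sigmaTildeLower μ c d • shiftSbar x β i μ =
      (2 * Complex.I) • (xMinusTilde i x β d * θbar i c) := by
    intro i
    have : ∀ μ, sigmaTildeLower μ c d • shiftSbar x β i μ = ∑ e : Fin 2,
        xMinusTilde i x β e * (sigmaTildeLower μ c d • Complex.I • σθbar μ i e) := fun μ => by
      simp only [shiftSbar, Finset.smul_sum, mul_smul_comm]
    simp only [this]
    rw [Finset.sum_comm]
    simp only [← Finset.mul_sum, sum_smul_I_σθbar]
    simp only [mul_ite, mul_zero, Finset.sum_ite_eq', Finset.mem_univ, if_true, mul_smul_comm]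
  rw [tangent_matTilde, hb, hb]
  simp only [coeffSbar, Sum.elim_inl, Sum.elim_inr, xPlusTilde_eq, xMinusTilde_eq, matTilde_eq,
    add_mul, sub_mul, ← Algebra.smul_def, smul_mul_assoc, map_sub]
  simp only [θbar_mul_θbar_comm _ _ _ _ (θ _ _)]
  simp only [← mul_assoc]
  simp only [mul_assoc, θbar_swap i i c β, θbar_swap j j c β, mul_neg, smul_neg]
  module

end

/-! #### Logarithmic derivatives -/

/-- Conformal action of a first-order operator on the intervals `x_{īj}` for which `P i j`. -/
structure IsConformal (a : OddIndex → Grassmann) (b : Fin 4 → Fin 4 → Grassmann)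
    (x : Configuration) (P : Fin 4 → Fin 4 → Prop) (n nb : Fin 4 → Fin 2 → Fin 2 → Grassmann) :
    Prop where
  eq : ∀ i j, P i j → ∀ c d, tangent a b (fun y => matTilde i j y c d) x =
    ∑ e, matTilde i j x c e * n j e d + ∑ e, matTilde i j x e d * nb i c e

/-- The action of an operator on a function with values in the even part. -/
def tangentE (a : OddIndex → Grassmann) (b : Fin 4 → Fin 4 → Grassmann) (x : Configuration)
    (E : Configuration → evenPart) : Grassmann := tangent a b (fun y => (E y : Grassmann)) x

section
variable {a : OddIndex → Grassmann} {b : Fin 4 → Fin 4 → Grassmann} {x : Configuration}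
  {E F : Configuration → evenPart}

lemma tangentE_mul (hE : EvenFun fun y => (E y : Grassmann))
    (hF : EvenFun fun y => (F y : Grassmann)) (hx : x ∈ spacelike) :
    tangentE a b x (fun y => E y * F y) = E x • tangentE a b x F + F x • tangentE a b x E := by
  have h := tangent_mul (a := a) (b := b) (hE.diff hx) (hF.diff hx) (E x).2
  rw [add_comm, ← (even_commute (F x).2 _).eq] at h
  exact h

lemma tangentE_add (hE : EvenFun fun y => (E y : Grassmann))
    (hF : EvenFun fun y => (F y : Grassmann)) (hx : x ∈ spacelike) :
    tangentE a b x (fun y => E y + F y) = tangentE a b x E + tangentE a b x F :=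
  tangent_add (hE.diff hx) (hF.diff hx)

lemma tangentE_sub (hE : EvenFun fun y => (E y : Grassmann))
    (hF : EvenFun fun y => (F y : Grassmann)) (hx : x ∈ spacelike) :
    tangentE a b x (fun y => E y - F y) = tangentE a b x E - tangentE a b x F :=
  tangent_sub (hE.diff hx) (hF.diff hx)

/-- The matrix `𝐱̃_{īj}` with even entries. -/
def matTE (i j : Fin 4) (x : Configuration) : Matrix (Fin 2) (Fin 2) evenPart :=
  (matE i j x).adjugate

lemma coe_matTE (i j : Fin 4) (x : Configuration) (c d : Fin 2) :
    (matTE i j x c d : Grassmann) = matTilde i j x c d := coe_adjugate_matE i j x c d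

lemma evenFun_matTE (i j : Fin 4) (c d : Fin 2) :
    EvenFun fun x => (matTE i j x c d : Grassmann) := by
  simp only [coe_matTE]
  exact evenFun_matTilde i j c d

lemma matE_eq_adjugate (i j : Fin 4) (x : Configuration) :
    matE i j x = (matTE i j x).adjugate := by
  rw [matTE, Matrix.adjugate_adjugate _ (by simp)]
  simp

lemma sqE_eq (i j : Fin 4) (x : Configuration) : sqE i j x =
    matTE i j x 0 0 * matTE i j x 1 1 - matTE i j x 0 1 * matTE i j x 1 0 := by
  rw [← Matrix.det_fin_two, ← det_matE, matTE, Matrix.det_adjugate, Fintype.card_fin, pow_one]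

variable {P : Fin 4 → Fin 4 → Prop} {n nb : Fin 4 → Fin 2 → Fin 2 → Grassmann}

lemma IsConformal.tangentE_matTE (h : IsConformal a b x P n nb) {i j : Fin 4} (hp : P i j)
    (c d : Fin 2) : tangentE a b x (fun y => matTE i j y c d) =
      matTE i j x c 0 • n j 0 d + matTE i j x c 1 • n j 1 d +
        (matTE i j x 0 d • nb i c 0 + matTE i j x 1 d • nb i c 1) := by
  have := h.eq i j hp c d
  simp only [← coe_matTE, Fin.sum_univ_two] at this
  exact this

/-- The square is a determinant, so only the traces of the two local factors survive. -/
lemma IsConformal.hasLog_sq (h : IsConformal a b x P n nb) (hx : x ∈ spacelike) {i j : Fin 4}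
    (hp : P i j) : HasLog a b x (sq i j) (n j 0 0 + n j 1 1 + (nb i 0 0 + nb i 1 1)) := by
  have e : ∀ c d, EvenFun fun x => (matTE i j x c d : Grassmann) := evenFun_matTE i j
  have h1 : tangentE a b x (sqE i j) =
      sqE i j x • (n j 0 0 + n j 1 1 + (nb i 0 0 + nb i 1 1)) := by
    rw [funext (sqE_eq i j)]
    rw [tangentE_sub ((e 0 0).mul (e 1 1)) ((e 0 1).mul (e 1 0)) hx,
      tangentE_mul (e 0 0) (e 1 1) hx, tangentE_mul (e 0 1) (e 1 0) hx]
    simp only [h.tangentE_matTE hp]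
    module
  exact h1

/-- The matrix `𝐱̃_{ij} 𝐱_{kl}` with even entries. -/
def mulE (i j k l : Fin 4) (x : Configuration) : Matrix (Fin 2) (Fin 2) evenPart :=
  matTE i j x * (matTE k l x).adjugate

lemma mulE_zero (i j k l : Fin 4) (x : Configuration) (c : Fin 2) : mulE i j k l x c 0 =
    matTE i j x c 0 * matTE k l x 1 1 - matTE i j x c 1 * matTE k l x 1 0 := by
  simp [mulE, Matrix.adjugate_fin_two, Matrix.mul_apply, Fin.sum_univ_two, sub_eq_add_neg]

lemma mulE_one (i j k l : Fin 4) (x : Configuration) (c : Fin 2) : mulE i j k l x c 1 =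
    matTE i j x c 1 * matTE k l x 0 0 - matTE i j x c 0 * matTE k l x 0 1 := by
  simp [mulE, Matrix.adjugate_fin_two, Matrix.mul_apply, Fin.sum_univ_two, sub_eq_add_neg, add_comm]

lemma evenFun_mulE (i j k l : Fin 4) (c d : Fin 2) :
    EvenFun fun x => (mulE i j k l x c d : Grassmann) := by
  have e := fun c d => evenFun_matTE i j c d
  have f := fun c d => evenFun_matTE k l c d
  fin_cases d
  · exact (((e c 0).mul (f 1 1)).sub ((e c 1).mul (f 1 0))).congr fun x _ =>
      congrArg Subtype.val (mulE_zero i j k l x c)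
  · exact (((e c 1).mul (f 0 0)).sub ((e c 0).mul (f 0 1))).congr fun x _ =>
      congrArg Subtype.val (mulE_one i j k l x c)

/-- At the shared point j the factors of a matrix and of an adjugate meet and leave only a trace.
The factors at i and k stay on the outside. -/
lemma IsConformal.tangentE_mulE (h : IsConformal a b x P n nb) (hx : x ∈ spacelike)
    {i j k : Fin 4} (hi : P i j) (hk : P k j) (c d : Fin 2) :
    tangentE a b x (fun y => mulE i j k j y c d) =
      mulE i j k j x c d • (n j 0 0 + n j 1 1 + (nb k 0 0 + nb k 1 1)) +
      (mulE i j k j x 0 d • nb i c 0 + mulE i j k j x 1 d • nb i c 1) -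
      (mulE i j k j x c 0 • nb k 0 d + mulE i j k j x c 1 • nb k 1 d) := by
  have e := fun c d => evenFun_matTE i j c d
  have f := fun c d => evenFun_matTE k j c d
  fin_cases d
  · simp only [Fin.zero_eta, mulE_zero, mulE_one]
    rw [tangentE_sub ((e c 0).mul (f 1 1)) ((e c 1).mul (f 1 0)) hx,
      tangentE_mul (e c 0) (f 1 1) hx, tangentE_mul (e c 1) (f 1 0) hx]
    simp only [h.tangentE_matTE hi, h.tangentE_matTE hk]
    module
  · simp only [Fin.mk_one, mulE_zero, mulE_one]
    rw [tangentE_sub ((e c 1).mul (f 0 0)) ((e c 0).mul (f 0 1)) hx,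
      tangentE_mul (e c 1) (f 0 0) hx, tangentE_mul (e c 0) (f 0 1) hx]
    simp only [h.tangentE_matTE hi, h.tangentE_matTE hk]
    module

lemma coe_chiralProd_eq (x : Configuration) : chiralProd x =
    ((sqE 0 2 x * sqE 1 3 x + sqE 0 3 x * sqE 1 2 x -
      (mulE 1 2 0 2 x 0 0 * mulE 0 3 1 3 x 0 0 + mulE 1 2 0 2 x 0 1 * mulE 0 3 1 3 x 1 0 +
      (mulE 1 2 0 2 x 1 0 * mulE 0 3 1 3 x 0 1 + mulE 1 2 0 2 x 1 1 * mulE 0 3 1 3 x 1 1)) :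
      evenPart) : Grassmann) := by
  rw [coe_chiralProd, det_matE, det_matE, det_matE, det_matE, matE_eq_adjugate 0 2,
    matE_eq_adjugate 1 3]
  congr 2
  rw [Matrix.trace_fin_two]
  change (mulE 1 2 0 2 x * mulE 0 3 1 3 x) 0 0 + (mulE 1 2 0 2 x * mulE 0 3 1 3 x) 1 1 = _
  rw [Matrix.mul_apply, Matrix.mul_apply, Fin.sum_univ_two, Fin.sum_univ_two]

/-- In the trace, points 3 and 4 are shared by neighbouring matrices and contribute traces only,
while the outer factors at points 1 and 2 cancel against each other by cyclicity. So all three terms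
of `chiralProd` have the same logarithmic derivative. -/
lemma IsConformal.hasLog_chiralProd (h : IsConformal a b x P n nb) (hx : x ∈ spacelike)
    (h02 : P 0 2) (h03 : P 0 3) (h12 : P 1 2) (h13 : P 1 3) :
    HasLog a b x chiralProd ((n 2 0 0 + n 2 1 1 + (nb 0 0 0 + nb 0 1 1)) +
      (n 3 0 0 + n 3 1 1 + (nb 1 0 0 + nb 1 1 1))) := by
  set l := (n 2 0 0 + n 2 1 1 + (nb 0 0 0 + nb 0 1 1)) +
      (n 3 0 0 + n 3 1 1 + (nb 1 0 0 + nb 1 1 1)) with hl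
  have s : ∀ i j, EvenFun fun x => (sqE i j x : Grassmann) := evenFun_sq
  have e := fun c d => evenFun_mulE 1 2 0 2 c d
  have f := fun c d => evenFun_mulE 0 3 1 3 c d
  have hs : ∀ i j, P i j → tangentE a b x (sqE i j) =
      sqE i j x • (n j 0 0 + n j 1 1 + (nb i 0 0 + nb i 1 1)) := fun i j hp => h.hasLog_sq hx hp
  set K : Configuration → evenPart := fun x => sqE 0 2 x * sqE 1 3 x + sqE 0 3 x * sqE 1 2 x -
      (mulE 1 2 0 2 x 0 0 * mulE 0 3 1 3 x 0 0 + mulE 1 2 0 2 x 0 1 * mulE 0 3 1 3 x 1 0 +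
      (mulE 1 2 0 2 x 1 0 * mulE 0 3 1 3 x 0 1 + mulE 1 2 0 2 x 1 1 * mulE 0 3 1 3 x 1 1))
      with hK
  have key : tangentE a b x K = K x • l := by
    rw [hK, tangentE_sub (((s 0 2).mul (s 1 3)).add ((s 0 3).mul (s 1 2)))
      ((((e 0 0).mul (f 0 0)).add ((e 0 1).mul (f 1 0))).add
        (((e 1 0).mul (f 0 1)).add ((e 1 1).mul (f 1 1)))) hx,
      tangentE_add ((s 0 2).mul (s 1 3)) ((s 0 3).mul (s 1 2)) hx,
      tangentE_add (((e 0 0).mul (f 0 0)).add ((e 0 1).mul (f 1 0)))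
        (((e 1 0).mul (f 0 1)).add ((e 1 1).mul (f 1 1))) hx,
      tangentE_add ((e 0 0).mul (f 0 0)) ((e 0 1).mul (f 1 0)) hx,
      tangentE_add ((e 1 0).mul (f 0 1)) ((e 1 1).mul (f 1 1)) hx,
      tangentE_mul (s 0 2) (s 1 3) hx, tangentE_mul (s 0 3) (s 1 2) hx,
      tangentE_mul (e 0 0) (f 0 0) hx, tangentE_mul (e 0 1) (f 1 0) hx,
      tangentE_mul (e 1 0) (f 0 1) hx, tangentE_mul (e 1 1) (f 1 1) hx, hs 0 2 h02, hs 1 3 h13,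
      hs 0 3 h03, hs 1 2 h12]
    simp only [h.tangentE_mulE hx h12 h02, h.tangentE_mulE hx h03 h13, hl]
    module
  have e1 : chiralProd = fun x => (K x : Grassmann) := funext coe_chiralProd_eq
  rw [HasLog, e1]
  exact key

end

end
end ChiralFourPoint

namespace ChiralFourPoint
noncomputable section

/-! #### The generators act conformally -/

section
variable (x : Configuration)

lemma isConformal_zero {a : OddIndex → Grassmann} {b : Fin 4 → Fin 4 → Grassmann}
    {P : Fin 4 → Fin 4 → Prop}
    (h : ∀ i j, P i j → ∀ c d, tangent a b (fun y => matTilde i j y c d) x = 0) :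
    IsConformal a b x P 0 0 := ⟨fun i j hp c d => by simp [h i j hp c d]⟩

lemma isConformal_Q (α : Fin 2) :
    IsConformal (coeffQ α) (shiftQ α) x (fun _ _ => True) 0 0 :=
  isConformal_zero x fun i j _ c d => tangent_Q_matTilde x i j c d α

lemma isConformal_Qbar (α : Fin 2) :
    IsConformal (coeffQbar α) (shiftQbar α) x (fun _ _ => True) 0 0 :=
  isConformal_zero x fun i j _ c d => tangent_Qbar_matTilde x i j c d α

lemma isConformal_D (k : Fin 4) (α : Fin 2) :
    IsConformal (coeffD k α) (shiftD k α) x (fun _ j => k ≠ j) 0 0 :=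
  isConformal_zero x fun i j hk c d => tangent_D_matTilde x i j c d hk α

lemma isConformal_Dbar (k : Fin 4) (α : Fin 2) :
    IsConformal (coeffDbar k α) (shiftDbar k α) x (fun i _ => k ≠ i) 0 0 :=
  isConformal_zero x fun i j hk c d => tangent_Dbar_matTilde x i j c d hk α

lemma isConformal_S (β : Fin 2) : IsConformal (coeffS x β) (shiftS x β) x (fun _ _ => True)
    (fun j e d => if e = β then (4 * Complex.I) • θ j d else 0) 0 := by
  refine ⟨fun i j _ c d => ?_⟩
  rw [tangent_S_matTilde]
  simp only [mul_ite, mul_zero, Finset.sum_ite_eq', Finset.mem_univ, if_true, Pi.zero_apply,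
    Finset.sum_const_zero, add_zero, mul_smul_comm]
  rw [← coe_matTE, (even_commute (matTE i j x c β).2 _).eq]

lemma isConformal_Sbar (β : Fin 2) :
    IsConformal (coeffSbar x β) (shiftSbar x β) x (fun _ _ => True) 0
      (fun i c e => if e = β then (4 * Complex.I) • θbar i c else 0) := by
  refine ⟨fun i j _ c d => ?_⟩
  rw [tangent_Sbar_matTilde]
  simp only [mul_ite, mul_zero, Finset.sum_ite_eq', Finset.mem_univ, if_true, Pi.zero_apply,
    Finset.sum_const_zero, zero_add, mul_smul_comm]

end

section
variable {a : OddIndex → Grassmann} {b : Fin 4 → Fin 4 → Grassmann} {x : Configuration}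

lemma sum_ite_diag (β : Fin 2) (z : Fin 2 → Grassmann) :
    (if (0 : Fin 2) = β then z 0 else 0) + (if (1 : Fin 2) = β then z 1 else 0) = z β := by
  fin_cases β <;> simp

/-- The logarithmic derivatives of the intervals and of the product `chiralProd` are those of a
conformal transformation. -/
structure HasLogs (a : OddIndex → Grassmann) (b : Fin 4 → Fin 4 → Grassmann) (x : Configuration)
    (s t : Fin 4 → Grassmann) : Prop where
  sq : ∀ i j, i ≠ j → HasLog a b x (sq i j) (s j + t i)
  prod : HasLog a b x chiralProd (s 2 + t 0 + (s 3 + t 1))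

lemma IsConformal.hasLogs {n nb : Fin 4 → Fin 2 → Fin 2 → Grassmann}
    (h : IsConformal a b x (fun _ _ => True) n nb) (hx : x ∈ spacelike) :
    HasLogs a b x (fun j => n j 0 0 + n j 1 1) (fun i => nb i 0 0 + nb i 1 1) :=
  ⟨fun _ _ _ => h.hasLog_sq hx trivial,
    h.hasLog_chiralProd hx trivial trivial trivial trivial⟩

lemma hasLogs_Q (hx : x ∈ spacelike) (α : Fin 2) : HasLogs (coeffQ α) (shiftQ α) x 0 0 := by
  have := (isConformal_Q x α).hasLogs hx
  simp only [Pi.zero_apply, add_zero] at this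
  exact this

lemma hasLogs_Qbar (hx : x ∈ spacelike) (α : Fin 2) :
    HasLogs (coeffQbar α) (shiftQbar α) x 0 0 := by
  have := (isConformal_Qbar x α).hasLogs hx
  simp only [Pi.zero_apply, add_zero] at this
  exact this

lemma hasLogs_S (hx : x ∈ spacelike) (β : Fin 2) :
    HasLogs (coeffS x β) (shiftS x β) x (fun i => (4 * Complex.I) • θ i β) 0 := by
  have := (isConformal_S x β).hasLogs hx
  have e := fun i => sum_ite_diag β fun c => (4 * Complex.I) • θ i c
  simp only [Pi.zero_apply, add_zero, e] at this
  exact this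

lemma hasLogs_Sbar (hx : x ∈ spacelike) (β : Fin 2) :
    HasLogs (coeffSbar x β) (shiftSbar x β) x 0 (fun i => (4 * Complex.I) • θbar i β) := by
  have := (isConformal_Sbar x β).hasLogs hx
  have e := fun i => sum_ite_diag β fun c => (4 * Complex.I) • θbar i c
  simp only [Pi.zero_apply, add_zero, e] at this
  exact this

/-- The ratio representing e^{4iT} has total weight zero at every point, separately for the `s` and
the `t` weights. -/
lemma HasLogs.tangent_T {s t : Fin 4 → Grassmann} (h : HasLogs a b x s t) (hx : x ∈ spacelike) :
    tangent a b T x = 0 := by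
  have h1 := tangent_smul_T hx h.sq h.prod
  have h2 : tangent a b (fun y => (4 * Complex.I) • T y) x = 0 := by
    rw [h1]; abel
  have hI : (4 * Complex.I) ≠ 0 := by simp
  have e : T = fun y => (4 * Complex.I)⁻¹ • (4 * Complex.I) • T y := by
    funext y; rw [inv_smul_smul₀ hI]
  rw [e, tangent_smul _ (evenFun_smul_T.diff hx), h2, smul_zero]

lemma evenFun_T : EvenFun T := by
  refine (evenFun_smul_T.smul (4 * Complex.I)⁻¹).congr fun y _ => ?_
  rw [inv_smul_smul₀ (by simp)]

lemma isNilpotent_T (hx : x ∈ spacelike) : IsNilpotent (T x) := by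
  have h := body_T hx
  rw [map_smul, smul_eq_zero] at h
  have h0 : body (T x) = 0 := h.resolve_left (by simp)
  exact ⟨17, eq_zero_of_mem_filt (by norm_num) (pow_mem_filt (mem_filt_one_of_body h0) 17)⟩

lemma isSuperconformal_of_hasLogs {G : SuperFun} (hG : AnalyticOnNhd ℝ G spacelike)
    (h : ∀ {a b x s t}, x ∈ spacelike → HasLogs a b x s t → tangent a b G x = 0) :
    IsSuperconformal 0 0 G where
  analytic := hG
  Q_eq α x hx := by rw [Q_eq_tangent, h hx (hasLogs_Q hx α)]
  Qbar_eq α x hx := by rw [Qbar_eq_tangent, h hx (hasLogs_Qbar hx α)]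
  S_eq α x hx := by rw [S_eq_tangent, h hx (hasLogs_S hx α)]; simp
  Sbar_eq α x hx := by rw [Sbar_eq_tangent, h hx (hasLogs_Sbar hx α)]; simp

theorem isSuperconformal_T : IsSuperconformal 0 0 T :=
  isSuperconformal_of_hasLogs evenFun_T.analytic fun hx h => h.tangent_T hx

/-! #### Chiral superfunctions -/

/-- The logarithmic derivatives of the chiral intervals. -/
structure HasChiralLogs (a : OddIndex → Grassmann) (b : Fin 4 → Fin 4 → Grassmann)
    (x : Configuration) (s t : Fin 4 → Grassmann) : Prop where
  h02 : HasLog a b x (sq 0 2) (s 2 + t 0)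
  h03 : HasLog a b x (sq 0 3) (s 3 + t 0)
  h12 : HasLog a b x (sq 1 2) (s 2 + t 1)
  h13 : HasLog a b x (sq 1 3) (s 3 + t 1)
  prod : HasLog a b x chiralProd (s 2 + t 0 + (s 3 + t 1))

lemma HasLogs.chiral {s t : Fin 4 → Grassmann} (h : HasLogs a b x s t) : HasChiralLogs a b x s t :=
  ⟨h.sq _ _ (by decide), h.sq _ _ (by decide), h.sq _ _ (by decide), h.sq _ _ (by decide), h.prod⟩

lemma IsConformal.hasChiralLogs {P : Fin 4 → Fin 4 → Prop} (h : IsConformal a b x P 0 0)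
    (hx : x ∈ spacelike) (h02 : P 0 2) (h03 : P 0 3) (h12 : P 1 2) (h13 : P 1 3) :
    HasChiralLogs a b x 0 0 := by
  have hs : ∀ i j, P i j → HasLog a b x (ChiralFourPoint.sq i j) (0 + 0) := fun i j hp => by
    simpa using h.hasLog_sq hx hp
  refine ⟨hs _ _ h02, hs _ _ h03, hs _ _ h12, hs _ _ h13, ?_⟩
  simpa using h.hasLog_chiralProd hx h02 h03 h12 h13

lemma hasChiralLogs_D (hx : x ∈ spacelike) {k : Fin 4} (h2 : k ≠ 2) (h3 : k ≠ 3) (α : Fin 2) :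
    HasChiralLogs (coeffD k α) (shiftD k α) x 0 0 :=
  (isConformal_D x k α).hasChiralLogs hx h2 h3 h2 h3

lemma hasChiralLogs_Dbar (hx : x ∈ spacelike) {k : Fin 4} (h0 : k ≠ 0) (h1 : k ≠ 1) (α : Fin 2) :
    HasChiralLogs (coeffDbar k α) (shiftDbar k α) x 0 0 :=
  (isConformal_Dbar x k α).hasChiralLogs hx h0 h0 h1 h1

lemma HasChiralLogs.tangent_expSum {s t : Fin 4 → Grassmann} (h : HasChiralLogs a b x s t)
    {f : ℝ × ℝ → ℂ} (hf : AnalyticOnNhd ℝ f crossRatioRange) (hx : x ∈ spacelike) :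
    tangent a b (expSum f) x = 0 := by
  -- For `D` and `D̄` nothing is known about the non-chiral intervals. As these are invertible they
  -- still have some logarithmic derivative, and it drops out.
  set l : Fin 4 → Fin 4 → Grassmann := fun i j => sinv (sq i j x) * tangent a b (sq i j) x
  have hl : ∀ i j, i ≠ j → HasLog a b x (sq i j) (l i j) := fun i j hij =>
    hasLog_sinv_mul (unitFun_sq hij) hx
  have e := fun {i j} (hij : i ≠ j) {m} (h' : HasLog a b x (sq i j) m) =>
    (hl i j hij).unique (unitFun_sq hij) hx h'
  refine ChiralFourPoint.tangent_expSum hf hx hl h.prod ?_ ?_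
  · rw [e (by decide) h.h03, e (by decide) h.h12]; abel
  · rw [e (by decide) h.h02, e (by decide) h.h13]

/-- The logarithmic derivative of `x_{1̄3}^{2 p} x_{1̄4}^{2 q} x_{2̄3}^{2 r}`. -/
lemma HasChiralLogs.powers {s t : Fin 4 → Grassmann} (h : HasChiralLogs a b x s t)
    (hx : x ∈ spacelike) (p q r : ℝ) :
    HasLog a b x (fun x => spow (sq 0 2 x) p * spow (sq 0 3 x) q * spow (sq 1 2 x) r)
      ((p : ℂ) • (s 2 + t 0) + (q : ℂ) • (s 3 + t 0) + (r : ℂ) • (s 2 + t 1)) := by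
  have u2 := unitFun_sq (show (0 : Fin 4) ≠ 2 by decide)
  have u3 := unitFun_sq (show (0 : Fin 4) ≠ 3 by decide)
  have u12 := unitFun_sq (show (1 : Fin 4) ≠ 2 by decide)
  exact ((h.h02.spow u2 hx p).mul (u2.spow_evenFun p) (u3.spow_evenFun q) hx
    (h.h03.spow u3 hx q)).mul ((u2.spow_evenFun p).mul (u3.spow_evenFun q)) (u12.spow_evenFun r) hx
    (h.h12.spow u12 hx r)

lemma evenFun_powers (p q r : ℝ) : EvenFun fun x =>
    spow (sq 0 2 x) p * spow (sq 0 3 x) q * spow (sq 1 2 x) r :=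
  (((unitFun_sq (by decide)).spow_evenFun p).mul ((unitFun_sq (by decide)).spow_evenFun q)).mul
    ((unitFun_sq (by decide)).spow_evenFun r)

lemma evenFun_expSum {f : ℝ × ℝ → ℂ} (hf : AnalyticOnNhd ℝ f crossRatioRange) :
    EvenFun (expSum f) :=
  .sum _ fun k _ => ((evenFun_smul_T.pow k).smul _).mul
    (evenFun_superEval (analytic_iterate analytic_eulerOp hf k) unitFun_I₁.toRealFun
      unitFun_I₂.toRealFun fun _ hx => crossRatios_mem hx)

/-- The relation between R-charges and scale dimensions of anti-chiral and chiral fields. -/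
structure Matched (η κ : Fin 4 → ℝ) : Prop where
  h0 : κ 0 = η 0 / 3
  h1 : κ 1 = η 1 / 3
  h2 : κ 2 = -(η 2 / 3)
  h3 : κ 3 = -(η 3 / 3)
  sum : ∑ i, κ i = 0

lemma Matched.zero : Matched 0 0 := by constructor <;> simp

/-- Multiplication of a superfunction by a power of the prefactor. -/
theorem IsChiralFourPointFunction.mul_powers {η κ η' κ' : Fin 4 → ℝ} {G : SuperFun}
    (hG : IsChiralFourPointFunction η κ G) (hm : Matched η κ) (hm' : Matched η' κ') {p q r : ℝ}
    (h0 : η' 0 = η 0 - p - q) (h1 : η' 1 = η 1 - r) (h2 : η' 2 = η 2 - p - r) (h3 : η' 3 = η 3 - q) :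
    IsChiralFourPointFunction η' κ' fun x =>
      (spow (sq 0 2 x) p * spow (sq 0 3 x) q * spow (sq 1 2 x) r) * G x := by
  have hP := evenFun_powers p q r
  set P : SuperFun := fun x => spow (sq 0 2 x) p * spow (sq 0 3 x) q * spow (sq 1 2 x) r with hPdef
  change IsChiralFourPointFunction η' κ' fun x => P x * G x
  have key : ∀ {a b x s t}, x ∈ spacelike → HasChiralLogs a b x s t →
      tangent a b (fun y => P y * G y) x = P x * (((p : ℂ) • (s 2 + t 0) + (q : ℂ) • (s 3 + t 0) +
        (r : ℂ) • (s 2 + t 1)) * G x + tangent a b G x) := by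
    intro a b x s t hx h
    have h1 : tangent a b P x = P x * _ := h.powers hx p q r
    rw [tangent_mul (hP.diff hx) (hG.analytic x hx).differentiableAt (hP.even x hx), h1,
      mul_assoc (P x) _ (G x), ← mul_add]
  have comm : ∀ {x} (_ : x ∈ spacelike) (c : ℂ) (z : Grassmann),
      c • (z * (P x * G x)) = P x * (c • (z * G x)) := fun {x} hx c z => by
    rw [← mul_assoc, ← (even_commute (hP.even x hx) z).eq, mul_assoc, mul_smul_comm]
  refine ⟨⟨fun x hx => analyticAt_mul (hP.analytic x hx) (hG.analytic x hx), ?_, ?_, ?_, ?_⟩,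
    ?_, ?_, ?_, ?_⟩
  · intro α x hx
    rw [Q_eq_tangent, key hx (hasLogs_Q hx α).chiral, ← Q_eq_tangent, hG.Q_eq α x hx]
    simp
  · intro α x hx
    rw [Qbar_eq_tangent, key hx (hasLogs_Qbar hx α).chiral, ← Qbar_eq_tangent, hG.Qbar_eq α x hx]
    simp
  · intro α x hx
    have h := hG.S_eq α x hx
    rw [S_eq_tangent] at h
    rw [S_eq_tangent, key hx (hasLogs_S hx α).chiral, eq_neg_of_add_eq_zero_left h]
    simp only [comm hx, ← Finset.mul_sum, ← mul_add]
    -- Under `Matched` the weight η - 3κ is zero at points 1, 2 and 2η at points 3, 4. The change of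
    -- the weights prescribed by `h2`, `h3` is compensated by the logarithmic derivative of the
    -- powers.
    convert mul_zero _
    simp only [Fin.sum_univ_four, hm.h0, hm.h1, hm.h2, hm.h3, hm'.h0, hm'.h1, hm'.h2, hm'.h3, h0,
      h1, h2, h3, Pi.zero_apply, add_zero, add_mul, smul_mul_assoc]
    push_cast
    module
  · intro α x hx
    have h := hG.Sbar_eq α x hx
    rw [Sbar_eq_tangent] at h
    rw [Sbar_eq_tangent, key hx (hasLogs_Sbar hx α).chiral, eq_neg_of_add_eq_zero_left h]
    simp only [comm hx, ← Finset.mul_sum, ← mul_add]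
    convert mul_zero _
    simp only [Fin.sum_univ_four, hm.h0, hm.h1, hm.h2, hm.h3, hm'.h0, hm'.h1, hm'.h2, hm'.h3, h0,
      h1, h2, h3, Pi.zero_apply, zero_add, add_mul, smul_mul_assoc]
    push_cast
    module
  all_goals intro α x hx
  · rw [D_eq_tangent, key hx (hasChiralLogs_D hx (by decide) (by decide) α), ← D_eq_tangent,
      hG.D_one α x hx]
    simp
  · rw [D_eq_tangent, key hx (hasChiralLogs_D hx (by decide) (by decide) α), ← D_eq_tangent,
      hG.D_two α x hx]
    simp
  · rw [Dbar_eq_tangent, key hx (hasChiralLogs_Dbar hx (by decide) (by decide) α),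
      ← Dbar_eq_tangent, hG.Dbar_three α x hx]
    simp
  · rw [Dbar_eq_tangent, key hx (hasChiralLogs_Dbar hx (by decide) (by decide) α),
      ← Dbar_eq_tangent, hG.Dbar_four α x hx]
    simp

lemma isChiral_of_hasChiralLogs {G : SuperFun} (hG : AnalyticOnNhd ℝ G spacelike)
    (h : ∀ {a b x s t}, x ∈ spacelike → HasChiralLogs a b x s t → tangent a b G x = 0) :
    IsChiralFourPointFunction 0 0 G where
  toIsSuperconformal := isSuperconformal_of_hasLogs hG fun hx hl => h hx hl.chiral
  D_one α x hx := by
    rw [D_eq_tangent, h hx (hasChiralLogs_D hx (by decide) (by decide) α)]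
  D_two α x hx := by
    rw [D_eq_tangent, h hx (hasChiralLogs_D hx (by decide) (by decide) α)]
  Dbar_three α x hx := by
    rw [Dbar_eq_tangent, h hx (hasChiralLogs_Dbar hx (by decide) (by decide) α)]
  Dbar_four α x hx := by
    rw [Dbar_eq_tangent, h hx (hasChiralLogs_Dbar hx (by decide) (by decide) α)]

lemma isChiral_expSum {f : ℝ × ℝ → ℂ} (hf : AnalyticOnNhd ℝ f crossRatioRange) :
    IsChiralFourPointFunction 0 0 (expSum f) :=
  isChiral_of_hasChiralLogs (evenFun_expSum hf).analytic fun hx h => h.tangent_expSum hf hx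

lemma IsChiralFourPointFunction.congr {η κ : Fin 4 → ℝ} {G H : SuperFun}
    (hG : IsChiralFourPointFunction η κ G) (h : H = G) : IsChiralFourPointFunction η κ H := h ▸ hG

/-- The weight-zero function `expSum` is multiplied by the prefactor. Its weight at point 1 comes
out right because vanishing total R-charge means η₁ + η₂ = η₃ + η₄. -/
theorem isChiral_expD {η κ : Fin 4 → ℝ} (hm : Matched η κ) {f : ℝ × ℝ → ℂ}
    (hf : AnalyticOnNhd ℝ f crossRatioRange) : IsChiralFourPointFunction η κ (expD η f) := by
  have hs := hm.sum
  rw [Fin.sum_univ_four, hm.h0, hm.h1, hm.h2, hm.h3] at hs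
  have h := (isChiral_expSum hf).mul_powers .zero hm (p := -(η 2 - η 1)) (q := -η 3) (r := -η 1)
    (by simp only [Pi.zero_apply]; linarith) (by simp) (by simp) (by simp)
  refine h.congr (funext fun x => ?_)
  have he : prefactor η x ∈ evenPart := mul_mem (mul_mem (spow_even (sq_even _ _ _) _)
    (spow_even (sq_even _ _ _) _)) (spow_even (sq_even _ _ _) _)
  exact ((even_commute he _).eq).symm

end
end
end ChiralFourPoint

namespace ChiralFourPoint
noncomputable section

/-! ### A chiral four-point function is determined by its body -/

/-- A subspace is the kernel of a linear projection, and such maps commute with space-time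
derivatives. -/
lemma dx_mem_filt {n : ℕ} {G : SuperFun} {x : Configuration} (hx : x ∈ spacelike)
    (hG : DifferentiableAt ℝ G x) (h : ∀ y ∈ spacelike, G y ∈ filt n) (i μ : Fin 4) :
    dx i μ G x ∈ filt n := by
  obtain ⟨q, hq⟩ := Submodule.exists_isCompl (filt n)
  set φ : Grassmann →ₗ[ℂ] Grassmann := q.subtype ∘ₗ Submodule.projectionOnto q (filt n) hq.symm
    with hφ
  have hker : ∀ z, φ z = 0 ↔ z ∈ filt n := fun z => by
    rw [hφ, LinearMap.comp_apply, Submodule.subtype_apply, Submodule.coe_eq_zero,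
      Submodule.projectionOnto_apply_eq_zero_iff]
  rw [← hker, ← dx_linear φ i μ hG]
  have : ∀ᶠ y in nhds x, φ (G y) = 0 :=
    Filter.eventually_of_mem (isOpen_spacelike.mem_nhds hx) fun y hy => (hker _).2 (h y hy)
  rw [dx_congr (H := fun _ => 0) i μ this]
  simp [dx_const]

lemma mem_of_sum_smul_mem {p : Submodule ℂ Grassmann} {M : Matrix (Fin 2) (Fin 2) ℂ}
    (hM : M.det ≠ 0) {v : Fin 2 → Grassmann} (h : ∀ β, ∑ a, M β a • v a ∈ p) (a : Fin 2) :
    v a ∈ p := by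
  rw [Matrix.det_fin_two] at hM
  have h0 := h 0
  have h1 := h 1
  rw [Fin.sum_univ_two] at h0 h1
  rw [← p.smul_mem_iff hM]
  fin_cases a
  · convert sub_mem (p.smul_mem (M 1 1) h0) (p.smul_mem (M 0 1) h1) using 1
    simp only [Fin.zero_eta]
    module
  · convert sub_mem (p.smul_mem (M 0 0) h1) (p.smul_mem (M 1 0) h0) using 1
    simp only [Fin.mk_one]
    module

/-- The matrix of the coordinates of a point, with upper indices. -/
def xTildeMat (i : Fin 4) (x : Configuration) : Matrix (Fin 2) (Fin 2) ℂ := Matrix.of (xTilde i x)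

lemma det_xTildeMat_sub (i j : Fin 4) (x : Configuration) :
    (xTildeMat i x - xTildeMat j x).det = body (sq i j x) := by
  rw [body_sq, Matrix.det_fin_two]
  simp [xTildeMat, xTilde, sigmaTildeLower, pauli, Fin.sum_univ_four]
  linear_combination (((x i 2 : ℂ) - x j 2) ^ 2) * Complex.I_sq

lemma det_xTildeMat_sub_ne {i j : Fin 4} (h : i ≠ j) {x : Configuration} (hx : x ∈ spacelike) :
    (xTildeMat i x - xTildeMat j x).det ≠ 0 := by
  rw [det_xTildeMat_sub]
  exact (unitFun_sq h).ne x hx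

section
variable {G : SuperFun} {x : Configuration}

lemma θ_mem_filt (i : Fin 4) (α : Fin 2) : θ i α ∈ filt 1 := vec_mem_filt _

lemma θbar_mem_filt (i : Fin 4) (α : Fin 2) : θbar i α ∈ filt 1 := vec_mem_filt _

lemma σθbar_mem_filt (μ i : Fin 4) (α : Fin 2) : σθbar μ i α ∈ filt 1 :=
  sum_mem fun _ _ => Submodule.smul_mem _ _ (θbar_mem_filt _ _)

lemma θσ_mem_filt (μ i : Fin 4) (α : Fin 2) : θσ μ i α ∈ filt 1 :=
  sum_mem fun _ _ => Submodule.smul_mem _ _ (θ_mem_filt _ _)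

lemma mul_mem_filt_succ {n : ℕ} {a b : Grassmann} (ha : a ∈ filt 1) (hb : b ∈ filt n) :
    a * b ∈ filt (n + 1) := by
  rw [add_comm]
  exact mul_mem_filt ha hb

lemma mul_mul_dgen_mem_filt {n : ℕ} {a b c : Grassmann} (ha : a ∈ filt 1) (hb : b ∈ filt 1)
    (hc : c ∈ filt n) (k : OddIndex) : a * b * dgen k c ∈ filt (n + 1) := by
  have hab : a * b ∈ filt 2 := mul_mem_filt (m := 1) (n := 1) ha hb
  cases n with
  | zero => exact filt_anti (by norm_num) (mul_mem_filt_left hab)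
  | succ m =>
    have := mul_mem_filt hab (dgen_mem_filt k hc)
    exact filt_anti (by omega) this

/-- In each identity the terms other than the odd derivatives with numerical coefficients have
degree at least n + 1. Modulo these the identities form a linear system for the sixteen odd
derivatives, and it is non-degenerate when the points are space-like separated. -/
lemma IsChiralFourPointFunction.dgen_mem_filt {η κ : Fin 4 → ℝ}
    (hG : IsChiralFourPointFunction η κ G) {n : ℕ} (h : ∀ y ∈ spacelike, G y ∈ filt n)
    (hx : x ∈ spacelike) (k : OddIndex) : dgen k (G x) ∈ filt (n + 1) := by
  have hd := dx_mem_filt hx (hG.analytic x hx).differentiableAt h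
  have hs : ∀ (c : ℂ) (z : Fin 4 → Grassmann) (i : Fin 4), (∀ μ, z μ ∈ filt 1) →
      c • ∑ μ, z μ * dx i μ G x ∈ filt (n + 1) := fun c z i hz =>
    Submodule.smul_mem _ _ (sum_mem fun μ _ => mul_mem_filt_succ (hz μ) (hd i μ))
  have hD : ∀ i, (∀ α, D i α G x = 0) → ∀ α, dθ i α (G x) ∈ filt (n + 1) := fun i hi α => by
    have h1 : dθ i α (G x) - Complex.I • ∑ μ : Fin 4, σθbar μ i α * dx i μ G x = 0 := hi α
    rw [sub_eq_zero.1 h1]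
    exact hs _ _ _ fun μ => σθbar_mem_filt _ _ _
  have hDbar : ∀ i, (∀ α, Dbar i α G x = 0) → ∀ α, dθbar i α (G x) ∈ filt (n + 1) := fun i hi α => by
    have h1 : -dθbar i α (G x) + Complex.I • ∑ μ : Fin 4, θσ μ i α * dx i μ G x = 0 := hi α
    rw [neg_add_eq_zero.1 h1]
    exact hs _ _ _ fun μ => θσ_mem_filt _ _ _
  have d0 := hD 0 fun α => hG.D_one α x hx
  have d1 := hD 1 fun α => hG.D_two α x hx
  have b2 := hDbar 2 fun α => hG.Dbar_three α x hx
  have b3 := hDbar 3 fun α => hG.Dbar_four α x hx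
  have q : ∀ α, ∑ i, dθ i α (G x) ∈ filt (n + 1) := fun α => by
    have h1 := hG.Q_eq α x hx
    rw [Q, Finset.sum_add_distrib] at h1
    rw [eq_neg_of_add_eq_zero_left h1]
    exact neg_mem (sum_mem fun i _ => hs _ _ _ fun μ => σθbar_mem_filt _ _ _)
  have qb : ∀ α, ∑ i, dθbar i α (G x) ∈ filt (n + 1) := fun α => by
    have h1 := hG.Qbar_eq α x hx
    rw [Qbar, Finset.sum_add_distrib] at h1
    rw [eq_neg_of_add_eq_zero_left h1]
    exact neg_mem (sum_mem fun i _ => hs _ _ _ fun μ => θσ_mem_filt _ _ _)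
  have s : ∀ β, ∑ i, ∑ c, xTilde i x c β • dθbar i c (G x) ∈ filt (n + 1) := fun β => by
    have h1 := hG.S_eq β x hx
    simp only [S, xMinusTilde_eq, add_mul, ← Algebra.smul_def, smul_mul_assoc,
      Finset.sum_add_distrib, Finset.sum_sub_distrib, dθ_eq_dgen, dθbar_eq_dgen] at h1
    have h2 : ∑ i, ∑ c, (2 * Complex.I) • (θ i β * θbar i c * dgen (Sum.inr (i, c)) (G x)) ∈
        filt (n + 1) := sum_mem fun i _ => sum_mem fun c _ => Submodule.smul_mem _ _
      (mul_mul_dgen_mem_filt (θ_mem_filt _ _) (θbar_mem_filt _ _) (h x hx) _)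
    have h3 : ∑ i, (4 * Complex.I) • ∑ c, θ i β * θ i c * dgen (Sum.inl (i, c)) (G x) ∈
        filt (n + 1) := sum_mem fun i _ => Submodule.smul_mem _ _ (sum_mem fun c _ =>
      mul_mul_dgen_mem_filt (θ_mem_filt _ _) (θ_mem_filt _ _) (h x hx) _)
    have h4 : ∑ i, Complex.I • ∑ μ, (∑ c, θσ μ i c * xPlusTilde i x c β) * dx i μ G x ∈
        filt (n + 1) := sum_mem fun i _ => hs _ _ _ fun μ => sum_mem fun c _ =>
      mul_mem_filt_left (θσ_mem_filt _ _ _)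
    have h5 : ∑ i, (2 * Complex.I * ((η i - 3 * κ i : ℝ) : ℂ)) • (θ i β * G x) ∈ filt (n + 1) :=
      sum_mem fun i _ => Submodule.smul_mem _ _ (mul_mem_filt_succ (θ_mem_filt _ _) (h x hx))
    convert neg_mem (sub_mem (add_mem (add_mem h2 h4) h5) h3) using 1
    simp only [dθbar_eq_dgen]
    rw [eq_neg_iff_add_eq_zero, ← h1]
    abel
  have sb : ∀ β, ∑ i, ∑ c, xTilde i x β c • dθ i c (G x) ∈ filt (n + 1) := fun β => by
    have h1 := hG.Sbar_eq β x hx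
    simp only [Sbar, xPlusTilde_eq, sub_mul, ← Algebra.smul_def, smul_mul_assoc,
      Finset.sum_add_distrib, Finset.sum_sub_distrib, dθ_eq_dgen, dθbar_eq_dgen] at h1
    have h2 : ∑ i, ∑ c, (2 * Complex.I) • (θ i c * θbar i β * dgen (Sum.inl (i, c)) (G x)) ∈
        filt (n + 1) := sum_mem fun i _ => sum_mem fun c _ => Submodule.smul_mem _ _
      (mul_mul_dgen_mem_filt (θ_mem_filt _ _) (θbar_mem_filt _ _) (h x hx) _)
    have h3 : ∑ i, (4 * Complex.I) • ∑ c, θbar i c * θbar i β * dgen (Sum.inr (i, c)) (G x) ∈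
        filt (n + 1) := sum_mem fun i _ => Submodule.smul_mem _ _ (sum_mem fun c _ =>
      mul_mul_dgen_mem_filt (θbar_mem_filt _ _) (θbar_mem_filt _ _) (h x hx) _)
    have h4 : ∑ i, Complex.I • ∑ μ, (∑ c, xMinusTilde i x β c * σθbar μ i c) * dx i μ G x ∈
        filt (n + 1) := sum_mem fun i _ => hs _ _ _ fun μ => sum_mem fun c _ =>
      mul_mem_filt_right (σθbar_mem_filt _ _ _)
    have h5 : ∑ i, (2 * Complex.I * ((η i + 3 * κ i : ℝ) : ℂ)) • (θbar i β * G x) ∈ filt (n + 1) :=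
      sum_mem fun i _ => Submodule.smul_mem _ _ (mul_mem_filt_succ (θbar_mem_filt _ _) (h x hx))
    convert neg_mem (sub_mem (add_mem (add_mem h3 h4) h5) h2) using 1
    simp only [dθ_eq_dgen]
    rw [eq_neg_iff_add_eq_zero, ← h1]
    abel
  -- Subtracting x̃₂ times Q̄ from S removes point 2, and points 3 and 4 are known from chirality.
  -- The remaining matrix x̃₁ - x̃₂ is invertible, its determinant being the square of a space-like
  -- interval.
  have b0 : ∀ c, dθbar 0 c (G x) ∈ filt (n + 1) := by
    refine mem_of_sum_smul_mem (M := (xTildeMat 0 x - xTildeMat 1 x).transpose)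
      (by rw [Matrix.det_transpose]; exact det_xTildeMat_sub_ne (by decide) hx) fun β => ?_
    have h1 : ∑ c, xTilde 1 x c β • ∑ i, dθbar i c (G x) ∈ filt (n + 1) :=
      sum_mem fun c _ => Submodule.smul_mem _ _ (qb c)
    have h2 : ∑ c, ((xTilde 2 x c β - xTilde 1 x c β) • dθbar 2 c (G x) +
        (xTilde 3 x c β - xTilde 1 x c β) • dθbar 3 c (G x)) ∈ filt (n + 1) :=
      sum_mem fun c _ => add_mem (Submodule.smul_mem _ _ (b2 c)) (Submodule.smul_mem _ _ (b3 c))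
    convert sub_mem (sub_mem (s β) h1) h2 using 1
    simp only [Fin.sum_univ_four, Fin.sum_univ_two, Matrix.transpose_apply, Matrix.sub_apply,
      xTildeMat, Matrix.of_apply]
    module
  have b1 : ∀ c, dθbar 1 c (G x) ∈ filt (n + 1) := fun c => by
    convert sub_mem (sub_mem (sub_mem (qb c) (b0 c)) (b2 c)) (b3 c) using 1
    rw [Fin.sum_univ_four]
    abel
  -- The same with S̄, Q and the points 3, 4 in place of S, Q̄ and 1, 2.
  have d2 : ∀ c, dθ 2 c (G x) ∈ filt (n + 1) := by
    refine mem_of_sum_smul_mem (M := xTildeMat 2 x - xTildeMat 3 x)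
      (det_xTildeMat_sub_ne (by decide) hx) fun β => ?_
    have h1 : ∑ c, xTilde 3 x β c • ∑ i, dθ i c (G x) ∈ filt (n + 1) :=
      sum_mem fun c _ => Submodule.smul_mem _ _ (q c)
    have h2 : ∑ c, ((xTilde 0 x β c - xTilde 3 x β c) • dθ 0 c (G x) +
        (xTilde 1 x β c - xTilde 3 x β c) • dθ 1 c (G x)) ∈ filt (n + 1) :=
      sum_mem fun c _ => add_mem (Submodule.smul_mem _ _ (d0 c)) (Submodule.smul_mem _ _ (d1 c))
    convert sub_mem (sub_mem (sb β) h1) h2 using 1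
    simp only [Fin.sum_univ_four, Fin.sum_univ_two, Matrix.sub_apply, xTildeMat, Matrix.of_apply]
    module
  have d3 : ∀ c, dθ 3 c (G x) ∈ filt (n + 1) := fun c => by
    convert sub_mem (sub_mem (sub_mem (q c) (d0 c)) (d1 c)) (d2 c) using 1
    rw [Fin.sum_univ_four]
    abel
  obtain ⟨i, c⟩ | ⟨i, c⟩ := k
  · fin_cases i
    exacts [d0 c, d1 c, d2 c, d3 c]
  · fin_cases i
    exacts [b0 c, b1 c, b2 c, b3 c]

/-- Starting from degree one, `dgen_mem_filt` and the Euler argument `mem_filt_succ_of_dgen` raise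
the degree step by step until it exceeds sixteen. -/
theorem IsChiralFourPointFunction.eq_zero {η κ : Fin 4 → ℝ}
    (hG : IsChiralFourPointFunction η κ G) (h : ∀ y ∈ spacelike, body (G y) = 0)
    (hx : x ∈ spacelike) : G x = 0 := by
  have key : ∀ n, ∀ y ∈ spacelike, G y ∈ filt (n + 1) := by
    intro n
    induction n with
    | zero => exact fun y hy => mem_filt_one_of_body (h y hy)
    | succ n ih =>
      exact fun y hy => mem_filt_succ_of_dgen (Nat.succ_ne_zero n) (ih y hy) fun k =>
        filt_anti (Nat.le_succ _) (hG.dgen_mem_filt ih hy k)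
  exact eq_zero_of_mem_filt (by norm_num) (key 16 x hx)

end

end
end ChiralFourPoint

namespace ChiralFourPoint
noncomputable section

/-! ### The equations at second order in the odd coordinates -/

/-- The body of a derivative. -/
def bodyD (k : OddIndex) : Grassmann →ₗ[ℂ] ℂ := body.toLinearMap ∘ₗ dgen k

lemma bodyD_apply (k : OddIndex) (z : Grassmann) : bodyD k z = body (dgen k z) := rfl

lemma bodyD_vec_mul (k : OddIndex) (v : OddIndex → ℂ) (z : Grassmann) :
    bodyD k (vec v * z) = v k * body z := by
  rw [bodyD_apply, dgen_vec_mul, map_sub, map_mul body, body_vec, zero_mul, sub_zero, map_smul,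
    smul_eq_mul]

lemma bodyD_θ_mul (k : OddIndex) (i : Fin 4) (α : Fin 2) (z : Grassmann) :
    bodyD k (θ i α * z) = if k = Sum.inl (i, α) then body z else 0 := by
  have := bodyD_vec_mul k (Pi.single (Sum.inl (i, α)) 1) z
  rw [Pi.single_apply, ite_mul, one_mul, zero_mul] at this
  exact this

lemma bodyD_θbar_mul (k : OddIndex) (i : Fin 4) (α : Fin 2) (z : Grassmann) :
    bodyD k (θbar i α * z) = if k = Sum.inr (i, α) then body z else 0 := by
  have := bodyD_vec_mul k (Pi.single (Sum.inr (i, α)) 1) z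
  rw [Pi.single_apply, ite_mul, one_mul, zero_mul] at this
  exact this

lemma body_θ (i : Fin 4) (α : Fin 2) : body (θ i α) = 0 := body_vec _

lemma body_θbar (i : Fin 4) (α : Fin 2) : body (θbar i α) = 0 := body_vec _

/-- The matrix of the bodies of the mixed second odd derivatives. -/
def oddHess (G : SuperFun) (j i : Fin 4) (x : Configuration) : Matrix (Fin 2) (Fin 2) ℂ :=
  Matrix.of fun α β => bodyD (Sum.inr (j, β)) (dθ i α (G x))

/-- The matrix of the bodies of the space-time derivatives. -/
def bodyGrad (G : SuperFun) (i : Fin 4) (x : Configuration) : Matrix (Fin 2) (Fin 2) ℂ :=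
  ∑ μ, body (dx i μ G x) • pauli μ

lemma bodyGrad_apply (G : SuperFun) (i : Fin 4) (x : Configuration) (α β : Fin 2) :
    bodyGrad G i x α β = ∑ μ, pauli μ α β * body (dx i μ G x) := by
  simp [bodyGrad, Matrix.sum_apply, mul_comm]

lemma body_dx_eq_zero {G : SuperFun} {i : Fin 4} {x : Configuration} (h : bodyGrad G i x = 0)
    (μ : Fin 4) : body (dx i μ G x) = 0 := by
  have h00 := congrFun (congrFun h 0) 0
  have h01 := congrFun (congrFun h 0) 1
  have h10 := congrFun (congrFun h 1) 0
  have h11 := congrFun (congrFun h 1) 1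
  simp only [bodyGrad_apply, Fin.sum_univ_four, pauli, Matrix.zero_apply, Matrix.of_apply,
    Matrix.cons_val', Matrix.cons_val_zero, Matrix.cons_val_one, Matrix.cons_val_fin_one,
    Matrix.cons_val] at h00 h01 h10 h11
  fin_cases μ <;> simp only [Fin.zero_eta, Fin.mk_one, Fin.reduceFinMk]
  · linear_combination (1 / 2) * h00 + (1 / 2) * h11
  · linear_combination (1 / 2) * h01 + (1 / 2) * h10
  · linear_combination (Complex.I / 2) * h01 - (Complex.I / 2) * h10 +
      body (dx i 2 G x) * Complex.I_sq
  · linear_combination (1 / 2) * h00 - (1 / 2) * h11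

lemma bodyD_dθbar (G : SuperFun) (j i : Fin 4) (x : Configuration) (α β : Fin 2) :
    bodyD (Sum.inl (i, α)) (dθbar j β (G x)) = -oddHess G j i x α β := by
  rw [oddHess, Matrix.of_apply, bodyD_apply, bodyD_apply, dθ_eq_dgen, dθbar_eq_dgen, dgen_comm,
    map_neg]

lemma bodyD_σθbar_mul (k : OddIndex) (μ i : Fin 4) (α : Fin 2) (z : Grassmann) :
    bodyD k (σθbar μ i α * z) = ∑ β, if k = Sum.inr (i, β) then pauli μ α β * body z else 0 := by
  simp only [σθbar, Finset.sum_mul, smul_mul_assoc, map_sum, map_smul, bodyD_θbar_mul, smul_eq_mul,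
    mul_ite, mul_zero]

lemma bodyD_θσ_mul (k : OddIndex) (μ i : Fin 4) (β : Fin 2) (z : Grassmann) :
    bodyD k (θσ μ i β * z) = ∑ α, if k = Sum.inl (i, α) then pauli μ α β * body z else 0 := by
  simp only [θσ, Finset.sum_mul, smul_mul_assoc, map_sum, map_smul, bodyD_θ_mul, smul_eq_mul,
    mul_ite, mul_zero]

section
variable {G : SuperFun} {x : Configuration} {η κ : Fin 4 → ℝ}

lemma oddHess_of_D {i : Fin 4} (h : ∀ α, D i α G x = 0) (j : Fin 4) :
    oddHess G j i x = if j = i then Complex.I • bodyGrad G i x else 0 := by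
  ext α β
  have h1 : dθ i α (G x) - Complex.I • ∑ μ : Fin 4, σθbar μ i α * dx i μ G x = 0 := h α
  rw [oddHess, Matrix.of_apply, sub_eq_zero.1 h1]
  simp only [map_smul, map_sum, bodyD_σθbar_mul, Sum.inr.injEq, Prod.mk.injEq]
  split_ifs with hj
  · simp [hj, bodyGrad_apply]
  · simp [hj]

lemma oddHess_of_Dbar {j : Fin 4} (h : ∀ α, Dbar j α G x = 0) (i : Fin 4) :
    oddHess G j i x = if i = j then -(Complex.I • bodyGrad G j x) else 0 := by
  ext α β
  have h1 : -dθbar j β (G x) + Complex.I • ∑ μ : Fin 4, θσ μ j β * dx j μ G x = 0 := h β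
  rw [← neg_neg (oddHess G j i x α β), ← bodyD_dθbar, neg_add_eq_zero.1 h1]
  simp only [map_smul, map_sum, bodyD_θσ_mul, Sum.inl.injEq, Prod.mk.injEq]
  split_ifs with hj
  · simp [hj, bodyGrad_apply]
  · simp [hj]

lemma oddHess_of_Qbar (h : ∀ α, Qbar α G x = 0) (i : Fin 4) :
    ∑ j, oddHess G j i x = Complex.I • bodyGrad G i x := by
  ext α β
  have h1 := congrArg (bodyD (Sum.inl (i, α))) (h β)
  simp only [Qbar, map_sum, map_add, map_smul, bodyD_θσ_mul, Sum.inl.injEq, Prod.mk.injEq,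
    bodyD_dθbar, map_zero, Finset.sum_add_distrib, Finset.sum_neg_distrib] at h1
  rw [neg_add_eq_zero] at h1
  rw [Matrix.sum_apply, h1, Finset.sum_eq_single i (by intro j _ hj; simp [hj.symm]) (by simp)]
  simp [bodyGrad_apply]

lemma oddHess_of_Q (h : ∀ α, Q α G x = 0) (j : Fin 4) :
    ∑ i, oddHess G j i x = -(Complex.I • bodyGrad G j x) := by
  ext α β
  have h1 := congrArg (bodyD (Sum.inr (j, β))) (h α)
  simp only [Q, map_sum, map_add, map_smul, bodyD_σθbar_mul, Sum.inr.injEq, Prod.mk.injEq,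
    map_zero, Finset.sum_add_distrib] at h1
  rw [add_eq_zero_iff_eq_neg] at h1
  rw [Matrix.sum_apply]
  refine Eq.trans (Finset.sum_congr rfl fun i _ => rfl) (h1.trans ?_)
  rw [Finset.sum_eq_single j (by intro j _ hj; simp [hj.symm]) (by simp)]
  simp [bodyGrad_apply]

lemma sum_ite_and_eq (c : ℂ) (i : Fin 4) (α : Fin 2) (F : Fin 4 → Fin 4 → Fin 2 → Fin 2 → ℂ) :
    ∑ j, c * ∑ μ, ∑ γ, ∑ δ, (if i = j ∧ α = δ then F j μ γ δ else 0) =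
      c * ∑ μ, ∑ γ, F i μ γ α := by
  rw [Finset.sum_eq_single i (by intro j _ hj; simp [hj.symm]) (by simp)]
  simp

lemma sum_weight_eq (c : Fin 4 → ℝ) (i : Fin 4) (p : Prop) [Decidable p] (z : ℂ) :
    ∑ j, 2 * (Complex.I * ((c j : ℂ) * if i = j ∧ p then z else 0)) =
      2 * Complex.I * (c i : ℂ) * z * if p then 1 else 0 := by
  rw [Finset.sum_eq_single i (by intro j _ hj; simp [hj.symm]) (by simp)]
  by_cases hp : p <;> simp [hp]
  ring

lemma oddHess_of_S (h : ∀ α, S η κ α G x = 0) (i : Fin 4) :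
    ∑ j, oddHess G j i x * xTildeMat j x = Complex.I • (bodyGrad G i x * xTildeMat i x) +
      (2 * Complex.I * ((η i - 3 * κ i : ℝ) : ℂ) * body (G x)) • (1 : Matrix (Fin 2) (Fin 2) ℂ) := by
  ext α β
  have h1 := congrArg (bodyD (Sum.inl (i, α))) (h β)
  have hb : ∀ j c d, body (xPlusTilde j x c d) = xTilde j x c d := fun j c d => by
    rw [xPlusTilde_eq, map_sub, map_smul, map_mul, body_θ, zero_mul, smul_zero, sub_zero,
      body_algebraMap]
  simp only [S, xMinusTilde_eq, add_mul, ← Algebra.smul_def, smul_mul_assoc, mul_assoc,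
    Finset.sum_mul, map_sum, map_add, map_sub, map_smul, bodyD_dθbar, bodyD_θ_mul, bodyD_θσ_mul,
    map_mul body, body_θ, body_θbar, zero_mul, hb, map_zero, Sum.inl.injEq, Prod.mk.injEq, ite_self,
    smul_eq_mul, mul_zero, Finset.sum_const_zero, add_zero, sub_zero, mul_neg,
    Finset.sum_add_distrib, Finset.sum_neg_distrib] at h1
  rw [sum_ite_and_eq Complex.I i α fun j μ γ δ => pauli μ δ γ * (xTilde j x γ β *
    body (dx j μ G x)), sum_weight_eq fun i => η i - 3 * κ i] at h1
  simp only [Matrix.sum_apply, Matrix.add_apply, Matrix.smul_apply, Matrix.mul_apply, xTildeMat,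
    Matrix.of_apply, bodyGrad_apply, smul_eq_mul, Matrix.one_apply, Finset.sum_mul]
  rw [Finset.sum_comm (s := (Finset.univ : Finset (Fin 2)))]
  simp only [mul_comm (xTilde _ _ _ _), mul_assoc] at h1 ⊢
  linear_combination -h1

lemma oddHess_of_Sbar (h : ∀ α, Sbar η κ α G x = 0) (j : Fin 4) :
    ∑ i, xTildeMat i x * oddHess G j i x = -(Complex.I • (xTildeMat j x * bodyGrad G j x)) -
      (2 * Complex.I * ((η j + 3 * κ j : ℝ) : ℂ) * body (G x)) • (1 : Matrix (Fin 2) (Fin 2) ℂ) := by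
  ext β γ
  have h1 := congrArg (bodyD (Sum.inr (j, γ))) (h β)
  have hx : ∀ i c d z, xMinusTilde i x c d * z = z * xMinusTilde i x c d := fun i c d z => by
    rw [xMinusTilde_eq, add_mul, mul_add, Algebra.commutes, smul_mul_assoc, θ_mul_θbar_comm,
      mul_smul_comm]
  have hb : ∀ j c d, body (xMinusTilde j x c d) = xTilde j x c d := fun j c d => by
    rw [xMinusTilde_eq, map_add, map_smul, map_mul, body_θ, zero_mul, smul_zero, add_zero,
      body_algebraMap]
  simp only [Sbar, xPlusTilde_eq, sub_mul, ← Algebra.smul_def, smul_mul_assoc, mul_assoc,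
    Finset.sum_mul, map_sum, map_add, map_sub, map_smul, bodyD_θ_mul, hx, bodyD_σθbar_mul,
    bodyD_θbar_mul,
    map_mul body, body_θbar, zero_mul, hb, map_zero, Sum.inr.injEq, Prod.mk.injEq, ite_self,
    smul_eq_mul, mul_zero, Finset.sum_const_zero, add_zero, sub_zero,
    Finset.sum_add_distrib] at h1
  rw [sum_ite_and_eq Complex.I j γ fun j μ c d => pauli μ c d * (body (dx j μ G x) *
    xTilde j x β c), sum_weight_eq fun i => η i + 3 * κ i] at h1
  simp only [Matrix.sum_apply, Matrix.sub_apply, Matrix.neg_apply, Matrix.smul_apply,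
    Matrix.mul_apply, xTildeMat, Matrix.of_apply, bodyGrad_apply, smul_eq_mul, Matrix.one_apply,
    Finset.mul_sum, oddHess, eq_comm (a := β)]
  rw [Finset.sum_comm (s := (Finset.univ : Finset (Fin 2)))]
  simp only [Finset.mul_sum, mul_comm (xTilde _ _ _ _), mul_assoc] at h1 ⊢
  linear_combination h1

lemma smul_one_eq_zero {c : ℂ} (h : c • (1 : Matrix (Fin 2) (Fin 2) ℂ) = 0) : c = 0 := by
  simpa using congrFun (congrFun h 0) 0

/-- At an anti-chiral point only the diagonal block of odd second derivatives survives in the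
identity for S, and it equals the gradient term on the other side. What is left is (η - 3κ) times
the body. At a chiral point the same happens with S̄. -/
theorem IsChiralFourPointFunction.matched (hG : IsChiralFourPointFunction η κ G)
    (hκ : ∑ i, κ i = 0) (hx : x ∈ spacelike) (h : body (G x) ≠ 0) : Matched η κ := by
  have hw : ∀ {w : ℝ}, 2 * Complex.I * (w : ℂ) * body (G x) = 0 → w = 0 := fun {w} hw => by
    simpa [h] using hw
  have hS : ∀ i, (∀ α, D i α G x = 0) → η i - 3 * κ i = 0 := fun i hi => by
    have h1 := oddHess_of_S (fun α => hG.S_eq α x hx) i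
    have h2 : ∀ j, j ≠ i → oddHess G j i x * xTildeMat j x = 0 := fun j hj => by
      rw [oddHess_of_D hi, if_neg hj, zero_mul]
    rw [Finset.sum_eq_single i (fun j _ hj => h2 j hj) (by simp), oddHess_of_D hi, if_pos rfl,
      smul_mul_assoc, left_eq_add] at h1
    exact hw (smul_one_eq_zero h1)
  have hSbar : ∀ i, (∀ α, Dbar i α G x = 0) → η i + 3 * κ i = 0 := fun i hi => by
    have h1 := oddHess_of_Sbar (fun α => hG.Sbar_eq α x hx) i
    have h2 : ∀ j, j ≠ i → xTildeMat j x * oddHess G i j x = 0 := fun j hj => by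
      rw [oddHess_of_Dbar hi, if_neg hj, mul_zero]
    rw [Finset.sum_eq_single i (fun j _ hj => h2 j hj) (by simp), oddHess_of_Dbar hi, if_pos rfl,
      mul_neg, mul_smul_comm, eq_comm, sub_eq_self] at h1
    exact hw (smul_one_eq_zero h1)
  have e0 := hS 0 fun α => hG.D_one α x hx
  have e1 := hS 1 fun α => hG.D_two α x hx
  have e2 := hSbar 2 fun α => hG.Dbar_three α x hx
  have e3 := hSbar 3 fun α => hG.Dbar_four α x hx
  exact ⟨by linarith, by linarith, by linarith, by linarith, hκ⟩

/-- The coordinate matrix of the difference of two points. -/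
def diffMat (i j : Fin 4) (x : Configuration) : Matrix (Fin 2) (Fin 2) ℂ :=
  xTildeMat i x - xTildeMat j x

lemma det_diffMat_ne {i j : Fin 4} (h : i ≠ j) (hx : x ∈ spacelike) : (diffMat i j x).det ≠ 0 :=
  det_xTildeMat_sub_ne h hx

/-- The relations between the second odd derivatives of an invariant four-point function. -/
structure HessRelations (G : SuperFun) (x : Configuration) : Prop where
  r2 : oddHess G 0 2 x * diffMat 2 0 x + oddHess G 1 2 x * diffMat 2 1 x = 0
  r3 : oddHess G 0 3 x * diffMat 3 0 x + oddHess G 1 3 x * diffMat 3 1 x = 0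
  l0 : diffMat 2 0 x * oddHess G 0 2 x + diffMat 3 0 x * oddHess G 0 3 x = 0
  l1 : diffMat 2 1 x * oddHess G 1 2 x + diffMat 3 1 x * oddHess G 1 3 x = 0
  g0 : (2 * Complex.I) • bodyGrad G 0 x = -(oddHess G 0 2 x + oddHess G 0 3 x)
  g1 : (2 * Complex.I) • bodyGrad G 1 x = -(oddHess G 1 2 x + oddHess G 1 3 x)
  g2 : (2 * Complex.I) • bodyGrad G 2 x = oddHess G 0 2 x + oddHess G 1 2 x
  g3 : (2 * Complex.I) • bodyGrad G 3 x = oddHess G 0 3 x + oddHess G 1 3 x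

/-- Chirality makes the diagonal blocks multiples of the gradients and leaves four mixed blocks,
with θ̄ at points 1, 2 and θ at 3, 4. The Q and Q̄ identities express the gradients through these;
inserting this into S and S̄ removes the gradients. -/
lemma IsChiralFourPointFunction.hessRelations (hG : IsChiralFourPointFunction 0 0 G)
    (hx : x ∈ spacelike) : HessRelations G x := by
  have d0 := oddHess_of_D fun α => hG.D_one α x hx
  have d1 := oddHess_of_D fun α => hG.D_two α x hx
  have b2 := oddHess_of_Dbar fun α => hG.Dbar_three α x hx
  have b3 := oddHess_of_Dbar fun α => hG.Dbar_four α x hx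
  have qb := oddHess_of_Qbar fun α => hG.Qbar_eq α x hx
  have q := oddHess_of_Q fun α => hG.Q_eq α x hx
  have s := oddHess_of_S fun α => hG.S_eq α x hx
  have sb := oddHess_of_Sbar fun α => hG.Sbar_eq α x hx
  have g0 : (2 * Complex.I) • bodyGrad G 0 x = -(oddHess G 0 2 x + oddHess G 0 3 x) := by
    have := q 0
    rw [Fin.sum_univ_four, d0, d1, if_pos rfl, if_neg (by decide), add_zero] at this
    rw [← sub_eq_zero, ← sub_eq_zero.2 this]
    module
  have g1 : (2 * Complex.I) • bodyGrad G 1 x = -(oddHess G 1 2 x + oddHess G 1 3 x) := by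
    have := q 1
    rw [Fin.sum_univ_four, d0, d1, if_pos rfl, if_neg (by decide), zero_add] at this
    rw [← sub_eq_zero, ← sub_eq_zero.2 this]
    module
  have g2 : (2 * Complex.I) • bodyGrad G 2 x = oddHess G 0 2 x + oddHess G 1 2 x := by
    have := qb 2
    rw [Fin.sum_univ_four, b2, b3, if_pos rfl, if_neg (by decide), add_zero] at this
    rw [← sub_eq_zero, ← neg_eq_zero, ← sub_eq_zero.2 this]
    module
  have g3 : (2 * Complex.I) • bodyGrad G 3 x = oddHess G 0 3 x + oddHess G 1 3 x := by
    have := qb 3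
    rw [Fin.sum_univ_four, b2, b3, if_pos rfl, if_neg (by decide), add_zero] at this
    rw [← sub_eq_zero, ← neg_eq_zero, ← sub_eq_zero.2 this]
    module
  refine ⟨?_, ?_, ?_, ?_, g0, g1, g2, g3⟩
  · have h := s 2
    have h2 := congrArg (· * xTildeMat 2 x) g2
    simp only [add_mul, smul_mul_assoc] at h2
    rw [Fin.sum_univ_four, b2, b3, if_pos rfl, if_neg (by decide)] at h
    simp only [Pi.zero_apply, mul_zero, sub_zero, Complex.ofReal_zero, zero_mul, zero_smul,
      add_zero, neg_mul, smul_mul_assoc] at h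
    simp only [diffMat, mul_sub]
    linear_combination (norm := module) -h - h2
  · have h := s 3
    have h2 := congrArg (· * xTildeMat 3 x) g3
    simp only [add_mul, smul_mul_assoc] at h2
    rw [Fin.sum_univ_four, b2, b3, if_pos rfl, if_neg (by decide)] at h
    simp only [Pi.zero_apply, mul_zero, sub_zero, Complex.ofReal_zero, zero_mul, zero_smul,
      add_zero, neg_mul, smul_mul_assoc] at h
    simp only [diffMat, mul_sub]
    linear_combination (norm := module) -h - h2
  · have h := sb 0
    have h2 := congrArg (xTildeMat 0 x * ·) g0
    simp only [mul_add, mul_smul_comm, mul_neg] at h2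
    rw [Fin.sum_univ_four, d0, d1, if_pos rfl, if_neg (by decide)] at h
    simp only [Pi.zero_apply, mul_zero, add_zero, Complex.ofReal_zero, zero_mul, zero_smul,
      sub_zero, mul_smul_comm] at h
    simp only [diffMat, sub_mul]
    linear_combination (norm := module) h - h2
  · have h := sb 1
    have h2 := congrArg (xTildeMat 1 x * ·) g1
    simp only [mul_add, mul_smul_comm, mul_neg] at h2
    rw [Fin.sum_univ_four, d0, d1, if_pos rfl, if_neg (by decide)] at h
    simp only [Pi.zero_apply, mul_zero, add_zero, Complex.ofReal_zero, zero_mul, zero_smul,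
      sub_zero, mul_smul_comm] at h
    simp only [diffMat, sub_mul]
    linear_combination (norm := module) h - h2

/-- The matrix `𝐱̃₃₁ adj(𝐱̃₃₂) 𝐱̃₄₂ adj(𝐱̃₄₁)`, which commutes with the second odd derivatives of
invariants. -/
def loopMat (x : Configuration) : Matrix (Fin 2) (Fin 2) ℂ :=
  diffMat 2 0 x * (diffMat 2 1 x).adjugate * diffMat 3 1 x * (diffMat 3 0 x).adjugate

/-- The four relations each link two of the four mixed blocks by coordinate matrices, in a closed
cycle. Going once around the cycle turns left multiplication by `loopMat` into right multiplication.
-/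
lemma HessRelations.commute (h : HessRelations G x) :
    loopMat x * (diffMat 2 0 x * oddHess G 0 2 x) = diffMat 2 0 x * oddHess G 0 2 x * loopMat x := by
  set a := diffMat 2 0 x
  set b := diffMat 2 1 x
  set c := diffMat 3 1 x
  set d := diffMat 3 0 x
  set p := oddHess G 0 2 x
  set q := oddHess G 0 3 x
  set r := oddHess G 1 2 x
  set s := oddHess G 1 3 x
  have e1 : d.adjugate * (a * p) = -(d.det • q) := by
    rw [eq_neg_of_add_eq_zero_left h.l0, mul_neg, ← mul_assoc, Matrix.adjugate_mul, smul_mul_assoc,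
      one_mul]
  have e2 : d.det • q = -(s * c * d.adjugate) := by
    rw [← neg_mul, ← eq_neg_of_add_eq_zero_left h.r3, mul_assoc, Matrix.mul_adjugate, mul_smul_comm,
      mul_one]
  have e3 : c * s = -(b * r) := eq_neg_of_add_eq_zero_right h.l1
  have e4 : b.det • r = -(p * a * b.adjugate) := by
    rw [← neg_mul, ← eq_neg_of_add_eq_zero_right h.r2, mul_assoc, Matrix.mul_adjugate,
      mul_smul_comm, mul_one]
  calc loopMat x * (a * p) = a * b.adjugate * c * (d.adjugate * (a * p)) := by
        rw [loopMat]; simp only [mul_assoc]; rfl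
    _ = a * b.adjugate * (c * s) * c * d.adjugate := by
        rw [e1, e2, neg_neg]; simp only [mul_assoc]
    _ = -(a * (b.adjugate * b) * r * c * d.adjugate) := by
        rw [e3]; simp only [mul_assoc, mul_neg, neg_mul]
    _ = -(a * (b.det • r) * c * d.adjugate) := by
        rw [Matrix.adjugate_mul, mul_smul_comm, mul_one, mul_smul_comm, smul_mul_assoc]
    _ = a * p * loopMat x := by
        rw [e4, loopMat]; simp only [mul_assoc, mul_neg, neg_mul, neg_neg]; rfl

/-- The commutant of a non-scalar 2 × 2 matrix is two-dimensional. When `W 0 1` is non-zero, its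
elements are determined by their first row. -/
lemma eq_zero_of_commute {W C : Matrix (Fin 2) (Fin 2) ℂ} (h : W * C = C * W) (hW : W 0 1 ≠ 0)
    (h0 : C 0 0 = 0) (h1 : C 0 1 = 0) : C = 0 := by
  have e0 := congrFun (congrFun h 0) 0
  have e1 := congrFun (congrFun h 0) 1
  simp only [Matrix.mul_apply, Fin.sum_univ_two, h0, h1, mul_zero, zero_mul, add_zero, zero_add,
    mul_eq_zero, hW, false_or] at e0 e1
  ext i j
  fin_cases i <;> fin_cases j
  exacts [h0, h1, e0, e1]

lemma eq_zero_of_mul_eq_zero_left {a p : Matrix (Fin 2) (Fin 2) ℂ} (ha : a.det ≠ 0)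
    (h : a * p = 0) : p = 0 := by
  have : a.det • p = 0 := by
    rw [← one_mul p, ← smul_mul_assoc, ← Matrix.adjugate_mul, mul_assoc, h, mul_zero]
  exact (smul_eq_zero.1 this).resolve_left ha

lemma eq_zero_of_mul_eq_zero_right {a p : Matrix (Fin 2) (Fin 2) ℂ} (ha : a.det ≠ 0)
    (h : p * a = 0) : p = 0 := by
  have : a.det • p = 0 := by
    rw [← mul_one p, ← mul_smul_comm, ← Matrix.mul_adjugate, ← mul_assoc, h, zero_mul]
  exact (smul_eq_zero.1 this).resolve_left ha

/-- One vanishing mixed block forces the other three to vanish through the invertible coordinate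
matrices, and the gradients are combinations of these blocks. -/
lemma HessRelations.bodyGrad_eq_zero (h : HessRelations G x) (hx : x ∈ spacelike)
    (hW : loopMat x 0 1 ≠ 0) (h0 : (diffMat 2 0 x * oddHess G 0 2 x) 0 0 = 0)
    (h1 : (diffMat 2 0 x * oddHess G 0 2 x) 0 1 = 0) (i : Fin 4) : bodyGrad G i x = 0 := by
  have e02 : oddHess G 0 2 x = 0 := eq_zero_of_mul_eq_zero_left (det_diffMat_ne (by decide) hx)
    (eq_zero_of_commute h.commute hW h0 h1)
  have e12 : oddHess G 1 2 x = 0 := by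
    have := h.r2
    rw [e02, zero_mul, zero_add] at this
    exact eq_zero_of_mul_eq_zero_right (det_diffMat_ne (by decide) hx) this
  have e03 : oddHess G 0 3 x = 0 := by
    have := h.l0
    rw [e02, mul_zero, zero_add] at this
    exact eq_zero_of_mul_eq_zero_left (det_diffMat_ne (by decide) hx) this
  have e13 : oddHess G 1 3 x = 0 := by
    have := h.r3
    rw [e03, zero_mul, zero_add] at this
    exact eq_zero_of_mul_eq_zero_right (det_diffMat_ne (by decide) hx) this
  have hz : ∀ {M : Matrix (Fin 2) (Fin 2) ℂ}, (2 * Complex.I) • M = 0 → M = 0 := fun hM =>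
    (smul_eq_zero.1 hM).resolve_left (by simp)
  fin_cases i
  · exact hz (M := bodyGrad G 0 x) (by rw [h.g0, e02, e03]; simp)
  · exact hz (M := bodyGrad G 1 x) (by rw [h.g1, e12, e13]; simp)
  · exact hz (M := bodyGrad G 2 x) (by rw [h.g2, e02, e12]; simp)
  · exact hz (M := bodyGrad G 3 x) (by rw [h.g3, e03, e13]; simp)

/-! #### Linear combinations of four-point functions -/

lemma IsSuperconformal.add {H : SuperFun} (hG : IsSuperconformal η κ G)
    (hH : IsSuperconformal η κ H) : IsSuperconformal η κ fun x => G x + H x where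
  analytic x hx := (hG.analytic x hx).add (hH.analytic x hx)
  Q_eq α x hx := by
    rw [Q_eq_tangent, tangent_add (hG.analytic x hx).differentiableAt
      (hH.analytic x hx).differentiableAt, ← Q_eq_tangent, ← Q_eq_tangent, hG.Q_eq α x hx,
      hH.Q_eq α x hx, add_zero]
  Qbar_eq α x hx := by
    rw [Qbar_eq_tangent, tangent_add (hG.analytic x hx).differentiableAt
      (hH.analytic x hx).differentiableAt, ← Qbar_eq_tangent, ← Qbar_eq_tangent,
      hG.Qbar_eq α x hx, hH.Qbar_eq α x hx, add_zero]
  S_eq α x hx := by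
    have h1 := hG.S_eq α x hx
    have h2 := hH.S_eq α x hx
    rw [S_eq_tangent] at h1 h2 ⊢
    rw [tangent_add (hG.analytic x hx).differentiableAt (hH.analytic x hx).differentiableAt]
    simp only [mul_add, smul_add, Finset.sum_add_distrib]
    rw [add_add_add_comm, h1, h2, add_zero]
  Sbar_eq α x hx := by
    have h1 := hG.Sbar_eq α x hx
    have h2 := hH.Sbar_eq α x hx
    rw [Sbar_eq_tangent] at h1 h2 ⊢
    rw [tangent_add (hG.analytic x hx).differentiableAt (hH.analytic x hx).differentiableAt]
    simp only [mul_add, smul_add, Finset.sum_add_distrib]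
    rw [add_add_add_comm, h1, h2, add_zero]

lemma IsSuperconformal.smul (hG : IsSuperconformal η κ G) (c : ℂ) :
    IsSuperconformal η κ fun x => c • G x where
  analytic x hx := analyticAt_const_smul c (hG.analytic x hx)
  Q_eq α x hx := by
    rw [Q_eq_tangent, tangent_smul c (hG.analytic x hx).differentiableAt, ← Q_eq_tangent,
      hG.Q_eq α x hx, smul_zero]
  Qbar_eq α x hx := by
    rw [Qbar_eq_tangent, tangent_smul c (hG.analytic x hx).differentiableAt, ← Qbar_eq_tangent,
      hG.Qbar_eq α x hx, smul_zero]
  S_eq α x hx := by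
    have h1 := hG.S_eq α x hx
    rw [S_eq_tangent] at h1 ⊢
    rw [tangent_smul c (hG.analytic x hx).differentiableAt]
    simp only [mul_smul_comm, smul_comm _ c, ← Finset.smul_sum]
    rw [← smul_add, h1, smul_zero]
  Sbar_eq α x hx := by
    have h1 := hG.Sbar_eq α x hx
    rw [Sbar_eq_tangent] at h1 ⊢
    rw [tangent_smul c (hG.analytic x hx).differentiableAt]
    simp only [mul_smul_comm, smul_comm _ c, ← Finset.smul_sum]
    rw [← smul_add, h1, smul_zero]

lemma IsChiralFourPointFunction.add {H : SuperFun} (hG : IsChiralFourPointFunction η κ G)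
    (hH : IsChiralFourPointFunction η κ H) :
    IsChiralFourPointFunction η κ fun x => G x + H x := by
  have hD : ∀ i α x, x ∈ spacelike → D i α G x = 0 → D i α H x = 0 →
      D i α (fun x => G x + H x) x = 0 := fun i α x hx h1 h2 => by
    rw [D_eq_tangent, tangent_add (hG.analytic x hx).differentiableAt
      (hH.analytic x hx).differentiableAt, ← D_eq_tangent, ← D_eq_tangent, h1, h2, add_zero]
  have hDbar : ∀ i α x, x ∈ spacelike → Dbar i α G x = 0 → Dbar i α H x = 0 →
      Dbar i α (fun x => G x + H x) x = 0 := fun i α x hx h1 h2 => by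
    rw [Dbar_eq_tangent, tangent_add (hG.analytic x hx).differentiableAt
      (hH.analytic x hx).differentiableAt, ← Dbar_eq_tangent, ← Dbar_eq_tangent, h1, h2, add_zero]
  exact ⟨hG.toIsSuperconformal.add hH.toIsSuperconformal,
    fun α x hx => hD _ _ _ hx (hG.D_one α x hx) (hH.D_one α x hx),
    fun α x hx => hD _ _ _ hx (hG.D_two α x hx) (hH.D_two α x hx),
    fun α x hx => hDbar _ _ _ hx (hG.Dbar_three α x hx) (hH.Dbar_three α x hx),
    fun α x hx => hDbar _ _ _ hx (hG.Dbar_four α x hx) (hH.Dbar_four α x hx)⟩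

lemma IsChiralFourPointFunction.smul (hG : IsChiralFourPointFunction η κ G) (c : ℂ) :
    IsChiralFourPointFunction η κ fun x => c • G x := by
  have hD : ∀ i α x, x ∈ spacelike → D i α G x = 0 → D i α (fun x => c • G x) x = 0 :=
    fun i α x hx h1 => by
      rw [D_eq_tangent, tangent_smul c (hG.analytic x hx).differentiableAt, ← D_eq_tangent, h1,
        smul_zero]
  have hDbar : ∀ i α x, x ∈ spacelike → Dbar i α G x = 0 → Dbar i α (fun x => c • G x) x = 0 :=
    fun i α x hx h1 => by
      rw [Dbar_eq_tangent, tangent_smul c (hG.analytic x hx).differentiableAt, ← Dbar_eq_tangent,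
        h1, smul_zero]
  exact ⟨hG.toIsSuperconformal.smul c, fun α x hx => hD _ _ _ hx (hG.D_one α x hx),
    fun α x hx => hD _ _ _ hx (hG.D_two α x hx),
    fun α x hx => hDbar _ _ _ hx (hG.Dbar_three α x hx),
    fun α x hx => hDbar _ _ _ hx (hG.Dbar_four α x hx)⟩

end

end
end ChiralFourPoint

namespace ChiralFourPoint
noncomputable section

/-! ### Functions constant along the fibres of a submersion -/

open Filter Topology in
/-- A function whose derivative vanishes along the fibres of a map with a local section factors
locally through this map. -/
lemma eventually_eq_comp_section {E V W : Type*} [NormedAddCommGroup E] [NormedSpace ℝ E]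
    [CompleteSpace E] [NormedAddCommGroup V] [NormedSpace ℝ V] [NormedAddCommGroup W]
    [NormedSpace ℝ W] {π : E → V} {s : V → E} {h : E → W} {p : E} (hπ : ContDiffAt ℝ 1 π p)
    (hs : ContDiffAt ℝ 1 s (π p)) (hsp : s (π p) = p) (hπs : ∀ᶠ q in 𝓝 (π p), π (s q) = q)
    (hh : ∀ᶠ y in 𝓝 p, DifferentiableAt ℝ h y)
    (hker : ∀ᶠ y in 𝓝 p, ∀ w, fderiv ℝ π y w = 0 → fderiv ℝ h y w = 0) :
    ∀ᶠ y in 𝓝 p, h y = h (s (π y)) := by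
  set A := fderiv ℝ π p
  set B := fderiv ℝ s (π p)
  have hπA : HasFDerivAt π A p := (hπ.differentiableAt one_ne_zero).hasFDerivAt
  have hsB : HasFDerivAt s B (π p) := (hs.differentiableAt one_ne_zero).hasFDerivAt
  have hAB : ∀ v, A (B v) = v := by
    have h1 : HasFDerivAt (fun q => π (s q)) (A.comp B) (π p) :=
      HasFDerivAt.comp (π p) (by rw [hsp]; exact hπA) hsB
    have h2 : HasFDerivAt (fun q => π (s q)) (.id ℝ V) (π p) :=
      (hasFDerivAt_id (π p)).congr_of_eventuallyEq hπs
    intro v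
    simpa using DFunLike.congr_fun (h1.unique h2) v
  -- A change of coordinates with identity derivative at `p` which makes `π` affine: `π` is `A`
  -- after `Φ`, up to a constant. In these coordinates the fibres are parallel affine subspaces.
  set Φ : E → E := fun y => B (π y - π p) + (y - B (A (y - p))) with hΦ
  have hΦp : Φ p = p := by simp [hΦ]
  have hΦc : ContDiffAt ℝ 1 Φ p := by
    have : ContDiffAt ℝ 1 (fun y => B (π y - π p)) p := B.contDiff.contDiffAt.comp p
      (hπ.sub contDiffAt_const)
    exact this.add (by fun_prop)
  have hΦd : HasFDerivAt Φ ((ContinuousLinearEquiv.refl ℝ E : E ≃L[ℝ] E) : E →L[ℝ] E) p := by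
    have h1 : HasFDerivAt (fun y => B (π y - π p)) (B.comp A) p :=
      B.hasFDerivAt.comp p (hπA.sub_const _)
    have h2 : HasFDerivAt (fun y => y - B (A (y - p))) (.id ℝ E - B.comp A) p :=
      (hasFDerivAt_id p).sub ((B.comp A).hasFDerivAt.comp p ((hasFDerivAt_id p).sub_const p))
    have e : B.comp A + (.id ℝ E - B.comp A) =
      ((ContinuousLinearEquiv.refl ℝ E : E ≃L[ℝ] E) : E →L[ℝ] E) := by ext; simp
    exact e ▸ h1.add h2
  have hlin : ∀ y, π y = A (Φ y) + (π p - A p) := fun y => by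
    simp [hΦ, hAB]
  set Ψ := hΦc.localInverse hΦd one_ne_zero
  have hst := hΦc.hasStrictFDerivAt' hΦd one_ne_zero
  have hleft : ∀ᶠ y in 𝓝 p, Ψ (Φ y) = y := hst.eventually_left_inverse
  have hright : ∀ᶠ z in 𝓝 p, Φ (Ψ z) = z := hΦp ▸ hst.eventually_right_inverse
  have hΨc : ContDiffAt ℝ 1 Ψ p := hΦp ▸ hΦc.to_localInverse hΦd one_ne_zero
  have hΨp : Tendsto Ψ (𝓝 p) (𝓝 p) := by
    have : Tendsto Ψ (𝓝 (Φ p)) (𝓝 p) := hst.localInverse_tendsto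
    rwa [hΦp] at this
  have hΨd : ∀ᶠ z in 𝓝 p, DifferentiableAt ℝ Ψ z :=
    (hΨc.eventually (by simp)).mono fun z hz => hz.differentiableAt one_ne_zero
  have hπd : ∀ᶠ y in 𝓝 p, DifferentiableAt ℝ π y :=
    (hπ.eventually (by simp)).mono fun z hz => hz.differentiableAt one_ne_zero
  obtain ⟨r, hr, hball⟩ := Metric.eventually_nhds_iff_ball.1
    (hright.and (hΨd.and (hΨp.eventually (hπd.and (hh.and hker)))))
  -- A ball is convex, so two of its points in the same straightened fibre are joined by a segment
  -- along which `π` is constant, and the derivative of `h` vanishes there.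
  have hconst : ∀ z ∈ Metric.ball p r, ∀ z' ∈ Metric.ball p r, A (z - z') = 0 →
      h (Ψ z) = h (Ψ z') := by
    intro z hz z' hz' hA
    have hseg : ∀ t ∈ Set.Icc (0 : ℝ) 1, z' + t • (z - z') ∈ Metric.ball p r := fun t ht =>
      (convex_ball p r).add_smul_sub_mem hz' hz ht
    have hd : ∀ t ∈ Set.Icc (0 : ℝ) 1, HasDerivAt (fun t : ℝ => h (Ψ (z' + t • (z - z')))) 0 t := by
      intro t ht
      obtain ⟨-, h1, h2, h3, h4⟩ := hball _ (hseg t ht)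
      have hl : HasDerivAt (fun t : ℝ => z' + t • (z - z')) (z - z') t := by
        simpa using ((hasDerivAt_id t).smul_const (z - z')).const_add z'
      have hΨl := h1.hasFDerivAt.comp_hasDerivAt t hl
      have hhl := h3.hasFDerivAt.comp_hasDerivAt t hΨl
      refine (h4 _ ?_) ▸ hhl
      have hb : ∀ᶠ u in 𝓝 t, z' + u • (z - z') ∈ Metric.ball p r :=
        hl.continuousAt.eventually_mem (Metric.isOpen_ball.mem_nhds (hseg t ht))
      refine (h2.hasFDerivAt.comp_hasDerivAt t hΨl).unique ?_
      refine (hasDerivAt_const t (A z' + (π p - A p))).congr_of_eventuallyEq ?_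
      filter_upwards [hb] with u hu
      change π (Ψ _) = _
      rw [hlin, (hball _ hu).1, map_add, map_smul, hA, smul_zero, add_zero]
    have := constant_of_has_deriv_right_zero
      (fun t ht => (hd t ht).continuousAt.continuousWithinAt)
      (fun t ht => (hd t (Set.Ico_subset_Icc_self ht)).hasDerivWithinAt) 1 (by simp)
    simpa using this
  have hΦt : Tendsto Φ (𝓝 p) (𝓝 p) := by simpa [ContinuousAt, hΦp] using hΦc.continuousAt
  have hsπ : Tendsto (fun y => s (π y)) (𝓝 p) (𝓝 p) := by
    have : ContinuousAt (fun y => s (π y)) p := hs.continuousAt.comp hπ.continuousAt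
    simpa [ContinuousAt, hsp] using this
  filter_upwards [hleft, hsπ.eventually hleft, hΦt (Metric.ball_mem_nhds p hr),
    (hΦt.comp hsπ) (Metric.ball_mem_nhds p hr), hπ.continuousAt.eventually hπs]
    with y h1 h2 h3 h4 h5
  have h := hconst _ h3 _ h4 (by
    rw [map_sub, sub_eq_zero]
    refine add_right_cancel (b := π p - A p) ?_
    rw [← hlin, Function.comp_apply, ← hlin, h5])
  rwa [h1, Function.comp_apply, h2] at h

/-! ### Invariant functions of the bodies -/

/-- The bodies of the two cross ratios. -/
def crossRatios (x : Configuration) : ℝ × ℝ := ((body (I₁ x)).re, (body (I₂ x)).re)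

lemma body_expSum {x : Configuration} (hx : x ∈ spacelike) (f : ℝ × ℝ → ℂ) :
    body (expSum f x) = f (crossRatios x) := by
  rw [expSum, map_sum, Finset.sum_eq_single 0]
  · simp [body_superEval, crossRatios]
  · intro k _ hk
    rw [map_mul, map_smul, map_pow, body_T hx, zero_pow hk, smul_zero, zero_mul]
  · simp

lemma analyticOnNhd_crossRatios : AnalyticOnNhd ℝ crossRatios spacelike := fun x hx =>
  ((Complex.reCLM.analyticAt _).comp (analyticAt_body (unitFun_I₁.analytic x hx))).prod
    ((Complex.reCLM.analyticAt _).comp (analyticAt_body (unitFun_I₂.analytic x hx)))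

/-- The body of a linear combination of chiral invariants has vanishing derivative as soon as two
of its second odd derivatives vanish, so any three invariants have dependent derivatives. -/
lemma fderiv_dependent {F : Fin 3 → SuperFun}
    (hF : ∀ k, IsChiralFourPointFunction 0 0 (F k)) {x : Configuration} (hx : x ∈ spacelike)
    (hW : loopMat x 0 1 ≠ 0) : ∃ c : Fin 3 → ℂ, c ≠ 0 ∧
      ∀ w, ∑ k, c k * fderiv ℝ (fun y => body (F k y)) x w = 0 := by
  -- Three first rows in a space of dimension two. The coefficients of their relation also serve for
  -- the gradients, since the combination is itself an invariant whose first row is zero.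
  have hdep : ¬ LinearIndependent ℂ fun k => (diffMat 2 0 x * oddHess (F k) 0 2 x) 0 := fun h => by
    simpa using h.fintype_card_le_finrank
  obtain ⟨c, hc, k, hk⟩ := Fintype.not_linearIndependent_iff.1 hdep
  refine ⟨c, fun h => hk (congrFun h k), ?_⟩
  set G : SuperFun := fun y => c 0 • F 0 y + c 1 • F 1 y + c 2 • F 2 y with hGdef
  have hG : IsChiralFourPointFunction 0 0 G :=
    (((hF 0).smul (c 0)).add ((hF 1).smul (c 1))).add ((hF 2).smul (c 2))
  have hH : diffMat 2 0 x * oddHess G 0 2 x = ∑ k, c k • (diffMat 2 0 x * oddHess (F k) 0 2 x) := by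
    simp only [← Matrix.mul_smul, ← Matrix.mul_sum]
    congr 1
    ext α β
    simp [oddHess, hGdef, Fin.sum_univ_three, Matrix.sum_apply]
  have hz : (diffMat 2 0 x * oddHess G 0 2 x) 0 = 0 := by
    rw [hH, ← hc]
    ext b
    simp [Matrix.sum_apply]
  have hgrad := (hG.hessRelations hx).bodyGrad_eq_zero hx hW (congrFun hz 0) (congrFun hz 1)
  have hd : ∀ k, HasFDerivAt (fun y => body (F k y)) (fderiv ℝ (fun y => body (F k y)) x) x :=
    fun k => (analyticAt_body ((hF k).analytic x hx)).differentiableAt.hasFDerivAt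
  have hsum : HasFDerivAt (fun y => body (G y))
      (c 0 • fderiv ℝ (fun y => body (F 0 y)) x + c 1 • fderiv ℝ (fun y => body (F 1 y)) x +
        c 2 • fderiv ℝ (fun y => body (F 2 y)) x) x := by
    have e : (fun y => body (G y)) =
        fun y => c 0 • body (F 0 y) + c 1 • body (F 1 y) + c 2 • body (F 2 y) := by
      funext y; simp [hGdef]
    rw [e]
    exact (((hd 0).const_smul (c 0)).add ((hd 1).const_smul (c 1))).add ((hd 2).const_smul (c 2))
  intro w
  have h0 : fderiv ℝ (fun y => body (G y)) x w = 0 := by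
    have hw : w = ∑ i, ∑ μ, w i μ • dir i μ := by
      ext i μ
      simp [dir, Finset.sum_apply, Pi.single_apply, Fin.sum_univ_four]
      fin_cases i <;> fin_cases μ <;> simp
    rw [hw]
    simp only [map_sum, map_smul, ← body_dx _ _ (hG.analytic x hx).differentiableAt,
      body_dx_eq_zero (hgrad _), smul_zero, Finset.sum_const_zero]
  rw [hsum.fderiv] at h0
  rw [Fin.sum_univ_three]
  simpa using h0

open Filter Topology in
/-- The derivative of an invariant chiral function is a combination of the derivatives of the cross
ratios. -/
lemma IsChiralFourPointFunction.fderiv_eq_zero {G : SuperFun}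
    (hG : IsChiralFourPointFunction 0 0 G) {x : Configuration} (hx : x ∈ spacelike)
    (hW : loopMat x 0 1 ≠ 0) (hsurj : Function.Surjective (fderiv ℝ crossRatios x))
    {w : Configuration} (hw : fderiv ℝ crossRatios x w = 0) :
    fderiv ℝ (fun y => body (G y)) x w = 0 := by
  have h1 : AnalyticOnNhd ℝ (fun p : ℝ × ℝ => (p.1 : ℂ)) crossRatioRange := fun p _ =>
    (Complex.ofRealCLM.analyticAt _).comp analyticAt_fst
  have h2 : AnalyticOnNhd ℝ (fun p : ℝ × ℝ => (p.2 : ℂ)) crossRatioRange := fun p _ =>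
    (Complex.ofRealCLM.analyticAt _).comp analyticAt_snd
  obtain ⟨c, hc, h⟩ := fderiv_dependent (F := ![G, expSum fun p => p.1, expSum fun p => p.2])
    (fun k => by fin_cases k; exacts [hG, isChiral_expSum h1, isChiral_expSum h2]) hx hW
  have hπ : HasFDerivAt crossRatios (fderiv ℝ crossRatios x) x :=
    (analyticOnNhd_crossRatios x hx).differentiableAt.hasFDerivAt
  have hU := isOpen_spacelike.mem_nhds hx
  have e1 : HasFDerivAt (fun y => body (expSum (fun p => (p.1 : ℂ)) y))
      (Complex.ofRealCLM.comp ((ContinuousLinearMap.fst ℝ ℝ ℝ).comp (fderiv ℝ crossRatios x))) x := by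
    refine HasFDerivAt.congr_of_eventuallyEq (Complex.ofRealCLM.hasFDerivAt.comp x
      ((ContinuousLinearMap.fst ℝ ℝ ℝ).hasFDerivAt.comp x hπ)) ?_
    filter_upwards [hU] with y hy using body_expSum hy _
  have e2 : HasFDerivAt (fun y => body (expSum (fun p => (p.2 : ℂ)) y))
      (Complex.ofRealCLM.comp ((ContinuousLinearMap.snd ℝ ℝ ℝ).comp (fderiv ℝ crossRatios x))) x := by
    refine HasFDerivAt.congr_of_eventuallyEq (Complex.ofRealCLM.hasFDerivAt.comp x
      ((ContinuousLinearMap.snd ℝ ℝ ℝ).hasFDerivAt.comp x hπ)) ?_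
    filter_upwards [hU] with y hy using body_expSum hy _
  simp only [Fin.sum_univ_three, Matrix.cons_val_zero, Matrix.cons_val_one, Matrix.cons_val,
    e1.fderiv, e2.fderiv] at h
  -- If the relation did not involve `G`, the two cross ratios would have dependent differentials,
  -- against surjectivity.
  by_cases h0 : c 0 = 0
  · refine absurd (funext fun k => ?_) hc
    obtain ⟨w1, hw1⟩ := hsurj (1, 0)
    obtain ⟨w2, hw2⟩ := hsurj (0, 1)
    have a1 := h w1
    have a2 := h w2
    simp [hw1, h0] at a1
    simp [hw2, h0] at a2
    fin_cases k
    exacts [h0, a1, a2]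
  · have := h w
    simp [hw] at this
    exact this.resolve_left h0

/-! ### A section of the cross ratios -/

/-- A space-like configuration with given cross ratios. -/
def section₀ (q : ℝ × ℝ) : Configuration :=
  ![![((q.1⁻¹ - ((q.1⁻¹ - q.2⁻¹ + 1) / 2) ^ 2 - 1) / 2) / (q.1⁻¹ + 1),
      ((q.1⁻¹ - q.2⁻¹ + 1) / 2) / (q.1⁻¹ + 1),
      ((q.1⁻¹ - ((q.1⁻¹ - q.2⁻¹ + 1) / 2) ^ 2 + 1) / 2) / (q.1⁻¹ + 1), 1 / (q.1⁻¹ + 1)],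
    ![0, 0, 0, 1], ![0, 1 / 2, 0, 1 / 2], 0]

/-- Points 2, 3, 4 are fixed. The intervals from point 1 to 4, 2 and 3 then determine in turn y² -
t², where t and y are coordinates 0 and 2, coordinate 3 and coordinate 1. Fixing y - t = 1 / (𝓘₁⁻¹ +
1) and solving for y + t avoids square roots, so the section is rational on the whole quadrant. -/
lemma body_sq_section₀ {q : ℝ × ℝ} (hq : q ∈ crossRatioRange) :
    body (sq 0 1 (section₀ q)) = ((-(q.1⁻¹ / (q.1⁻¹ + 1)) : ℝ) : ℂ) ∧
    body (sq 0 2 (section₀ q)) = ((-(q.2⁻¹ / (q.1⁻¹ + 1) / 2) : ℝ) : ℂ) ∧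
    body (sq 0 3 (section₀ q)) = ((-(1 / (q.1⁻¹ + 1)) : ℝ) : ℂ) ∧
    body (sq 1 2 (section₀ q)) = ((-(1 / 2) : ℝ) : ℂ) ∧
    body (sq 1 3 (section₀ q)) = ((-1 : ℝ) : ℂ) ∧
    body (sq 2 3 (section₀ q)) = ((-(1 / 2) : ℝ) : ℂ) := by
  have h1 : 0 < q.1⁻¹ := inv_pos.2 hq.1
  simp only [body_sq, Complex.ofReal_inj, section₀, Matrix.cons_val_zero, Matrix.cons_val_one,
    Matrix.cons_val, Pi.zero_apply]
  generalize q.1⁻¹ = p at h1 ⊢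
  generalize q.2⁻¹ = r
  have : p + 1 ≠ 0 := by positivity
  refine ⟨?_, ?_, ?_, ?_, ?_, ?_⟩ <;> field_simp <;> ring

lemma section₀_mem {q : ℝ × ℝ} (hq : q ∈ crossRatioRange) : section₀ q ∈ spacelike := by
  obtain ⟨h01, h02, h03, h12, h13, h23⟩ := body_sq_section₀ hq
  have h1 : 0 < q.1⁻¹ := inv_pos.2 hq.1
  have h2 : 0 < q.2⁻¹ := inv_pos.2 hq.2
  have key : ∀ {i j : Fin 4} {r : ℝ}, body (sq i j (section₀ q)) = ((-r : ℝ) : ℂ) → 0 < r →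
      (section₀ q i 0 - section₀ q j 0) ^ 2 < (section₀ q i 1 - section₀ q j 1) ^ 2 +
        (section₀ q i 2 - section₀ q j 2) ^ 2 + (section₀ q i 3 - section₀ q j 3) ^ 2 := by
    intro i j r h hr
    rw [body_sq, Complex.ofReal_inj] at h
    linarith
  have k01 := key h01 (by positivity)
  have k02 := key h02 (by positivity)
  have k03 := key h03 (by positivity)
  have k12 := key h12 (by positivity)
  have k13 := key h13 (by positivity)
  have k23 := key h23 (by positivity)
  intro i j hij
  fin_cases i <;> fin_cases j <;> first | exact absurd rfl hij | skip
  all_goals simp only [Fin.zero_eta, Fin.mk_one, Fin.reduceFinMk]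
  all_goals linarith

lemma crossRatios_section₀ {q : ℝ × ℝ} (hq : q ∈ crossRatioRange) : crossRatios (section₀ q) = q := by
  obtain ⟨h01, h02, h03, h12, h13, h23⟩ := body_sq_section₀ hq
  have h1 : q.1 ≠ 0 := hq.1.ne'
  have h2 : q.2 ≠ 0 := hq.2.ne'
  have h3 : q.1⁻¹ + 1 ≠ 0 := by have := inv_pos.2 hq.1; positivity
  have h4 : 1 + q.1 ≠ 0 := by have := hq.1; positivity
  ext
  · simp only [crossRatios, I₁, crossRatio, map_mul, body_sinv, body_sq_swap 2 1, h01, h03, h12,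
      h23]
    rw [← Complex.ofReal_mul, ← Complex.ofReal_mul, ← Complex.ofReal_inv, ← Complex.ofReal_mul,
      Complex.ofReal_re]
    field_simp
  · simp only [crossRatios, I₂, crossRatio, map_mul, body_sinv, h02, h03, h12, h13]
    rw [← Complex.ofReal_mul, ← Complex.ofReal_mul, ← Complex.ofReal_inv, ← Complex.ofReal_mul,
      Complex.ofReal_re]
    field_simp

lemma analyticOnNhd_section₀ : AnalyticOnNhd ℝ section₀ crossRatioRange := by
  intro q hq
  have h3 : q.1⁻¹ + 1 ≠ 0 := by have := inv_pos.2 hq.1; positivity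
  have a1 : AnalyticAt ℝ (fun q : ℝ × ℝ => q.1⁻¹) q := analyticAt_fst.inv hq.1.ne'
  have a2 : AnalyticAt ℝ (fun q : ℝ × ℝ => q.2⁻¹) q := analyticAt_snd.inv hq.2.ne'
  have ha : AnalyticAt ℝ (fun q : ℝ × ℝ => (q.1⁻¹ - q.2⁻¹ + 1) / 2) q := by fun_prop (disch := simp)
  refine analyticAt_pi_iff.2 fun i => analyticAt_pi_iff.2 fun μ => ?_
  fin_cases i <;> fin_cases μ <;>
    simp only [section₀, Fin.zero_eta, Fin.mk_one, Fin.reduceFinMk, Matrix.cons_val_zero,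
      Matrix.cons_val_one, Matrix.cons_val, Pi.zero_apply]
  all_goals first | exact analyticAt_const | skip
  · exact (((a1.sub (ha.pow 2)).sub analyticAt_const).div analyticAt_const two_ne_zero).div
      (a1.add analyticAt_const) h3
  · exact ha.div (a1.add analyticAt_const) h3
  · exact (((a1.sub (ha.pow 2)).add analyticAt_const).div analyticAt_const two_ne_zero).div
      (a1.add analyticAt_const) h3
  · exact analyticAt_const.div (a1.add analyticAt_const) h3

/-- The generic case is needed at a single point only: continuity extends it to a neighbourhood and
the identity theorem does the rest. -/
lemma loopMat_section₀_ne : loopMat (section₀ (1, 1)) 0 1 ≠ 0 := fun h => by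
  simp [loopMat, diffMat, xTildeMat, xTilde, section₀, Matrix.mul_apply, Matrix.adjugate_fin_two,
    Fin.sum_univ_four, sigmaTildeLower, pauli] at h
  have := congrArg Complex.re h
  norm_num at this

lemma continuous_loopMat : Continuous fun x => loopMat x 0 1 := by
  have h : ∀ i j, Continuous (diffMat i j) := fun i j => by
    refine continuous_matrix fun a b => ?_
    simp only [diffMat, xTildeMat, xTilde, Matrix.sub_apply, Matrix.of_apply]
    fun_prop
  exact ((((h 2 0).matrix_mul (h 2 1).matrix_adjugate).matrix_mul (h 3 1)).matrix_mul
    (h 3 0).matrix_adjugate).matrix_elem 0 1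

end
end ChiralFourPoint

namespace ChiralFourPoint
noncomputable section

/-! ### Space-like configurations are connected -/

lemma mem_spacelike_of_ne {x : Configuration} (h0 : ∀ i, x i 0 = 0)
    (h : ∀ i j, i ≠ j → ∃ μ, x i μ ≠ x j μ) : x ∈ spacelike := by
  intro i j hij
  obtain ⟨μ, hμ⟩ := h i j hij
  have hp := sq_pos_of_ne_zero (sub_ne_zero.2 hμ)
  have h1 := sq_nonneg (x i 1 - x j 1)
  have h2 := sq_nonneg (x i 2 - x j 2)
  have h3 := sq_nonneg (x i 3 - x j 3)
  rw [h0, h0, sub_zero, zero_pow two_ne_zero]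
  fin_cases μ
  · simp [h0] at hμ
  all_goals simp only [Fin.mk_one, Fin.reduceFinMk] at hp
  all_goals linarith

/-- Two configurations at time zero with the same, pairwise different, heights. -/
lemma joinedIn_spacelike {x y : Configuration} (hx : ∀ i, x i 0 = 0) (hy : ∀ i, y i 0 = 0)
    (ℓ : (Fin 4 → ℝ) →ₗ[ℝ] ℝ) (hℓ : ∀ i, ℓ (x i) = ℓ (y i))
    (hinj : Function.Injective fun i => ℓ (y i)) : JoinedIn spacelike x y := by
  refine .of_segment_subset ?_
  rintro _ ⟨s, t, -, -, hst, rfl⟩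
  refine mem_spacelike_of_ne (fun i => by simp [hx, hy]) fun i j hij => ?_
  by_contra! h
  have e : ∀ k, ℓ ((s • x + t • y) k) = ℓ (y k) := fun k => by
    rw [Pi.add_apply, Pi.smul_apply, Pi.smul_apply, map_add, map_smul, map_smul, hℓ, ← add_smul,
      hst, one_smul]
  exact hij (hinj ((e i).symm.trans ((congrArg ℓ (funext h)).trans (e j))))

/-- Contracting all times to zero shrinks time differences and leaves the spatial distances
unchanged. -/
lemma joinedIn_spacelike_timeZero {x : Configuration} (hx : x ∈ spacelike) :
    JoinedIn spacelike x fun i => Function.update (x i) 0 0 := by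
  refine .of_segment_subset ?_
  rintro _ ⟨s, t, hs, ht, hst, rfl⟩ i j hij
  have h := hx i j hij
  have e : ∀ z : ℝ, s * z + t * z = z := fun z => by rw [← add_mul, hst, one_mul]
  have h1 : s ^ 2 ≤ 1 := pow_le_one₀ hs (by linarith)
  simp only [Pi.add_apply, Pi.smul_apply, smul_eq_mul, Function.update_self,
    Function.update_of_ne (show (1 : Fin 4) ≠ 0 by decide),
    Function.update_of_ne (show (2 : Fin 4) ≠ 0 by decide),
    Function.update_of_ne (show (3 : Fin 4) ≠ 0 by decide), e]
  refine lt_of_le_of_lt ?_ h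
  calc (s * x i 0 + t * 0 - (s * x j 0 + t * 0)) ^ 2 = s ^ 2 * (x i 0 - x j 0) ^ 2 := by ring
    _ ≤ 1 * (x i 0 - x j 0) ^ 2 := mul_le_mul_of_nonneg_right h1 (sq_nonneg _)
    _ = _ := one_mul _

/-- A linear function of the spatial coordinates. -/
def height (τ : ℝ) : (Fin 4 → ℝ) →ₗ[ℝ] ℝ :=
  LinearMap.proj 1 + τ • LinearMap.proj 2 + τ ^ 2 • LinearMap.proj 3

lemma height_apply (τ : ℝ) (v : Fin 4 → ℝ) : height τ v = v 1 + τ * v 2 + τ ^ 2 * v 3 := rfl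

open Polynomial in
-- The coefficients run along the moment curve. For two distinct spatial positions the heights agree
-- only at the roots of a non-zero polynomial in τ, so the product over all pairs is non-zero
-- somewhere.
lemma exists_injective_height {x : Configuration} (hx : x ∈ spacelike) :
    ∃ τ, Function.Injective fun i => height τ (x i) := by
  set P : Fin 4 → Fin 4 → ℝ[X] := fun i j =>
    C (x i 1 - x j 1) + C (x i 2 - x j 2) * X + C (x i 3 - x j 3) * X ^ 2 with hP
  have hP0 : ∀ i j, i ≠ j → P i j ≠ 0 := fun i j hij h => by
    have e := fun k => congrArg (coeff · k) h
    have e0 := e 0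
    have e1 := e 1
    have e2 := e 2
    simp only [hP, coeff_add, coeff_C_mul, coeff_X, coeff_C, coeff_X_pow, coeff_zero] at e0 e1 e2
    norm_num at e0 e1 e2
    have := hx i j hij
    rw [e0, e1, e2] at this
    nlinarith [sq_nonneg (x i 0 - x j 0)]
  have hQ : ∏ p ∈ Finset.univ.filter (fun p : Fin 4 × Fin 4 => p.1 ≠ p.2), P p.1 p.2 ≠ 0 :=
    Finset.prod_ne_zero_iff.2 fun p hp => hP0 _ _ (Finset.mem_filter.1 hp).2
  obtain ⟨τ, hτ⟩ : ∃ τ, eval τ (∏ p ∈ Finset.univ.filter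
      (fun p : Fin 4 × Fin 4 => p.1 ≠ p.2), P p.1 p.2) ≠ 0 := by
    by_contra! h
    exact hQ (Polynomial.funext fun τ => by rw [h, eval_zero])
  refine ⟨τ, fun i j hij => ?_⟩
  by_contra hne
  rw [eval_prod, Finset.prod_ne_zero_iff] at hτ
  refine hτ (i, j) (by simpa using hne) ?_
  simp only [height_apply] at hij
  simp [hP]
  linear_combination hij

lemma isPreconnected_spacelike : IsPreconnected spacelike := by
  have hb : ∀ i j : Fin 4, ((i : ℕ) : ℝ) = ((j : ℕ) : ℝ) → i = j := fun i j h =>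
    Fin.ext (by exact_mod_cast h)
  set b : Configuration := fun i => ![0, 0, ((i : ℕ) : ℝ), 0]
  have key : ∀ x ∈ spacelike, JoinedIn spacelike x b := by
    intro x hx
    have h1 := joinedIn_spacelike_timeZero hx
    obtain ⟨τ, hτ⟩ := exists_injective_height h1.target_mem
    refine h1.trans ?_
    set y : Configuration := fun i => Function.update (x i) 0 0
    have hy : ∀ i, y i 0 = 0 := fun i => Function.update_self ..
    -- An intermediate configuration with the generic heights of `y` and the second coordinates of
    -- `b`. Along either straight segment one injective linear function of the points stays
    -- constant, so the points never collide.
    set z : Configuration := fun i => ![0, height τ (y i) - ((i : ℕ) : ℝ) * τ, ((i : ℕ) : ℝ), 0]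
    have hz : ∀ i, height τ (y i) = height τ (z i) := fun i => by
      rw [height_apply τ (z i)]
      simp [z]
      ring
    refine (joinedIn_spacelike hy (fun i => rfl) (height τ) hz ?_).trans
      (joinedIn_spacelike (fun i => rfl) (fun i => rfl) (LinearMap.proj 2) (fun i => rfl)
        fun i j h => hb i j h)
    intro i j h
    exact hτ ((hz i).trans (h.trans (hz j).symm))
  have hbm : b ∈ spacelike := (key _ (section₀_mem (q := (1, 1)) (by simp [crossRatioRange]))).target_mem
  have : IsPathConnected spacelike := ⟨b, hbm, fun {y} hy => (key y hy).symm⟩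
  exact this.isConnected.isPreconnected

/-! ### Invariant chiral functions depend only on the cross ratios -/

open Filter Topology in
-- Near the point over (1, 1) the body is constant along the fibres of the cross ratios. Both sides
-- are analytic on a connected set, so agreement near one point propagates.
lemma IsChiralFourPointFunction.body_eq_section₀ {G : SuperFun}
    (hG : IsChiralFourPointFunction 0 0 G) {x : Configuration} (hx : x ∈ spacelike) :
    body (G x) = body (G (section₀ (crossRatios x))) := by
  have hq : ((1, 1) : ℝ × ℝ) ∈ crossRatioRange := by simp [crossRatioRange]
  set p := section₀ (1, 1) with hp
  have hpU : p ∈ spacelike := section₀_mem hq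
  have hπp : crossRatios p = (1, 1) := crossRatios_section₀ hq
  have hU : ∀ᶠ y in 𝓝 p, y ∈ spacelike := isOpen_spacelike.mem_nhds hpU
  have hπ := analyticOnNhd_crossRatios
  have hs : AnalyticAt ℝ section₀ (crossRatios p) := hπp ▸ analyticOnNhd_section₀ _ hq
  have hbG : AnalyticOnNhd ℝ (fun y => body (G y)) spacelike := fun y hy =>
    analyticAt_body (hG.analytic y hy)
  have hπs : ∀ᶠ q in 𝓝 (crossRatios p), crossRatios (section₀ q) = q := by
    rw [hπp]
    filter_upwards [isOpen_crossRatioRange.mem_nhds hq] with q hq using crossRatios_section₀ hq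
  have hsp : section₀ (crossRatios p) = p := by rw [hπp]
  set B := fderiv ℝ section₀ (crossRatios p)
  -- At `p` the composite with the derivative of the section is the identity. Units form an open
  -- set, so the cross ratios have surjective derivative nearby.
  have hunit : ∀ᶠ y in 𝓝 p, IsUnit ((fderiv ℝ crossRatios y).comp B) := by
    have hc : ContinuousAt (fun y => (fderiv ℝ crossRatios y).comp B) p :=
      ((hπ p hpU).fderiv.continuousAt).clm_comp continuousAt_const
    refine hc.eventually_mem (Units.isOpen.mem_nhds ?_)
    have h1 : HasFDerivAt (fun q => crossRatios (section₀ q)) ((fderiv ℝ crossRatios p).comp B)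
        (crossRatios p) := HasFDerivAt.comp (g := crossRatios) _
      (by rw [hsp]; exact (hπ p hpU).differentiableAt.hasFDerivAt) hs.differentiableAt.hasFDerivAt
    have h2 : HasFDerivAt (fun q => crossRatios (section₀ q)) (.id ℝ (ℝ × ℝ)) (crossRatios p) :=
      (hasFDerivAt_id _).congr_of_eventuallyEq hπs
    rw [Set.mem_ofPred_eq, h1.unique h2]
    exact isUnit_one
  have hloop : ∀ᶠ y in 𝓝 p, loopMat y 0 1 ≠ 0 :=
    continuous_loopMat.continuousAt.eventually_ne loopMat_section₀_ne
  have hloc := eventually_eq_comp_section (h := fun y => body (G y)) (hπ p hpU).contDiffAt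
    hs.contDiffAt hsp hπs (hU.mono fun y hy => (hbG y hy).differentiableAt) <| by
      filter_upwards [hU, hunit, hloop] with y h1 h2 h3 w hw
      refine hG.fderiv_eq_zero h1 h3 (fun v => ?_) hw
      obtain ⟨u, hu⟩ := h2
      refine ⟨B ((↑u⁻¹ : (ℝ × ℝ) →L[ℝ] (ℝ × ℝ)) v), ?_⟩
      have := DFunLike.congr_fun u.mul_inv v
      rw [hu] at this
      exact this
  have hcomp : AnalyticOnNhd ℝ (fun y => body (G (section₀ (crossRatios y)))) spacelike := fun y hy =>
    AnalyticAt.fun_comp (g := fun z => body (G z)) (f := fun y => section₀ (crossRatios y))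
      (hbG _ (section₀_mem (crossRatios_mem hy)))
      (AnalyticAt.fun_comp (f := crossRatios) (analyticOnNhd_section₀ _ (crossRatios_mem hy)) (hπ y hy))
  exact hbG.eqOn_of_preconnected_of_eventuallyEq hcomp isPreconnected_spacelike hpU hloc hx

/-! ### The form of the four-point functions -/

lemma body_prefactor_ne (η : Fin 4 → ℝ) {x : Configuration} (hx : x ∈ spacelike) :
    body (prefactor η x) ≠ 0 := by
  have h : ∀ {i j : Fin 4}, i ≠ j → ∀ r : ℝ, body (sq i j x) ^ (r : ℂ) ≠ 0 := fun hij r =>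
    (Complex.cpow_ne_zero_iff_of_exponent_ne_zero · |>.2 ((unitFun_sq hij).ne x hx)) |> fun h => by
      by_cases hr : (r : ℂ) = 0
      · simp [hr]
      · exact h hr
  simp only [prefactor, map_mul, body_spow]
  exact mul_ne_zero (mul_ne_zero (h (by decide) _) (h (by decide) _)) (h (by decide) _)

lemma body_expD (η : Fin 4 → ℝ) (f : ℝ × ℝ → ℂ) {x : Configuration} (hx : x ∈ spacelike) :
    body (expD η f x) = f (crossRatios x) * body (prefactor η x) := by
  change body (expSum f x * prefactor η x) = _
  rw [map_mul, body_expSum hx]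

lemma expD_zero (η : Fin 4 → ℝ) (x : Configuration) : expD η 0 x = 0 := by
  have h : ∀ k, eulerOp^[k] 0 = 0 := fun k => by
    induction k with
    | zero => rfl
    | succ k ih =>
      rw [Function.iterate_succ_apply', ih]
      funext p
      simp [eulerOp]
  have h2 : ∀ A B, superEval 0 A B = 0 := fun A B => by
    simp [superEval]
  simp [expD, h, h2]

/-- The zeroth-order coefficient is determined by the body. -/
lemma expD_unique {η κ : Fin 4 → ℝ} {G : SuperFun} (hG : IsChiralFourPointFunction η κ G)
    (hm : Matched η κ) {f : ℝ × ℝ → ℂ} (hf : AnalyticOnNhd ℝ f crossRatioRange)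
    (h : ∀ x ∈ spacelike, body (G x) = f (crossRatios x) * body (prefactor η x))
    {x : Configuration} (hx : x ∈ spacelike) : G x = expD η f x := by
  have hd := (hG.add ((isChiral_expD hm hf).smul (-1))).eq_zero (fun y hy => by
    rw [map_add, map_smul, h y hy, body_expD η f hy, smul_eq_mul]; ring) hx
  rwa [neg_smul, one_smul, ← sub_eq_add_neg, sub_eq_zero] at hd

/-- If the body is non-zero somewhere, the weights match, the prefactor can be divided out, and f is
the body of the quotient along the section. Otherwise the identities say nothing about the weights,
but the function is zero and f = 0 serves. -/
theorem IsChiralFourPointFunction.exists_expD {η κ : Fin 4 → ℝ} {G : SuperFun}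
    (hG : IsChiralFourPointFunction η κ G) (hκ : ∑ i, κ i = 0) :
    ∃ f : ℝ × ℝ → ℂ, AnalyticOnNhd ℝ f crossRatioRange ∧ ∀ x ∈ spacelike, G x = expD η f x := by
  by_cases h : ∃ x ∈ spacelike, body (G x) ≠ 0
  · obtain ⟨x, hx, hne⟩ := h
    have hm := hG.matched hκ hx hne
    have hs := hκ
    rw [Fin.sum_univ_four, hm.h0, hm.h1, hm.h2, hm.h3] at hs
    have hH := hG.mul_powers hm .zero (p := η 2 - η 1) (q := η 3) (r := η 1)
      (by simp only [Pi.zero_apply]; linarith) (by simp) (by simp) (by simp)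
    set H : SuperFun := fun x => (spow (sq 0 2 x) (η 2 - η 1) * spow (sq 0 3 x) (η 3) *
      spow (sq 1 2 x) (η 1)) * G x with hHdef
    have hf : AnalyticOnNhd ℝ (fun q => body (H (section₀ q))) crossRatioRange := fun q hq =>
      AnalyticAt.fun_comp (g := fun z => body (H z)) (analyticAt_body (hH.analytic _ (section₀_mem hq)))
        (analyticOnNhd_section₀ q hq)
    refine ⟨_, hf, fun y hy => expD_unique hG hm hf (fun z hz => ?_) hy⟩
    rw [← hH.body_eq_section₀ hz]
    have e : ∀ {i j : Fin 4}, i ≠ j → ∀ r : ℝ,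
        body (sq i j z) ^ (r : ℂ) * body (sq i j z) ^ (-r : ℂ) = 1 := fun hij r => by
      rw [← Complex.cpow_add _ _ ((unitFun_sq hij).ne z hz), add_neg_cancel, Complex.cpow_zero]
    simp only [hHdef, prefactor, map_mul, body_spow, Complex.ofReal_neg]
    have e1 := e (show (0 : Fin 4) ≠ 2 by decide) (η 2 - η 1)
    have e2 := e (show (0 : Fin 4) ≠ 3 by decide) (η 3)
    have e3 := e (show (1 : Fin 4) ≠ 2 by decide) (η 1)
    have key : ∀ {a a' b b' c c' g : ℂ}, a * a' = 1 → b * b' = 1 → c * c' = 1 →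
        g = a * b * c * g * (a' * b' * c') := fun {a a' b b' c c' g} ha hb hc => by
      calc g = (a * a') * (b * b') * (c * c') * g := by rw [ha, hb, hc]; ring
        _ = _ := by ring
    exact key e1 e2 e3
  · push Not at h
    refine ⟨0, fun _ _ => analyticAt_const, fun x hx => ?_⟩
    rw [hG.eq_zero h hx, expD_zero]

/-! ### Expansions in the nilpotent invariants -/

lemma body_nilInv (k i j : Fin 2) (x : Configuration) : body (nilInv k i j x) = 0 := by
  have h : ∀ β, body (ΘbarTilde j x β) = 0 := fun β => by
    simp [ΘbarTilde, θdiff, body_θ]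
  simp [nilInv, contract, h]

/-- Each nilpotent invariant has a spinor factor without body, so the body of any expansion sees
only the coefficient of the empty monomial. -/
lemma body_nilMonomial (m : Fin 2 × Fin 2 × Fin 2 → ℕ) (x : Configuration) :
    body (nilMonomial m x) = if m = 0 then 1 else 0 := by
  simp only [nilMonomial, map_list_prod, List.map_flatMap, List.map_map, Function.comp_def, map_pow,
    body_nilInv]
  split_ifs with h
  · subst h
    simp [List.finRange]
  · obtain ⟨⟨k, i, j⟩, hk⟩ := Function.ne_iff.1 h
    refine List.prod_eq_zero ?_
    simp only [List.mem_flatMap, List.mem_map, List.mem_finRange, true_and]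
    exact ⟨k, i, j, zero_pow hk⟩

lemma IsNilpotentExpansion.body_eq {η : Fin 4 → ℝ} {G : SuperFun}
    {c : (Fin 2 × Fin 2 × Fin 2 → ℕ) →₀ (ℝ × ℝ → ℂ)} (h : IsNilpotentExpansion η G c)
    {x : Configuration} (hx : x ∈ spacelike) :
    body (G x) = c 0 (crossRatios x) * body (prefactor η x) := by
  rw [h x hx, map_mul, Finsupp.sum, map_sum]
  congr 1
  simp only [map_mul, body_superEval, body_nilMonomial, mul_ite, mul_one, mul_zero]
  rw [Finset.sum_ite_eq' c.support 0]
  split_ifs with h0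
  · rfl
  · rw [Finsupp.notMem_support_iff.1 h0, Pi.zero_apply]

end
end ChiralFourPoint

theorem mainTheorem1 (η κ : Fin 4 → ℝ) (hκ : ∑ i, κ i = 0) :
    (∀ G : SuperFun, IsChiralFourPointFunction η κ G →
      ∃ f : ℝ × ℝ → ℂ, AnalyticOnNhd ℝ f crossRatioRange ∧
        (∀ x ∈ spacelike, G x = expD η f x) ∧
        (∀ c : (Fin 2 × Fin 2 × Fin 2 → ℕ) →₀ (ℝ × ℝ → ℂ),
          IsNilpotentExpansion η G c → Set.EqOn (c 0) f crossRatioRange)) ∧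
    (κ 0 = η 0 / 3 → κ 1 = η 1 / 3 → κ 2 = -(η 2 / 3) → κ 3 = -(η 3 / 3) →
      ∀ f : ℝ × ℝ → ℂ, AnalyticOnNhd ℝ f crossRatioRange →
        IsChiralFourPointFunction η κ (expD η f)) ∧
    (IsSuperconformal 0 0 T ∧ ∀ x ∈ spacelike, IsNilpotent (T x)) := by
  refine ⟨fun G hG => ?_, fun h0 h1 h2 h3 f hf => isChiral_expD ⟨h0, h1, h2, h3, hκ⟩ hf,
    isSuperconformal_T, fun x hx => isNilpotent_T hx⟩
  obtain ⟨f, hf, hGf⟩ := hG.exists_expD hκ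
  refine ⟨f, hf, hGf, fun c hc q hq => ?_⟩
  -- Every pair of positive numbers is the value of the cross ratios on the section, and the
  -- prefactor has non-zero body, so the bodies determine `c 0` on the whole quadrant.
  have hx := section₀_mem hq
  have h := hc.body_eq hx
  rw [hGf _ hx, body_expD η f hx, crossRatios_section₀ hq] at h
  exact (mul_right_cancel₀ (body_prefactor_ne η hx) h).symm
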